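/- Let $n\ge 1$ and let $A$ be an $n\times n$ random self-adjoint matrix over $\mathbb{R}$, $\mathbb{C}$ or the quaternions $\mathbb{H}$, drawn from the Gaussian Orthogonal ($\beta=1$), Unitary ($\beta=2$) or Symplectic ($\beta=4$) Ensemble, normalized as follows: the entries on and above the diagonal are independent, the diagonal entries are real with law $N(0,2/\beta)$, and the $\beta$ real coordinates of each entry above the diagonal are independent with law $N(0,1/\beta)$. (For $\beta=2$ this is the standard normal distribution on the space of Hermitian matrices with the Hilbert--Schmidt inner product.) For $k\ge 1$ let $$W_k=\operatorname{tr}T_k\Bigl(\tfrac{1}{2\sqrt n}A\Bigr)-\mathbb{E}\operatorname{tr}T_k\Bigl(\tfrac{1}{2\sqrt n}A\Bigr),$$ where $T_k$ is the $k$-th Chebyshev polynomial of the first kind and $\operatorname{tr}$ is the sum of the $n$ diagonal entries. Let $Z_1,\dots,Z_d$ be independent standard normal random variables, and let $d_W$ be the $L^1$-Wasserstein distance on $\mathbb{R}^d$ with the Euclidean norm, $d_W(X,Y)=\sup_f|\mathbb{E}f(X)-\mathbb{E}f(Y)|$ over all $1$-Lipschitz $f:\mathbb{R}^d\to\mathbb{R}$.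 For the GUE, for every $d$ there is a constant $K_d>0$ depending only on $d$ such that, for all $n\ge 1$, $$d_W\Bigl((W_1,\dots,W_d),\bigl(\tfrac12 Z_1,\tfrac{\sqrt2}{2}Z_2,\dots,\tfrac{\sqrt d}{2}Z_d\bigr)\Bigr)\le\frac{K_d}{n}.$$ The same holds for the GOE and the GSE with the limiting vector multiplied by $\sqrt{2/\beta}$, that is, by $\sqrt2$ for the GOE and by $1/\sqrt2$ for the GSE. The rate is optimal: in each of the three cases, if $d\ge 2$, there is a constant $c_d>0$ such that the distance above is at least $c_d/n$ for all sufficiently large $n$. -/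

import Mathlib

open MeasureTheory ProbabilityTheory Filter
open scoped Quaternion ENNReal

noncomputable section

/-- The `L¹`-Wasserstein distance between two probability measures on `ℝᵈ` (with finite first
moments): the supremum of `|∫ f dμ - ∫ f dν|` over the functions `f : ℝᵈ → ℝ` that are
`1`-Lipschitz for the Euclidean norm. -/
def wassersteinDist {d : ℕ} (μ ν : Measure (EuclideanSpace ℝ (Fin d))) : ℝ≥0∞ :=
  ⨆ f : {f : EuclideanSpace ℝ (Fin d) → ℝ // LipschitzWith 1 f},
    ENNReal.ofReal |∫ x, f.1 x ∂μ - ∫ x, f.1 x ∂ν|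

/-- The law of `β n²` independent real standard normal variables, `β` for each entry of an
`n × n` matrix. -/
def normalCoords (β n : ℕ) : Measure (Fin n → Fin n → Fin β → ℝ) :=
  Measure.pi fun _ => Measure.pi fun _ => Measure.pi fun _ => gaussianReal 0 1

section Ensembles

variable {𝔽 : Type} [Ring 𝔽] [StarRing 𝔽] [Algebra ℝ 𝔽] {β : ℕ}

/-- The `n × n` matrix over `𝔽` whose entry `(i, j)` has the real coordinates `x i j` with respect
to the real basis `u` of `𝔽`. -/
def coordMatrix (u : Fin β → 𝔽) (n : ℕ) (x : Fin n → Fin n → Fin β → ℝ) :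
    Matrix (Fin n) (Fin n) 𝔽 :=
  Matrix.of fun i j => ∑ c, x i j c • u c

/-- The self-adjoint matrix `(G + G*) / √(2β)`, where `G` has the coordinates `x`. If these are
independent standard normal variables and `𝔽` is `ℝ`, `ℂ` or `ℍ` with its standard basis
(`β = 1, 2, 4`), the entries on and above the diagonal are independent, the diagonal ones are
real with law `N(0, 2/β)`, and those above the diagonal have `β` independent `N(0, 1/β)`
coordinates. -/
def ensembleMatrix (u : Fin β → 𝔽) (n : ℕ) (x : Fin n → Fin n → Fin β → ℝ) :
    Matrix (Fin n) (Fin n) 𝔽 :=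
  (Real.sqrt (2 * β))⁻¹ • (coordMatrix u n x + (coordMatrix u n x).conjTranspose)

/-- `tr T_k(A / (2√n))`, with `T_k` the Chebyshev polynomial of the first kind. For self-adjoint
`A` this trace is real, and `re` only reads it as a real number. -/
def chebyshevTrace (re : 𝔽 → ℝ) (k n : ℕ) (A : Matrix (Fin n) (Fin n) 𝔽) : ℝ :=
  re (Matrix.trace
    (Polynomial.aeval ((2 * Real.sqrt n)⁻¹ • A) (Polynomial.Chebyshev.T ℝ (k : ℤ))))

/-- The random vector `(W_1, …, W_d)`, `W_k = tr T_k(A / (2√n)) - 𝔼 tr T_k(A / (2√n))`. -/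
def centeredTraces (re : 𝔽 → ℝ) (u : Fin β → 𝔽) (n d : ℕ) (x : Fin n → Fin n → Fin β → ℝ) :
    EuclideanSpace ℝ (Fin d) :=
  WithLp.toLp 2 fun j =>
    chebyshevTrace re ((j : ℕ) + 1) n (ensembleMatrix u n x)
      - ∫ y, chebyshevTrace re ((j : ℕ) + 1) n (ensembleMatrix u n y) ∂(normalCoords β n)

/-- The law of `(W_1, …, W_d)`. -/
def centeredTracesLaw (re : 𝔽 → ℝ) (u : Fin β → 𝔽) (n d : ℕ) :
    Measure (EuclideanSpace ℝ (Fin d)) :=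
  (normalCoords β n).map (centeredTraces re u n d)

end Ensembles

/-- The law of `(W_1, …, W_d)` for the Gaussian Unitary Ensemble: Hermitian `A`, diagonal entries
`N(0, 1)`, real and imaginary parts of the entries above the diagonal `N(0, 1/2)`, that is, the
standard normal distribution on the Hermitian matrices with the Hilbert-Schmidt inner product. -/
def gueLaw (n d : ℕ) : Measure (EuclideanSpace ℝ (Fin d)) :=
  centeredTracesLaw (𝔽 := ℂ) Complex.re ![1, Complex.I] n d

/-- The law of `(W_1, …, W_d)` for the Gaussian Orthogonal Ensemble: real symmetric `A`, diagonal
entries `N(0, 2)`, entries above the diagonal `N(0, 1)`. -/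
def goeLaw (n d : ℕ) : Measure (EuclideanSpace ℝ (Fin d)) :=
  centeredTracesLaw (𝔽 := ℝ) id ![1] n d

/-- The law of `(W_1, …, W_d)` for the Gaussian Symplectic Ensemble: quaternionic self-adjoint `A`,
diagonal entries `N(0, 1/2)`, the four real coordinates of the entries above the diagonal
`N(0, 1/4)`. The trace is the sum of the `n` diagonal quaternions. -/
def gseLaw (n d : ℕ) : Measure (EuclideanSpace ℝ (Fin d)) :=
  centeredTracesLaw (𝔽 := ℍ[ℝ]) (fun q => q.re)
    ![1, ⟨0, 1, 0, 0⟩, ⟨0, 0, 1, 0⟩, ⟨0, 0, 0, 1⟩] n d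

/-- The law of `s • (½ Z_1, (√2 / 2) Z_2, …, (√d / 2) Z_d)`, with `Z_1, …, Z_d` independent
standard normal variables. -/
def limitLaw (d : ℕ) (s : ℝ) : Measure (EuclideanSpace ℝ (Fin d)) :=
  (Measure.pi fun _ : Fin d => gaussianReal 0 1).map fun z =>
    WithLp.toLp 2 fun j => s * (Real.sqrt ((j : ℕ) + 1) / 2) * z j

end

/-!
Write `X = A / (2√n)`, let `σ` be the integral of polynomials against the semicircle law on
`[-1, 1]`, and let `τ(q) = tr q(X) - n σ(q)`. The proof is Stein's method applied to an exact family
of identities for the random functional `τ`; only polynomials, moments and Gaussian integration by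
parts are used, and no spectral theory.

*The loop equation.* Let `ρ = 2 / β` and `κ = 2 / β - 1`. Integration by parts in the independent
normal coordinates of `X` expresses `𝔼 τ(X q) P`, for a polynomial `q` and a function `P` of the
matrix, through divided differences of `q`
(`IsTraceModel.integral_centeredEval_X_mul`). For `q = U_k`, the Chebyshev polynomial of the second
kind, the part of the equation that is linear in `τ` combines to `T_{k+1}`, because averaging the
divided difference of `U_k` against `σ` gives `2 U_{k-1}` (`dividedDiff_semicircle_U`). Hence
`𝔼 τ(T_{k+1}) P` is, up to a constant times `𝔼 P`, the sum of `1 / (4n)` times the expectation of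
`((τ ⊗ τ)(∂ U_k) + κ τ(U_k')) P` and of a term in the gradient of `P`. If `P` is a function of
`W = (W_1, …, W_d)`, the coefficients of the gradient term are the products
`∇ tr T_{j+1}(X) · ∇ tr T_{k+1}(X) / (k + 1) = (j + 1) ρ / (4n) tr (U_j U_k)(X)`; as the `U_k` are
orthonormal for `σ`, this is the diagonal covariance of the limit law plus a multiple of
`τ(U_j U_k) / n`. The structure
`IsTraceModel` isolates the contraction rules of Gaussian matrices behind these identities, and
`IsStandardBasis.isTraceModel` verifies them for `ℝ`, `ℂ` and `ℍ` at once.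

*The upper bound.* Each term of the loop equation for a product of centered power traces has lower
total degree, so that all mixed moments of `τ` are bounded uniformly in `n`
(`LoopEquations.uniformlyBounded`). The error terms above are thus of order `1 / n` in `L¹`, and `W`
satisfies Stein's identity up to `O(1 / n)` (`IsTraceModel.steinIdentity`). Along the rotation
`cos θ • W + sin θ • Z` of `W` into an independent vector `Z` with the limit law, the derivative of
`𝔼 h` consists of these errors alone. The error in the covariance meets the second derivatives of
`h`; integrating by parts in `Z` removes one derivative, which leaves a bound by the Lipschitz
constant of `h`, hence the rate for the `L¹`-Wasserstein distance
(`SteinIdentity.wassersteinDist_le`).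

*The lower bound.* For `T_2` the quadratic error vanishes and `U_1 ^ 2 = 2 T_2 + 2`, so that
`𝔼 W_2 g(W_2) = 𝔼 (ρ / 2 + (ρ / n) (W_2 + κ / 2)) g'(W_2)` exactly. For `g(w) = exp(-w² / 2)` this
shows that if `𝔼 W_2 exp(-W_2² / 2)` and `𝔼 W_2² exp(-W_2² / 2)`, which are expectations of
Lipschitz functions, were both within `o(1 / n)` of their values for the limit law, then the second
limit value would vanish; it is positive (`IsTraceModel.le_wassersteinDist`).
-/

/-! ### Functions of polynomial growth -/

/-- `f` is bounded in norm by a polynomial in the norm of its argument. -/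
def PolyGrowth {E V : Type*} [Norm E] [Norm V] (f : E → V) : Prop :=
  ∃ C : ℝ, 0 ≤ C ∧ ∃ m : ℕ, ∀ x, ‖f x‖ ≤ C * (1 + ‖x‖) ^ m

/-- A `C¹` function that has polynomial growth together with its derivative. -/
structure Tame {E V : Type*} [NormedAddCommGroup E] [NormedSpace ℝ E] [NormedAddCommGroup V]
    [NormedSpace ℝ V] (f : E → V) : Prop where
  contDiff : ContDiff ℝ 1 f
  growth : PolyGrowth f
  growth_fderiv : PolyGrowth (fderiv ℝ f)

namespace PolyGrowth

section

variable {E F V W : Type*} [NormedAddCommGroup E] [NormedAddCommGroup F] [NormedAddCommGroup V]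
  [NormedAddCommGroup W]

lemma of_bounded {f : E → V} {C : ℝ} (h : ∀ x, ‖f x‖ ≤ C) : PolyGrowth f :=
  ⟨C, (norm_nonneg _).trans (h 0), 0, by simpa using h⟩

lemma of_le {f : E → V} {g : E → W} (hg : PolyGrowth g) (h : ∀ x, ‖f x‖ ≤ ‖g x‖) :
    PolyGrowth f := by
  obtain ⟨C, hC, m, hm⟩ := hg
  exact ⟨C, hC, m, fun x => (h x).trans (hm x)⟩

lemma const (c : V) : PolyGrowth (fun _ : E => c) := of_bounded fun _ => le_rfl

lemma add {f g : E → V} (hf : PolyGrowth f) (hg : PolyGrowth g) :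
    PolyGrowth (fun x => f x + g x) := by
  obtain ⟨C, hC, m, hm⟩ := hf
  obtain ⟨D, hD, k, hk⟩ := hg
  refine ⟨C + D, by positivity, m + k, fun x => (norm_add_le _ _).trans ?_⟩
  have h1 : (1 : ℝ) ≤ 1 + ‖x‖ := by simp
  rw [add_mul]
  refine add_le_add ((hm x).trans ?_) ((hk x).trans ?_)
  · exact mul_le_mul_of_nonneg_left (pow_le_pow_right₀ h1 (by omega)) hC
  · exact mul_le_mul_of_nonneg_left (pow_le_pow_right₀ h1 (by omega)) hD

/-- A function dominated by a product of two functions of polynomial growth has polynomial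
growth; this serves products, scalar multiples and compositions of linear maps alike. -/
lemma of_le_mul {U : Type*} [NormedAddCommGroup U] {f : E → V} {g : E → W} {h : E → U}
    (hf : PolyGrowth f) (hg : PolyGrowth g)
    (hle : ∀ x, ‖h x‖ ≤ ‖f x‖ * ‖g x‖) : PolyGrowth h := by
  obtain ⟨C, hC, m, hm⟩ := hf
  obtain ⟨D, hD, k, hk⟩ := hg
  refine ⟨C * D, by positivity, m + k, fun x => (hle x).trans ?_⟩
  calc ‖f x‖ * ‖g x‖ ≤ (C * (1 + ‖x‖) ^ m) * (D * (1 + ‖x‖) ^ k) :=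
        mul_le_mul (hm x) (hk x) (norm_nonneg _) (by positivity)
    _ = _ := by rw [pow_add]; ring

lemma comp {f : E → V} {g : F → E} (hf : PolyGrowth f) (hg : PolyGrowth g) :
    PolyGrowth (fun x => f (g x)) := by
  obtain ⟨C, hC, m, hm⟩ := hf
  obtain ⟨D, hD, k, hk⟩ := hg
  refine ⟨C * (1 + D) ^ m, by positivity, k * m, fun x => (hm _).trans ?_⟩
  rw [mul_assoc, pow_mul, ← mul_pow]
  refine mul_le_mul_of_nonneg_left (pow_le_pow_left₀ (by positivity) ?_ m) hC
  have h1 : (1 : ℝ) ≤ (1 + ‖x‖) ^ k := one_le_pow₀ (by simp)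
  have := hk x
  nlinarith

lemma id : PolyGrowth (fun x : E => x) :=
  ⟨1, zero_le_one, 1, fun x => by simp⟩

end

variable {E V : Type*} [NormedAddCommGroup E] [NormedAddCommGroup V]

lemma integrable [MeasurableSpace E] [OpensMeasurableSpace E] [SecondCountableTopology E]
    {μ : Measure E} [IsProbabilityMeasure μ]
    (hμ : ∀ m : ℕ, Integrable (fun x => ‖x‖ ^ m) μ) {f : E → V} (hf : PolyGrowth f)
    (hc : Continuous f) : Integrable f μ := by
  obtain ⟨C, hC, m, hm⟩ := hf
  have h1 : Integrable (fun x => C * (1 + ‖x‖) ^ m) μ := by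
    refine Integrable.const_mul ?_ C
    simp_rw [add_pow, one_pow, one_mul]
    exact integrable_finsetSum _ fun i _ => (hμ _).mul_const _
  exact h1.mono' hc.aestronglyMeasurable (ae_of_all _ hm)

end PolyGrowth

namespace Tame

variable {E F V W : Type*} [NormedAddCommGroup E] [NormedSpace ℝ E] [NormedAddCommGroup F]
  [NormedSpace ℝ F] [NormedAddCommGroup V] [NormedSpace ℝ V] [NormedAddCommGroup W]
  [NormedSpace ℝ W]

lemma differentiable {f : E → V} (hf : Tame f) : Differentiable ℝ f :=
  hf.contDiff.differentiable one_ne_zero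

lemma continuous {f : E → V} (hf : Tame f) : Continuous f := hf.contDiff.continuous

lemma continuous_fderiv {f : E → V} (hf : Tame f) : Continuous (fderiv ℝ f) :=
  hf.contDiff.continuous_fderiv one_ne_zero

lemma growth_fderiv_apply {f : E → V} (hf : Tame f) (v : E) :
    PolyGrowth (fun x => fderiv ℝ f x v) :=
  PolyGrowth.of_le_mul hf.growth_fderiv (PolyGrowth.const v)
    fun x => (fderiv ℝ f x).le_opNorm v

lemma continuous_fderiv_apply {f : E → V} (hf : Tame f) (v : E) :
    Continuous (fun x => fderiv ℝ f x v) :=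
  hf.continuous_fderiv.clm_apply continuous_const

lemma const (c : V) : Tame (fun _ : E => c) where
  contDiff := contDiff_const
  growth := PolyGrowth.const c
  growth_fderiv := PolyGrowth.of_bounded (C := 0) fun x => by simp

lemma clm (L : E →L[ℝ] V) : Tame (fun x => L x) where
  contDiff := L.contDiff
  growth := PolyGrowth.of_le_mul (PolyGrowth.const (E := E) L) PolyGrowth.id fun x => L.le_opNorm x
  growth_fderiv := PolyGrowth.of_bounded (C := ‖L‖) fun x => by simp

lemma add {f g : E → V} (hf : Tame f) (hg : Tame g) : Tame (fun x => f x + g x) where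
  contDiff := hf.contDiff.add hg.contDiff
  growth := hf.growth.add hg.growth
  growth_fderiv := by
    refine (hf.growth_fderiv.add hg.growth_fderiv).of_le fun x => ?_
    rw [fderiv_fun_add (hf.differentiable x) (hg.differentiable x)]

lemma comp {f : E → V} {g : F → E} (hf : Tame f) (hg : Tame g) : Tame (fun x => f (g x)) where
  contDiff := hf.contDiff.comp hg.contDiff
  growth := hf.growth.comp hg.growth
  growth_fderiv := by
    refine PolyGrowth.of_le_mul (hf.growth_fderiv.comp hg.growth) hg.growth_fderiv fun x => ?_
    rw [fderiv_fun_comp x (hf.differentiable (g x)) (hg.differentiable x)]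
    exact ContinuousLinearMap.opNorm_comp_le _ _

lemma mul {𝒜 : Type*} [NormedRing 𝒜] [NormedAlgebra ℝ 𝒜] {f g : E → 𝒜} (hf : Tame f)
    (hg : Tame g) : Tame (fun x => f x * g x) where
  contDiff := hf.contDiff.mul hg.contDiff
  growth := PolyGrowth.of_le_mul hf.growth hg.growth fun x => norm_mul_le _ _
  growth_fderiv := by
    have h1 : PolyGrowth fun x => f x • fderiv ℝ g x :=
      PolyGrowth.of_le_mul hf.growth hg.growth_fderiv fun x =>
        ContinuousLinearMap.opNorm_le_bound _ (by positivity) fun v => by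
          rw [mul_assoc]
          exact (norm_mul_le _ _).trans
            (mul_le_mul_of_nonneg_left ((fderiv ℝ g x).le_opNorm v) (norm_nonneg _))
    have h2 : PolyGrowth fun x => MulOpposite.op (g x) • fderiv ℝ f x :=
      PolyGrowth.of_le_mul hf.growth_fderiv hg.growth fun x =>
        ContinuousLinearMap.opNorm_le_bound _ (by positivity) fun v => by
          rw [mul_right_comm]
          exact (norm_mul_le _ _).trans
            (mul_le_mul_of_nonneg_right ((fderiv ℝ f x).le_opNorm v) (norm_nonneg _))
    refine (h1.add h2).of_le fun x => ?_
    rw [fderiv_fun_mul' (hf.differentiable x) (hg.differentiable x)]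

lemma const_mul {f : E → ℝ} (hf : Tame f) (c : ℝ) : Tame (fun x => c * f x) := (const c).mul hf

lemma sub {f g : E → ℝ} (hf : Tame f) (hg : Tame g) : Tame (fun x => f x - g x) := by
  simpa [sub_eq_add_neg] using hf.add (hg.const_mul (-1))

lemma pow {𝒜 : Type*} [NormedRing 𝒜] [NormedAlgebra ℝ 𝒜] {f : E → 𝒜} (hf : Tame f) (k : ℕ) :
    Tame (fun x => f x ^ k) := by
  induction k with
  | zero => simpa using const (1 : 𝒜)
  | succ k ih => simpa [pow_succ] using ih.mul hf

lemma sum {ι : Type*} (s : Finset ι) {f : ι → E → V} (hf : ∀ i ∈ s, Tame (f i)) :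
    Tame (fun x => ∑ i ∈ s, f i x) := by
  classical
  induction s using Finset.induction_on with
  | empty => simpa using const (0 : V)
  | insert a s ha ih =>
    simp_rw [Finset.sum_insert ha]
    exact (hf a (by simp)).add (ih fun i hi => hf i (by simp [hi]))

lemma multiset_prod (s : Multiset ℕ) {f : ℕ → E → ℝ} (hf : ∀ i, Tame (f i)) :
    Tame (fun x => (s.map fun i => f i x).prod) := by
  induction s using Multiset.induction_on with
  | empty => simpa using const (1 : ℝ)
  | cons a s ih => simpa using (hf a).mul ih

/-- A bounded `C¹` function with bounded derivative is tame. -/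
lemma of_bounded {f : E → V} {C D : ℝ} (hf : ContDiff ℝ 1 f) (hC : ∀ x, ‖f x‖ ≤ C)
    (hD : ∀ x, ‖fderiv ℝ f x‖ ≤ D) : Tame f :=
  ⟨hf, PolyGrowth.of_bounded hC, PolyGrowth.of_bounded hD⟩

variable [MeasurableSpace E] [OpensMeasurableSpace E] [SecondCountableTopology E]
  {μ : Measure E} [IsProbabilityMeasure μ]

lemma integrable (hμ : ∀ m : ℕ, Integrable (fun x => ‖x‖ ^ m) μ) {f : E → V} (hf : Tame f) :
    Integrable f μ :=
  hf.growth.integrable hμ hf.continuous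

lemma integrable_fderiv (hμ : ∀ m : ℕ, Integrable (fun x => ‖x‖ ^ m) μ) {f : E → V}
    (hf : Tame f) (v : E) : Integrable (fun x => fderiv ℝ f x v) μ :=
  (hf.growth_fderiv_apply v).integrable hμ (hf.continuous_fderiv_apply v)

end Tame

/-! ### Gaussian integration by parts -/

/-- All moments of the norm are finite under `μ`. -/
def FiniteMoments {E : Type*} [NormedAddCommGroup E] [MeasurableSpace E] (μ : Measure E) : Prop :=
  ∀ m : ℕ, Integrable (fun x => ‖x‖ ^ m) μ

/-- The integration by parts formula `∫ ℓ(x) f(x) dμ = ∫ ∂_v f(x) dμ` for tame functions `f`. It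
holds for a standard normal coordinate `ℓ`, with `v` the corresponding basis vector. -/
def IntegrationByParts {E : Type*} [NormedAddCommGroup E] [NormedSpace ℝ E] [MeasurableSpace E]
    (μ : Measure E) (v : E) (ℓ : E →L[ℝ] ℝ) : Prop :=
  ∀ f : E → ℝ, Tame f → ∫ x, ℓ x * f x ∂μ = ∫ x, fderiv ℝ f x v ∂μ

lemma finiteMoments_gaussianReal : FiniteMoments (gaussianReal 0 1) := fun m => by
  have h := (memLp_id_gaussianReal' (μ := 0) (v := 1) m (by simp)).integrable_norm_pow'
  simpa using h

lemma hasDerivAt_gaussianPDFReal (x : ℝ) :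
    HasDerivAt (gaussianPDFReal 0 1) (-x * gaussianPDFReal 0 1 x) x := by
  have h : HasDerivAt (fun x : ℝ => (√(2 * Real.pi * 1))⁻¹ * Real.exp (-(x - 0) ^ 2 / (2 * 1)))
      ((√(2 * Real.pi * 1))⁻¹ * (Real.exp (-(x - 0) ^ 2 / (2 * 1)) * (-x))) x := by
    refine HasDerivAt.const_mul _ (HasDerivAt.exp ?_)
    have := ((((hasDerivAt_id x).sub_const 0).pow 2).neg).div_const (2 * 1)
    exact this.congr_deriv (by simp; ring)
  have h2 : gaussianPDFReal 0 1 =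
      fun x : ℝ => (√(2 * Real.pi * 1))⁻¹ * Real.exp (-(x - 0) ^ 2 / (2 * 1)) := by
    ext x
    simp [gaussianPDFReal]
  rw [h2]
  convert h using 1
  ring

lemma integrable_gaussianPDFReal_mul {f : ℝ → ℝ} (hf : Integrable f (gaussianReal 0 1)) :
    Integrable (fun x => gaussianPDFReal 0 1 x * f x) := by
  rw [gaussianReal_of_var_ne_zero _ one_ne_zero,
    integrable_withDensity_iff_integrable_smul' (measurable_gaussianPDF 0 1)
      (ae_of_all _ fun x => by simp [gaussianPDF])] at hf
  simpa [toReal_gaussianPDF] using hf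

lemma integrationByParts_gaussianReal :
    IntegrationByParts (gaussianReal 0 1) 1 (ContinuousLinearMap.id ℝ ℝ) := by
  intro f hf
  have hμ := finiteMoments_gaussianReal
  rw [integral_gaussianReal_eq_integral_smul one_ne_zero,
    integral_gaussianReal_eq_integral_smul one_ne_zero]
  have hx : Integrable (fun x => x * f x) (gaussianReal 0 1) :=
    ((Tame.clm (ContinuousLinearMap.id ℝ ℝ)).mul hf).integrable hμ
  have h := integral_mul_deriv_eq_deriv_mul_of_integrable (u := gaussianPDFReal 0 1) (v := f)
    (u' := fun x => -x * gaussianPDFReal 0 1 x) (v' := fun x => fderiv ℝ f x 1)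
    (fun x _ => hasDerivAt_gaussianPDFReal x)
    (fun x _ => by simpa using (hf.differentiable x).hasFDerivAt.hasDerivAt)
    (integrable_gaussianPDFReal_mul (hf.integrable_fderiv hμ 1))
    ((integrable_gaussianPDFReal_mul hx).neg.congr
      (ae_of_all _ fun x => by simp; ring))
    (integrable_gaussianPDFReal_mul (hf.integrable hμ))
  simp only [smul_eq_mul, h, ← integral_neg]
  congr 1
  ext x
  simp
  ring

lemma fderiv_comp_clm_add {E F : Type*} [NormedAddCommGroup E] [NormedSpace ℝ E]
    [NormedAddCommGroup F] [NormedSpace ℝ F] {f : E → ℝ} (hf : Differentiable ℝ f) (L : F →L[ℝ] E)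
    (c : E) (x v : F) :
    fderiv ℝ (fun x => f (L x + c)) x v = fderiv ℝ f (L x + c) (L v) := by
  have h : HasFDerivAt (fun x => f (L x + c)) ((fderiv ℝ f (L x + c)).comp L) x :=
    (hf _).hasFDerivAt.comp x (L.hasFDerivAt.add_const c)
  rw [h.fderiv]
  rfl

lemma Fin.insertNth_eq_single_add {E : Type*} [NormedAddCommGroup E] [NormedSpace ℝ E]
    {m : ℕ} (i : Fin (m + 1)) (x : E) (y : Fin m → E) :
    (i.insertNth x y : Fin (m + 1) → E) =
      ContinuousLinearMap.single ℝ (fun _ => E) i x + (i.insertNth 0 y : Fin (m + 1) → E) := by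
  ext j
  refine Fin.succAboveCases i ?_ (fun k => ?_) j <;> simp

lemma FiniteMoments.pi {E : Type*} [NormedAddCommGroup E] [MeasurableSpace E]
    [OpensMeasurableSpace E] [SecondCountableTopology E] {κ : Type*}
    [Fintype κ] {μ : κ → Measure E} [∀ i, IsProbabilityMeasure (μ i)]
    (hμ : ∀ i, FiniteMoments (μ i)) : FiniteMoments (Measure.pi μ) := by
  intro m
  have h1 : Integrable (fun x : κ → E => 1 + ∑ i, ‖x i‖ ^ m) (Measure.pi μ) :=
    (integrable_const _).add (integrable_finsetSum _ fun i _ =>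
      integrable_comp_eval (μ := μ) (i := i) (f := fun y : E => ‖y‖ ^ m) (hμ i m))
  refine h1.mono' (by fun_prop) (ae_of_all _ fun x => ?_)
  have hs : 0 ≤ ∑ i, ‖x i‖ ^ m := Finset.sum_nonneg fun i _ => by positivity
  rw [norm_pow, norm_norm]
  cases isEmpty_or_nonempty κ with
  | inl h =>
    have : ‖x‖ = 0 := by simp [Subsingleton.elim x 0]
    rw [this]
    exact (pow_le_one₀ le_rfl zero_le_one).trans (by linarith)
  | inr h =>
    obtain ⟨i, hi⟩ : ∃ i, ‖x‖ = ‖x i‖ := by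
      obtain ⟨i, -, hi⟩ := Finset.exists_mem_eq_sup Finset.univ Finset.univ_nonempty
        (fun i => ‖x i‖₊)
      exact ⟨i, by rw [← coe_nnnorm, ← coe_nnnorm, Pi.nnnorm_def, hi]⟩
    rw [hi]
    have := Finset.single_le_sum (f := fun i => ‖x i‖ ^ m) (fun i _ => by positivity)
      (Finset.mem_univ i)
    linarith

/-- Integration by parts in one coordinate of a product measure, by Fubini's theorem. -/
lemma IntegrationByParts.pi {E : Type*} [NormedAddCommGroup E] [NormedSpace ℝ E]
    [MeasurableSpace E] [BorelSpace E] [SecondCountableTopology E] {m : ℕ}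
    {μ : Fin m → Measure E} [∀ i, IsProbabilityMeasure (μ i)] (hμ : ∀ i, FiniteMoments (μ i))
    {i : Fin m} {v : E} {ℓ : E →L[ℝ] ℝ} (h : IntegrationByParts (μ i) v ℓ) :
    IntegrationByParts (Measure.pi μ) (Pi.single i v) (ℓ.comp (ContinuousLinearMap.proj i)) := by
  intro f hf
  obtain _ | m := m
  · exact i.elim0
  have hmp := (measurePreserving_piFinSuccAbove μ i).symm
  have hemb :=
    (MeasurableEquiv.piFinSuccAbove (fun _ : Fin (m + 1) => E) i).symm.measurableEmbedding
  have hm := FiniteMoments.pi hμ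
  have hI1 : Integrable (fun x : Fin (m + 1) → E => ℓ (x i) * f x) (Measure.pi μ) :=
    ((Tame.clm (ℓ.comp (ContinuousLinearMap.proj (φ := fun _ : Fin (m + 1) => E) i))).mul
      hf).integrable hm
  have hI2 := hf.integrable_fderiv hm (Pi.single i v)
  change ∫ x : Fin (m + 1) → E, ℓ (x i) * f x ∂_ = _
  have hJ1 := (hmp.integrable_comp_emb hemb).2 hI1
  have hJ2 := (hmp.integrable_comp_emb hemb).2 hI2
  simp only [Function.comp_def] at hJ1 hJ2
  rw [← hmp.integral_comp hemb, ← hmp.integral_comp hemb, integral_prod_symm _ hJ1,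
    integral_prod_symm _ hJ2]
  refine integral_congr_ae (ae_of_all _ fun y => ?_)
  have ht : Tame fun x : E => ContinuousLinearMap.single ℝ (fun _ : Fin (m + 1) => E) i x +
      (i.insertNth 0 y : Fin (m + 1) → E) := (Tame.clm _).add (Tame.const _)
  have h2 := h _ (hf.comp ht)
  have h3 : ∀ x, (MeasurableEquiv.piFinSuccAbove (fun _ : Fin (m + 1) => E) i).symm (x, y) =
      ContinuousLinearMap.single ℝ (fun _ : Fin (m + 1) => E) i x +
      (i.insertNth 0 y : Fin (m + 1) → E) := fun x => Fin.insertNth_eq_single_add i x y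
  simp only [h3]
  convert h2 using 3 with x x
  · simp
  · rw [fderiv_comp_clm_add hf.differentiable]
    simp

/-! ### Stein's method along a rotation -/

/-- The standard normal distribution on `ℝᵈ`. -/
noncomputable def stdNormal (d : ℕ) : Measure (Fin d → ℝ) := Measure.pi fun _ => gaussianReal 0 1

instance (d : ℕ) : IsProbabilityMeasure (stdNormal d) := by
  unfold stdNormal
  infer_instance

lemma finiteMoments_stdNormal (d : ℕ) : FiniteMoments (stdNormal d) :=
  FiniteMoments.pi fun _ => finiteMoments_gaussianReal

lemma integrationByParts_stdNormal {d : ℕ} (j : Fin d) :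
    IntegrationByParts (stdNormal d) (Pi.single j 1) (ContinuousLinearMap.proj j) :=
  IntegrationByParts.pi (fun _ => finiteMoments_gaussianReal) integrationByParts_gaussianReal

lemma integral_sq_stdNormal {d : ℕ} (j : Fin d) : ∫ z, z j ^ 2 ∂(stdNormal d) = 1 := by
  set L : (Fin d → ℝ) →L[ℝ] ℝ := ContinuousLinearMap.proj j with hL
  have h := integrationByParts_stdNormal j L (Tame.clm L)
  simp only [ContinuousLinearMap.fderiv, hL, ContinuousLinearMap.proj_apply, Pi.single_eq_same,
    integral_const, probReal_univ, one_smul] at h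
  simpa only [sq] using h

lemma integrable_eval_stdNormal {d : ℕ} (j : Fin d) :
    Integrable (fun z => z j) (stdNormal d) :=
  (Tame.clm (ContinuousLinearMap.proj (R := ℝ) (φ := fun _ : Fin d => ℝ) j)).integrable
    (finiteMoments_stdNormal d)

lemma integral_abs_stdNormal_le {d : ℕ} (j : Fin d) : ∫ z, |z j| ∂(stdNormal d) ≤ 1 := by
  have h2 : Integrable (fun z => z j ^ 2) (stdNormal d) :=
    ((Tame.clm (ContinuousLinearMap.proj (R := ℝ) (φ := fun _ : Fin d => ℝ) j)).pow 2).integrable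
      (finiteMoments_stdNormal d)
  calc ∫ z, |z j| ∂(stdNormal d) ≤ ∫ z, (1 + z j ^ 2) / 2 ∂(stdNormal d) := by
        refine integral_mono (integrable_eval_stdNormal j).abs
          (((integrable_const _).add h2).div_const 2) fun z => ?_
        have := sq_abs (z j)
        have := sq_nonneg (|z j| - 1)
        simp only
        linarith
    _ = 1 := by
        rw [integral_div, integral_add (integrable_const _) h2, integral_sq_stdNormal]
        norm_num

/-- The linear map `z ↦ (s_1 z_1, …, s_d z_d)` into Euclidean space. -/
noncomputable def diagScale {d : ℕ} (s : Fin d → ℝ) : (Fin d → ℝ) →L[ℝ] EuclideanSpace ℝ (Fin d) :=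
  (EuclideanSpace.equiv (Fin d) ℝ).symm.toContinuousLinearMap.comp
    (ContinuousLinearMap.pi fun j => s j • ContinuousLinearMap.proj j)

lemma diagScale_apply {d : ℕ} (s : Fin d → ℝ) (z : Fin d → ℝ) :
    diagScale s z = WithLp.toLp 2 fun j => s j * z j := by
  ext j
  simp [diagScale]

lemma diagScale_single {d : ℕ} (s : Fin d → ℝ) (j : Fin d) :
    diagScale s (Pi.single j 1) = s j • EuclideanSpace.single j (1 : ℝ) := by
  ext i
  rw [diagScale_apply]
  by_cases h : i = j
  · subst h; simp
  · simp [h]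

lemma EuclideanSpace.clm_apply_eq_sum {d : ℕ} (L : EuclideanSpace ℝ (Fin d) →L[ℝ] ℝ)
    (v : EuclideanSpace ℝ (Fin d)) : L v = ∑ k, v k * L (EuclideanSpace.single k 1) := by
  have h : v = ∑ k, v k • EuclideanSpace.single k (1 : ℝ) := by
    ext i
    simp [Finset.sum_apply, Pi.single_apply]
  conv_lhs => rw [h]
  simp

/-- A `C¹` function that is bounded together with its derivative. -/
structure BddC1 {E : Type*} [NormedAddCommGroup E] [NormedSpace ℝ E] (g : E → ℝ) : Prop where
  contDiff : ContDiff ℝ 1 g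
  bound : ∃ C, ∀ y, ‖g y‖ ≤ C
  bound_fderiv : ∃ C, ∀ y, ‖fderiv ℝ g y‖ ≤ C

lemma BddC1.tame {E : Type*} [NormedAddCommGroup E] [NormedSpace ℝ E] {g : E → ℝ} (hg : BddC1 g) :
    Tame g := by
  obtain ⟨C, hC⟩ := hg.bound
  obtain ⟨D, hD⟩ := hg.bound_fderiv
  exact Tame.of_bounded hg.contDiff hC hD

lemma BddC1.comp_clm_add {E F : Type*} [NormedAddCommGroup E] [NormedSpace ℝ E]
    [NormedAddCommGroup F] [NormedSpace ℝ F] {g : E → ℝ} (hg : BddC1 g) (L : F →L[ℝ] E) (c : E) :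
    BddC1 fun x => g (L x + c) := by
  obtain ⟨C, hC⟩ := hg.bound
  obtain ⟨D, hD⟩ := hg.bound_fderiv
  refine ⟨hg.contDiff.comp (L.contDiff.add contDiff_const), ⟨C, fun y => hC _⟩, D * ‖L‖,
    fun y => ContinuousLinearMap.opNorm_le_bound _
      (mul_nonneg ((norm_nonneg _).trans (hD 0)) (norm_nonneg _)) fun v => ?_⟩
  rw [fderiv_comp_clm_add hg.tame.differentiable]
  calc _ ≤ ‖fderiv ℝ g (L y + c)‖ * ‖L v‖ := ContinuousLinearMap.le_opNorm _ _
    _ ≤ D * (‖L‖ * ‖v‖) := mul_le_mul (hD _) (L.le_opNorm v) (norm_nonneg _)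
        ((norm_nonneg _).trans (hD 0))
    _ = _ := by ring

/-- The perturbed Stein identity of a random vector `W` in `ℝᵈ` with respect to the centered
normal law with independent coordinates of variances `s_k²`: the deviation from Stein's
characterization is carried by the matrix `G` and the vector `R`. -/
def SteinIdentity {d : ℕ} {Ω : Type*} [MeasurableSpace Ω] (μ : Measure Ω)
    (W : Ω → EuclideanSpace ℝ (Fin d)) (s : Fin d → ℝ) (G : Fin d → Fin d → Ω → ℝ)
    (R : Fin d → Ω → ℝ) : Prop :=
  ∀ g : EuclideanSpace ℝ (Fin d) → ℝ, BddC1 g → ∀ k,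
    ∫ ω, W ω k * g (W ω) ∂μ =
      ∑ j, ∫ ω, G j k ω * fderiv ℝ g (W ω) (EuclideanSpace.single j 1) ∂μ
        + s k ^ 2 * ∫ ω, fderiv ℝ g (W ω) (EuclideanSpace.single k 1) ∂μ
        + ∫ ω, R k ω * g (W ω) ∂μ

section Rotation

variable {d : ℕ} {Ω : Type*} [MeasurableSpace Ω] {μ : Measure Ω}
  {W : Ω → EuclideanSpace ℝ (Fin d)} {s : Fin d → ℝ} {G : Fin d → Fin d → Ω → ℝ}
  {R : Fin d → Ω → ℝ} {a b : ℝ} {p : EuclideanSpace ℝ (Fin d) → ℝ}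

lemma integrable_mul_comp_add (hW : Measurable W) {f : Ω × (Fin d → ℝ) → ℝ}
    (hf : Integrable f (μ.prod (stdNormal d))) (hp : Continuous p) {C : ℝ} (hC : ∀ y, ‖p y‖ ≤ C) :
    Integrable (fun x => f x * p (a • W x.1 + b • diagScale s x.2)) (μ.prod (stdNormal d)) := by
  refine hf.mul_bdd (c := C) ?_ (ae_of_all _ fun x => hC _)
  exact (hp.measurable.comp (by fun_prop)).aestronglyMeasurable

/-- Gaussian integration by parts in the `j`-th normal coordinate. -/
lemma integral_mul_coord [IsProbabilityMeasure μ] (hW : Measurable W)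
    (hp : BddC1 p) {f : Ω → ℝ} (hf : Integrable f μ)
    (j : Fin d) :
    ∫ x, f x.1 * x.2 j * p (a • W x.1 + b • diagScale s x.2) ∂(μ.prod (stdNormal d)) =
      b * s j * ∫ x, f x.1 * fderiv ℝ p (a • W x.1 + b • diagScale s x.2)
        (EuclideanSpace.single j 1) ∂(μ.prod (stdNormal d)) := by
  obtain ⟨C, hC⟩ := hp.bound
  obtain ⟨D, hD⟩ := hp.bound_fderiv
  have h1 := integrable_mul_comp_add (μ := μ) (a := a) (b := b) (s := s) hW
    (hf.mul_prod (integrable_eval_stdNormal j)) hp.tame.continuous hC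
  have h2 := integrable_mul_comp_add (μ := μ) (a := a) (b := b) (s := s) hW
    (hf.mul_prod (integrable_const (μ := stdNormal d) (1 : ℝ)))
    (hp.tame.continuous_fderiv_apply (EuclideanSpace.single j 1)) (C := D)
    (fun y => (ContinuousLinearMap.le_opNorm _ _).trans (by simpa using hD y))
  simp only [mul_one] at h2
  rw [integral_prod _ h1, integral_prod _ h2, ← integral_const_mul]
  refine integral_congr_ae (ae_of_all _ fun ω => ?_)
  have h3 := integrationByParts_stdNormal j _
    (hp.comp_clm_add (b • diagScale s) (a • W ω)).tame
  simp only [fderiv_comp_clm_add hp.tame.differentiable] at h3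
  simp only [ContinuousLinearMap.proj_apply, _root_.smul_apply, diagScale_single,
    map_smul, smul_eq_mul, add_comm _ (a • W ω), integral_const_mul] at h3
  simp only [mul_assoc, integral_const_mul, h3]
  ring

/-- The perturbed Stein identity, after smoothing by an independent normal vector. -/
lemma SteinIdentity.integral_mul [IsProbabilityMeasure μ] (h : SteinIdentity μ W s G R)
    (hW : Measurable W) (hWi : Integrable W μ) (hG : ∀ j k, Integrable (G j k) μ) (hR : ∀ k, Integrable (R k) μ)
    (hp : BddC1 p) (k : Fin d) :
    ∫ x, W x.1 k * p (a • W x.1 + b • diagScale s x.2) ∂(μ.prod (stdNormal d)) =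
      ∑ j, a * ∫ x, G j k x.1 * fderiv ℝ p (a • W x.1 + b • diagScale s x.2)
        (EuclideanSpace.single j 1) ∂(μ.prod (stdNormal d))
      + a * (s k ^ 2 * ∫ x, fderiv ℝ p (a • W x.1 + b • diagScale s x.2)
        (EuclideanSpace.single k 1) ∂(μ.prod (stdNormal d)))
      + ∫ x, R k x.1 * p (a • W x.1 + b • diagScale s x.2) ∂(μ.prod (stdNormal d)) := by
  obtain ⟨C, hC⟩ := hp.bound
  obtain ⟨D, hD⟩ := hp.bound_fderiv
  have hWk : Integrable (fun ω => W ω k) μ :=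
    (EuclideanSpace.proj (𝕜 := ℝ) k : EuclideanSpace ℝ (Fin d) →L[ℝ] ℝ).integrable_comp hWi
  have hi : ∀ f : Ω → ℝ, Integrable f μ → Integrable (fun x : Ω × (Fin d → ℝ) =>
      f x.1 * p (a • W x.1 + b • diagScale s x.2)) (μ.prod (stdNormal d)) := fun f hf =>
    integrable_mul_comp_add hW (hf.comp_fst _) hp.tame.continuous hC
  have hi' : ∀ (f : Ω → ℝ) (j : Fin d), Integrable f μ →
      Integrable (fun x : Ω × (Fin d → ℝ) => f x.1 *
        fderiv ℝ p (a • W x.1 + b • diagScale s x.2) (EuclideanSpace.single j 1))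
        (μ.prod (stdNormal d)) := fun f j hf =>
    integrable_mul_comp_add hW (hf.comp_fst _)
      (hp.tame.continuous_fderiv_apply (EuclideanSpace.single j 1)) (C := D)
      (fun y => (ContinuousLinearMap.le_opNorm _ _).trans (by simpa using hD y))
  have hi1 := fun j => hi' (fun _ => 1) j (integrable_const _)
  simp only [one_mul] at hi1
  have h3 : ∀ z, _ := fun z => h _ (hp.comp_clm_add (a • ContinuousLinearMap.id ℝ _)
    (b • diagScale s z)) k
  simp only [fderiv_comp_clm_add hp.tame.differentiable] at h3
  simp only [_root_.smul_apply, ContinuousLinearMap.id_apply, map_smul,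
    smul_eq_mul, mul_left_comm _ a, integral_const_mul] at h3
  rw [integral_prod_symm _ (hi _ hWk), integral_prod_symm _ (hi _ (hR k)),
    integral_prod_symm _ (hi1 k)]
  simp_rw [fun j => integral_prod_symm _ (hi' _ j (hG j k)), h3]
  rw [integral_add, integral_add, integral_finsetSum]
  · simp only [integral_const_mul]
  · exact fun j _ => ((hi' _ j (hG j k)).integral_prod_right).const_mul a
  · exact integrable_finsetSum _ fun j _ => ((hi' _ j (hG j k)).integral_prod_right).const_mul a
  · exact (((hi1 k).integral_prod_right).const_mul _).const_mul a
  · exact (integrable_finsetSum _ fun j _ =>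
      ((hi' _ j (hG j k)).integral_prod_right).const_mul a).add
        ((((hi1 k).integral_prod_right).const_mul _).const_mul a)
  · exact (hi _ (hR k)).integral_prod_right

lemma norm_single_one {d : ℕ} (k : Fin d) : ‖EuclideanSpace.single k (1 : ℝ)‖ = 1 := by simp

lemma bddC1_fderiv_apply {h : EuclideanSpace ℝ (Fin d) → ℝ} (hh : ContDiff ℝ 2 h)
    (h1 : ∀ y, ‖fderiv ℝ h y‖ ≤ 1) {M : ℝ} (hM : ∀ y, ‖fderiv ℝ (fderiv ℝ h) y‖ ≤ M) (k : Fin d) :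
    BddC1 fun y => fderiv ℝ h y (EuclideanSpace.single k 1) := by
  have hc : ContDiff ℝ 1 (fderiv ℝ h) := hh.fderiv_right (by norm_num)
  refine ⟨hc.clm_apply contDiff_const, ⟨1, fun y => ?_⟩, M, fun y => ?_⟩
  · exact (ContinuousLinearMap.le_opNorm _ _).trans (by simpa using h1 y)
  · refine ContinuousLinearMap.opNorm_le_bound _ (le_trans (by positivity) (hM 0)) fun v => ?_
    have h2 : HasFDerivAt (fun y => fderiv ℝ h y (EuclideanSpace.single k 1))
        (((ContinuousLinearMap.apply ℝ ℝ (EuclideanSpace.single k 1))).comp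
          (fderiv ℝ (fderiv ℝ h) y)) y :=
      (ContinuousLinearMap.apply ℝ ℝ (EuclideanSpace.single k (1 : ℝ))).hasFDerivAt.comp y
        (hc.differentiable one_ne_zero y).hasFDerivAt
    rw [h2.fderiv]
    calc ‖fderiv ℝ (fderiv ℝ h) y v (EuclideanSpace.single k 1)‖
        ≤ ‖fderiv ℝ (fderiv ℝ h) y v‖ * ‖EuclideanSpace.single k (1 : ℝ)‖ :=
          ContinuousLinearMap.le_opNorm _ _
      _ ≤ M * ‖v‖ := by
          rw [norm_single_one, mul_one]
          exact (ContinuousLinearMap.le_opNorm _ _).trans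
            (mul_le_mul_of_nonneg_right (hM y) (norm_nonneg _))

lemma LipschitzWith.integrable_comp_of_one {E Ω : Type*} [NormedAddCommGroup E]
    [MeasurableSpace Ω] {μ : Measure Ω} [IsProbabilityMeasure μ] {W : Ω → E} (hWi : Integrable W μ)
    {h : E → ℝ} (hlip : LipschitzWith 1 h) :
    Integrable (fun ω => h (W ω)) μ := by
  refine ((integrable_const |h 0|).add hWi.norm).mono'
    (hlip.continuous.comp_aestronglyMeasurable hWi.aestronglyMeasurable) (ae_of_all _ fun ω => ?_)
  have h2 := hlip.dist_le_mul (W ω) 0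
  rw [Real.dist_eq, dist_zero_right] at h2
  have h3 := abs_sub_abs_le_abs_sub (h (W ω)) (h 0)
  simp only [NNReal.coe_one, one_mul] at h2
  simp only [Real.norm_eq_abs, Pi.add_apply]
  linarith

lemma integrable_rotation [IsProbabilityMeasure μ] (hWi : Integrable W μ) (a b : ℝ) :
    Integrable (fun x : Ω × (Fin d → ℝ) => a • W x.1 + b • diagScale s x.2)
      (μ.prod (stdNormal d)) := by
  have h1 : Integrable (fun x : Ω × (Fin d → ℝ) => W x.1) (μ.prod (stdNormal d)) :=
    hWi.comp_fst _
  have h2 : Integrable (fun z : Fin d → ℝ => diagScale s z) (stdNormal d) :=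
    (Tame.clm (diagScale s)).integrable (finiteMoments_stdNormal d)
  have h3 : Integrable (fun x : Ω × (Fin d → ℝ) => diagScale s x.2) (μ.prod (stdNormal d)) :=
    h2.comp_snd _
  exact (h1.fun_smul a).fun_add (h3.fun_smul b)

lemma hasDerivAt_integral_rotation [IsProbabilityMeasure μ] (hWi : Integrable W μ)
    {h : EuclideanSpace ℝ (Fin d) → ℝ} (hh : ContDiff ℝ 1 h) (h1 : ∀ y, ‖fderiv ℝ h y‖ ≤ 1)
    (θ : ℝ) :
    HasDerivAt (fun θ => ∫ x, h (Real.cos θ • W x.1 + Real.sin θ • diagScale s x.2)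
      ∂(μ.prod (stdNormal d)))
      (∫ x, fderiv ℝ h (Real.cos θ • W x.1 + Real.sin θ • diagScale s x.2)
        (-Real.sin θ • W x.1 + Real.cos θ • diagScale s x.2) ∂(μ.prod (stdNormal d))) θ := by
  have hdiff : Differentiable ℝ h := hh.differentiable one_ne_zero
  have hlip : LipschitzWith 1 h := lipschitzWith_of_nnnorm_fderiv_le hdiff fun y => h1 y
  have hint := fun θ =>
    hlip.integrable_comp_of_one (integrable_rotation (s := s) hWi (Real.cos θ) (Real.sin θ))
  have hZi : Integrable (fun z => diagScale s z) (stdNormal d) :=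
    (Tame.clm (diagScale s)).integrable (finiteMoments_stdNormal d)
  refine (hasDerivAt_integral_of_dominated_loc_of_deriv_le (s := Set.univ)
    (bound := fun x : Ω × (Fin d → ℝ) => ‖W x.1‖ + ‖diagScale s x.2‖)
    (F := fun θ x => h (Real.cos θ • W x.1 + Real.sin θ • diagScale s x.2))
    (F' := fun θ x => fderiv ℝ h (Real.cos θ • W x.1 + Real.sin θ • diagScale s x.2)
      (-Real.sin θ • W x.1 + Real.cos θ • diagScale s x.2)) univ_mem
    (Eventually.of_forall fun θ => (hint θ).aestronglyMeasurable) (hint θ) ?_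
    (ae_of_all _ fun x θ _ => ?_) ((hWi.norm.comp_fst _).add (hZi.norm.comp_snd _))
    (ae_of_all _ fun x θ _ => ?_)).2
  · have ha : AEStronglyMeasurable (fun x : Ω × (Fin d → ℝ) =>
        fderiv ℝ h (Real.cos θ • W x.1 + Real.sin θ • diagScale s x.2)) (μ.prod (stdNormal d)) :=
      (hh.continuous_fderiv one_ne_zero).comp_aestronglyMeasurable
        (integrable_rotation hWi _ _).aestronglyMeasurable
    exact (ContinuousLinearMap.apply ℝ ℝ).flip.aestronglyMeasurable_comp₂ ha
      (integrable_rotation hWi _ _).aestronglyMeasurable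
  · refine (ContinuousLinearMap.le_opNorm _ _).trans ?_
    refine (mul_le_of_le_one_left (norm_nonneg _) (h1 _)).trans ((norm_add_le _ _).trans ?_)
    rw [norm_smul, norm_smul, norm_neg]
    exact add_le_add (mul_le_of_le_one_left (norm_nonneg _) (Real.abs_sin_le_one θ))
      (mul_le_of_le_one_left (norm_nonneg _) (Real.abs_cos_le_one θ))
  · exact (hdiff _).hasFDerivAt.comp_hasDerivAt θ
      (((Real.hasDerivAt_cos θ).smul_const _).add ((Real.hasDerivAt_sin θ).smul_const _))

/-- The derivative along the rotation, after integration by parts. The derivatives of `p` that the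
perturbed Stein identity produces cancel against those of the normal part, except for the ones
paired with `G`, and these are integrated by parts back onto the normal coordinates. -/
lemma SteinIdentity.integral_rotation_term [IsProbabilityMeasure μ] (hS : SteinIdentity μ W s G R)
    (hW : Measurable W) (hWi : Integrable W μ) (hs : ∀ k, 0 < s k)
    (hG : ∀ j k, Integrable (G j k) μ) (hR : ∀ k, Integrable (R k) μ) (hp : BddC1 p) (θ : ℝ)
    (k : Fin d) :
    -Real.sin θ * ∫ x, W x.1 k * p (Real.cos θ • W x.1 + Real.sin θ • diagScale s x.2)
        ∂(μ.prod (stdNormal d)) +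
      Real.cos θ * s k * ∫ x, x.2 k * p (Real.cos θ • W x.1 + Real.sin θ • diagScale s x.2)
        ∂(μ.prod (stdNormal d)) =
    -(∑ j, Real.cos θ * (s j)⁻¹ * ∫ x, G j k x.1 * x.2 j *
        p (Real.cos θ • W x.1 + Real.sin θ • diagScale s x.2) ∂(μ.prod (stdNormal d))) -
      Real.sin θ * ∫ x, R k x.1 * p (Real.cos θ • W x.1 + Real.sin θ • diagScale s x.2)
        ∂(μ.prod (stdNormal d)) := by
  have e1 := hS.integral_mul (a := Real.cos θ) (b := Real.sin θ) hW hWi hG hR hp k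
  have e2 := fun j => integral_mul_coord (s := s) (a := Real.cos θ) (b := Real.sin θ) hW hp
    (hG j k) j
  have e3 := integral_mul_coord (s := s) (a := Real.cos θ) (b := Real.sin θ) hW hp
    (integrable_const (μ := μ) (1 : ℝ)) k
  simp only [one_mul] at e3
  rw [e1, e3]
  simp_rw [e2]
  have e4 : ∀ j, (s j)⁻¹ * s j = 1 := fun j => inv_mul_cancel₀ (hs j).ne'
  have e5 : ∀ (j : Fin d) (t : ℝ), Real.cos θ * (s j)⁻¹ * (Real.sin θ * s j * t) =
      Real.sin θ * (Real.cos θ * t) := fun j t => by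
    linear_combination (Real.cos θ * Real.sin θ * t) * e4 j
  simp_rw [e5, ← Finset.mul_sum]
  ring

lemma SteinIdentity.abs_deriv_rotation_le [IsProbabilityMeasure μ] (hS : SteinIdentity μ W s G R)
    (hW : Measurable W) (hWi : Integrable W μ) (hs : ∀ k, 0 < s k)
    (hG : ∀ j k, Integrable (G j k) μ) (hR : ∀ k, Integrable (R k) μ)
    {h : EuclideanSpace ℝ (Fin d) → ℝ} (hh : ContDiff ℝ 2 h) (h1 : ∀ y, ‖fderiv ℝ h y‖ ≤ 1)
    {M : ℝ} (hM : ∀ y, ‖fderiv ℝ (fderiv ℝ h) y‖ ≤ M) (θ : ℝ) :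
    |∫ x, fderiv ℝ h (Real.cos θ • W x.1 + Real.sin θ • diagScale s x.2)
        (-Real.sin θ • W x.1 + Real.cos θ • diagScale s x.2) ∂(μ.prod (stdNormal d))| ≤
      ∑ k, (∑ j, (s j)⁻¹ * ∫ ω, |G j k ω| ∂μ + ∫ ω, |R k ω| ∂μ) := by
  set ν := μ.prod (stdNormal d) with hν
  set Y : Ω × (Fin d → ℝ) → EuclideanSpace ℝ (Fin d) :=
    fun x => Real.cos θ • W x.1 + Real.sin θ • diagScale s x.2 with hY
  set p : Fin d → EuclideanSpace ℝ (Fin d) → ℝ :=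
    fun k y => fderiv ℝ h y (EuclideanSpace.single k 1) with hpdef
  have hp : ∀ k, BddC1 (p k) := bddC1_fderiv_apply hh h1 hM
  have hp1 : ∀ k y, ‖p k y‖ ≤ 1 := fun k y =>
    (ContinuousLinearMap.le_opNorm _ _).trans (by simpa using h1 y)
  have hWk : ∀ k, Integrable (fun ω => W ω k) μ := fun k =>
    (EuclideanSpace.proj (𝕜 := ℝ) k : EuclideanSpace ℝ (Fin d) →L[ℝ] ℝ).integrable_comp hWi
  have hzk : ∀ k, Integrable (fun x : Ω × (Fin d → ℝ) => x.2 k) ν := fun k =>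
    (integrable_eval_stdNormal k).comp_snd _
  have hI : ∀ k {f : Ω × (Fin d → ℝ) → ℝ}, Integrable f ν →
      Integrable (fun x => f x * p k (Y x)) ν := fun k f hf =>
    integrable_mul_comp_add hW hf (hp k).tame.continuous (hp1 k)
  have hexp : ∀ x : Ω × (Fin d → ℝ), fderiv ℝ h (Y x)
      (-Real.sin θ • W x.1 + Real.cos θ • diagScale s x.2) =
      ∑ k, (-Real.sin θ * (W x.1 k * p k (Y x)) +
        Real.cos θ * s k * (x.2 k * p k (Y x))) := fun x => by
    rw [EuclideanSpace.clm_apply_eq_sum]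
    refine Finset.sum_congr rfl fun k _ => ?_
    simp only [diagScale_apply, PiLp.add_apply, PiLp.smul_apply, smul_eq_mul, hpdef]
    ring
  have hterm : ∀ k, ∫ x, (-Real.sin θ * (W x.1 k * p k (Y x)) +
        Real.cos θ * s k * (x.2 k * p k (Y x))) ∂ν =
      -(∑ j, Real.cos θ * (s j)⁻¹ * ∫ x, G j k x.1 * x.2 j * p k (Y x) ∂ν) -
        Real.sin θ * ∫ x, R k x.1 * p k (Y x) ∂ν := by
    intro k
    rw [integral_add ((hI k ((hWk k).comp_fst _)).const_mul _) ((hI k (hzk k)).const_mul _),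
      integral_const_mul, integral_const_mul]
    exact hS.integral_rotation_term hW hWi hs hG hR (hp k) θ k
  rw [integral_congr_ae (ae_of_all ν hexp), integral_finsetSum _ fun k _ =>
    ((hI k ((hWk k).comp_fst _)).const_mul _).fun_add ((hI k (hzk k)).const_mul _)]
  simp_rw [hterm]
  refine (Finset.abs_sum_le_sum_abs _ _).trans (Finset.sum_le_sum fun k _ => ?_)
  have hsub : ∀ x y : ℝ, |-x - y| ≤ |x| + |y| := fun x y => by
    have := abs_sub (-x) y
    rwa [abs_neg] at this
  refine (hsub _ _).trans (add_le_add ((Finset.abs_sum_le_sum_abs _ _).trans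
    (Finset.sum_le_sum fun j _ => ?_)) ?_)
  · rw [abs_mul, abs_mul, abs_of_pos (inv_pos.2 (hs j)), mul_comm |Real.cos θ|, mul_assoc]
    refine mul_le_mul_of_nonneg_left ?_ (inv_pos.2 (hs j)).le
    refine (mul_le_of_le_one_left (abs_nonneg _) (Real.abs_cos_le_one θ)).trans ?_
    refine abs_integral_le_integral_abs.trans ?_
    have hGz := (hG j k).mul_prod (integrable_eval_stdNormal j)
    calc ∫ x, |G j k x.1 * x.2 j * p k (Y x)| ∂ν
        ≤ ∫ x, |G j k x.1| * |x.2 j| ∂ν := by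
          refine integral_mono (hI k hGz).abs
            ((hG j k).abs.mul_prod (integrable_eval_stdNormal j).abs) fun x => ?_
          simp only [abs_mul]
          exact mul_le_of_le_one_right (by positivity) (hp1 k _)
      _ = (∫ ω, |G j k ω| ∂μ) * ∫ z, |z j| ∂(stdNormal d) :=
          integral_prod_mul (fun ω => |G j k ω|) fun z : Fin d → ℝ => |z j|
      _ ≤ ∫ ω, |G j k ω| ∂μ :=
          mul_le_of_le_one_right (integral_nonneg fun _ => abs_nonneg _)
            (integral_abs_stdNormal_le j)
  · rw [abs_mul]
    refine (mul_le_of_le_one_left (abs_nonneg _) (Real.abs_sin_le_one θ)).trans ?_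
    refine abs_integral_le_integral_abs.trans ?_
    calc ∫ x, |R k x.1 * p k (Y x)| ∂ν ≤ ∫ x, |R k x.1| ∂ν := by
          refine integral_mono (hI k ((hR k).comp_fst _)).abs ((hR k).abs.comp_fst _) fun x => ?_
          simp only [abs_mul]
          exact mul_le_of_le_one_right (abs_nonneg _) (hp1 k _)
      _ = ∫ ω, |R k ω| ∂μ := by
          rw [hν, integral_fun_fst (fun ω => |R k ω|)]
          simp

/-- Stein's method for a smooth test function: along the rotation `cos θ W + sin θ Z` of `W` into
an independent normal vector `Z`, the expectation of `h` has a derivative which, after Gaussian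
integration by parts in `Z`, involves only the first derivatives of `h`. -/
lemma SteinIdentity.abs_integral_sub_le [IsProbabilityMeasure μ] (hS : SteinIdentity μ W s G R)
    (hW : Measurable W) (hWi : Integrable W μ) (hs : ∀ k, 0 < s k)
    (hG : ∀ j k, Integrable (G j k) μ) (hR : ∀ k, Integrable (R k) μ)
    {h : EuclideanSpace ℝ (Fin d) → ℝ} (hh : ContDiff ℝ 2 h) (h1 : ∀ y, ‖fderiv ℝ h y‖ ≤ 1)
    {M : ℝ} (hM : ∀ y, ‖fderiv ℝ (fderiv ℝ h) y‖ ≤ M) :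
    |∫ ω, h (W ω) ∂μ - ∫ z, h (diagScale s z) ∂(stdNormal d)| ≤
      Real.pi / 2 * ∑ k, (∑ j, (s j)⁻¹ * ∫ ω, |G j k ω| ∂μ + ∫ ω, |R k ω| ∂μ) := by
  have hfin := Convex.norm_image_sub_le_of_norm_hasDerivWithin_le (s := Set.univ)
    (x := Real.pi / 2) (y := 0)
    (fun θ _ => (hasDerivAt_integral_rotation (s := s) hWi (hh.of_le one_le_two) h1
      θ).hasDerivWithinAt)
    (fun θ _ => hS.abs_deriv_rotation_le hW hWi hs hG hR hh h1 hM θ) convex_univ trivial trivial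
  have hpi : ‖(0 : ℝ) - Real.pi / 2‖ = Real.pi / 2 := by
    rw [zero_sub, norm_neg, Real.norm_of_nonneg (by positivity)]
  rw [hpi, Real.norm_eq_abs, mul_comm] at hfin
  simp only [Real.cos_zero, Real.sin_zero, Real.cos_pi_div_two, Real.sin_pi_div_two, one_smul,
    zero_smul, add_zero, zero_add] at hfin
  rw [integral_fun_fst (fun ω => h (W ω)), integral_fun_snd (fun z => h (diagScale s z))]
    at hfin
  simpa using hfin

end Rotation

/-! ### Smoothing of Lipschitz functions and the Wasserstein distance -/

section Mollify

variable {G V V' : Type*} [NormedAddCommGroup G] [NormedSpace ℝ G] [FiniteDimensional ℝ G]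
  [MeasurableSpace G] [BorelSpace G] [NormedAddCommGroup V] [NormedSpace ℝ V]
  [NormedAddCommGroup V'] [NormedSpace ℝ V'] {ν : Measure G} [ν.IsAddHaarMeasure]

lemma lipschitz_convolution {ψ : G → V} (hψ : Continuous ψ) (hψ' : HasCompactSupport ψ)
    (L : V →L[ℝ] ℝ →L[ℝ] V') {h : G → ℝ} (hh : LipschitzWith 1 h) (x y : G) :
    ‖convolution ψ h L ν x - convolution ψ h L ν y‖ ≤ (∫ t, ‖L‖ * ‖ψ t‖ ∂ν) * ‖x - y‖ := by
  have hloc : LocallyIntegrable h ν := hh.continuous.locallyIntegrable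
  have hex := hψ'.convolutionExists_left L hψ hloc
  rw [convolution_def, convolution_def, ← integral_sub (hex x) (hex y), ← integral_mul_const]
  refine norm_integral_le_of_norm_le (((hψ.integrable_of_hasCompactSupport hψ').norm.const_mul
    _).mul_const _) (ae_of_all _ fun t => ?_)
  rw [← map_sub]
  refine (L.le_opNorm₂ _ _).trans (mul_le_mul_of_nonneg_left ?_ (by positivity))
  have := hh.dist_le_mul (x - t) (y - t)
  simpa [dist_eq_norm] using this

lemma exists_lipschitz_convolution {ψ : G → V} (hψ : Continuous ψ) (hψ' : HasCompactSupport ψ)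
    (L : V →L[ℝ] ℝ →L[ℝ] V') {h : G → ℝ} (hh : LipschitzWith 1 h) :
    ∃ K : ℝ, ∀ x y, ‖convolution ψ h L ν x - convolution ψ h L ν y‖ ≤ K * ‖x - y‖ :=
  ⟨_, lipschitz_convolution hψ hψ' L hh⟩

/-- A `1`-Lipschitz function is a uniform limit of smooth `1`-Lipschitz functions, and each of these
has a bounded second derivative. -/
lemma exists_smooth_approx {h : G → ℝ} (hh : LipschitzWith 1 h) {ε : ℝ} (hε : 0 < ε) :
    ∃ h' : G → ℝ, ContDiff ℝ 2 h' ∧ (∀ y, ‖fderiv ℝ h' y‖ ≤ 1) ∧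
      (∃ M, ∀ y, ‖fderiv ℝ (fderiv ℝ h') y‖ ≤ M) ∧ ∀ y, |h' y - h y| ≤ ε := by
  let ν : Measure G := Measure.addHaar
  let φ : ContDiffBump (0 : G) := ⟨ε / 2, ε, by positivity, by linarith⟩
  have hloc : LocallyIntegrable h ν := hh.continuous.locallyIntegrable
  have hφs : HasCompactSupport (φ.normed ν) := φ.hasCompactSupport_normed
  have hφc : ContDiff ℝ 2 (φ.normed ν) := φ.contDiff_normed
  have hφ1 : ContDiff ℝ 1 (φ.normed ν) := hφc.of_le one_le_two
  have hD : ∀ x, fderiv ℝ (convolution (φ.normed ν) h (ContinuousLinearMap.lsmul ℝ ℝ) ν) x =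
      convolution (fderiv ℝ (φ.normed ν)) h
        (ContinuousLinearMap.precompL G (ContinuousLinearMap.lsmul ℝ ℝ)) ν x := fun x =>
    (hφs.hasFDerivAt_convolution_left _ hφ1 hloc x).fderiv
  refine ⟨convolution (φ.normed ν) h (ContinuousLinearMap.lsmul ℝ ℝ) ν,
    hφs.contDiff_convolution_left _ hφc hloc, fun y => ?_, ?_, fun y => ?_⟩
  · have hlip : LipschitzWith 1 (convolution (φ.normed ν) h (ContinuousLinearMap.lsmul ℝ ℝ) ν) := by
      refine LipschitzWith.of_dist_le_mul fun x y => ?_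
      rw [dist_eq_norm, dist_eq_norm]
      refine (lipschitz_convolution hφ1.continuous hφs _ hh x y).trans
        (mul_le_mul_of_nonneg_right ?_ (norm_nonneg _))
      rw [integral_const_mul]
      have h1 : ∫ t, ‖φ.normed ν t‖ ∂ν = 1 := by
        simp_rw [Real.norm_of_nonneg (φ.nonneg_normed _)]
        exact φ.integral_normed
      rw [h1, mul_one]
      exact ContinuousLinearMap.opNorm_lsmul_le
    simpa using norm_fderiv_le_of_lipschitz ℝ hlip (x₀ := y)
  · obtain ⟨K, hK⟩ : ∃ K : ℝ, ∀ x y,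
        ‖fderiv ℝ (convolution (φ.normed ν) h (ContinuousLinearMap.lsmul ℝ ℝ) ν) x -
          fderiv ℝ (convolution (φ.normed ν) h (ContinuousLinearMap.lsmul ℝ ℝ) ν) y‖ ≤
        K * ‖x - y‖ := by
      simp_rw [hD]
      exact exists_lipschitz_convolution (hφ1.continuous_fderiv one_ne_zero) (hφs.fderiv ℝ)
        (ContinuousLinearMap.precompL G (ContinuousLinearMap.lsmul ℝ ℝ)) hh
    refine ⟨K.toNNReal, fun y => norm_fderiv_le_of_lipschitz ℝ
      (LipschitzWith.of_dist_le_mul fun x y => ?_)⟩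
    rw [dist_eq_norm, dist_eq_norm]
    exact (hK x y).trans (mul_le_mul_of_nonneg_right (Real.le_coe_toNNReal K) (norm_nonneg _))
  · rw [← Real.dist_eq]
    refine φ.dist_normed_convolution_le hh.continuous.aestronglyMeasurable fun x hx => ?_
    have := hh.dist_le_mul x y
    rw [NNReal.coe_one, one_mul] at this
    exact this.trans (Metric.mem_ball.1 hx).le

end Mollify

lemma abs_integral_comp_sub_le {d : ℕ} {Ω : Type*} [MeasurableSpace Ω] {μ : Measure Ω}
    [IsProbabilityMeasure μ] {W : Ω → EuclideanSpace ℝ (Fin d)} (hWi : Integrable W μ)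
    {f h : EuclideanSpace ℝ (Fin d) → ℝ} (hf : LipschitzWith 1 f) (hh : LipschitzWith 1 h) {ε : ℝ}
    (hε : ∀ y, |h y - f y| ≤ ε) : |∫ ω, f (W ω) ∂μ - ∫ ω, h (W ω) ∂μ| ≤ ε := by
  rw [← integral_sub (hf.integrable_comp_of_one hWi) (hh.integrable_comp_of_one hWi)]
  have h1 := norm_integral_le_of_norm_le_const (μ := μ) (C := ε)
    (f := fun ω => f (W ω) - h (W ω)) (ae_of_all _ fun ω => by
      rw [Real.norm_eq_abs, abs_sub_comm]
      exact hε _)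
  rwa [probReal_univ, mul_one] at h1

/-- A perturbed Stein identity bounds the Wasserstein distance to the normal law. -/
theorem SteinIdentity.wassersteinDist_le {d : ℕ} {Ω : Type*} [MeasurableSpace Ω] {μ : Measure Ω}
    [IsProbabilityMeasure μ] {W : Ω → EuclideanSpace ℝ (Fin d)} {s : Fin d → ℝ}
    {G : Fin d → Fin d → Ω → ℝ} {R : Fin d → Ω → ℝ}
    (hS : SteinIdentity μ W s G R) (hW : Measurable W) (hWi : Integrable W μ) (hs : ∀ k, 0 < s k)
    (hG : ∀ j k, Integrable (G j k) μ) (hR : ∀ k, Integrable (R k) μ) :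
    wassersteinDist (μ.map W) ((stdNormal d).map (diagScale s)) ≤ ENNReal.ofReal
      (Real.pi / 2 * ∑ k, (∑ j, (s j)⁻¹ * ∫ ω, |G j k ω| ∂μ + ∫ ω, |R k ω| ∂μ)) := by
  refine iSup_le fun ⟨f, hf⟩ => ENNReal.ofReal_le_ofReal ?_
  simp only
  rw [integral_map hW.aemeasurable hf.continuous.aestronglyMeasurable,
    integral_map (diagScale s).continuous.aemeasurable hf.continuous.aestronglyMeasurable]
  have hZi : Integrable (fun z => diagScale s z) (stdNormal d) :=
    (Tame.clm (diagScale s)).integrable (finiteMoments_stdNormal d)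
  refine le_of_forall_pos_le_add fun ε hε => ?_
  obtain ⟨h, hh, h1, ⟨M, hM⟩, hε'⟩ := exists_smooth_approx hf (half_pos hε)
  have hhl : LipschitzWith 1 h :=
    lipschitzWith_of_nnnorm_fderiv_le (hh.differentiable two_ne_zero) fun y => h1 y
  have hmain := hS.abs_integral_sub_le hW hWi hs hG hR hh h1 hM
  have k1 := abs_integral_comp_sub_le hWi hf hhl hε'
  have k2 := abs_integral_comp_sub_le hZi hf hhl hε'
  rw [abs_le] at k1 k2 hmain ⊢
  constructor <;> linarith

/-! ### Semicircle moments and Chebyshev polynomials -/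

section Semicircle

open Polynomial

lemma Polynomial.linearMap_ext {M : Type*} [AddCommMonoid M] [Module ℝ M] {f g : ℝ[X] →ₗ[ℝ] M}
    (h : ∀ m : ℕ, f (X ^ m) = g (X ^ m)) : f = g := by
  refine Polynomial.lhom_ext' fun m => LinearMap.ext_ring ?_
  simpa [monomial_one_right_eq_X_pow] using h m

/-- The linear map on polynomials with prescribed values on the powers of `X`. -/
noncomputable def powerFunctional {M : Type*} [AddCommMonoid M] [Module ℝ M] (c : ℕ → M) :
    ℝ[X] →ₗ[ℝ] M :=
  Polynomial.lsum fun m => LinearMap.toSpanSingleton ℝ M (c m)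

lemma powerFunctional_X_pow {M : Type*} [AddCommMonoid M] [Module ℝ M] (c : ℕ → M) (m : ℕ) :
    powerFunctional c (X ^ m) = c m := by
  simp [powerFunctional, Polynomial.lsum_apply, X_pow_eq_monomial]

/-- The moments of the semicircle law on `[-1, 1]`, by their recursion. -/
noncomputable def semicircleMoment : ℕ → ℝ
  | 0 => 1
  | 1 => 0
  | m + 2 => 1 / 4 * ∑ p : Fin (m + 1), semicircleMoment p * semicircleMoment (m - p)

lemma semicircleMoment_zero : semicircleMoment 0 = 1 := by
  rw [semicircleMoment]

lemma semicircleMoment_succ (m : ℕ) : semicircleMoment (m + 1) =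
    1 / 4 * ∑ p ∈ Finset.range m, semicircleMoment p * semicircleMoment (m - 1 - p) := by
  cases m with
  | zero => simp [semicircleMoment]
  | succ m =>
    rw [semicircleMoment, Finset.sum_range]
    rfl

/-- Integration of polynomials against the semicircle law. -/
noncomputable def semicircle : ℝ[X] →ₗ[ℝ] ℝ := powerFunctional semicircleMoment

lemma semicircle_X_pow (m : ℕ) : semicircle (X ^ m) = semicircleMoment m :=
  powerFunctional_X_pow _ m

lemma semicircle_one : semicircle 1 = 1 := by
  simpa [semicircleMoment_zero] using semicircle_X_pow 0

/-- The divided difference `(q(x) - q(y)) / (x - y)`, integrated in `y` against the functional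
`φ`. -/
noncomputable def dividedDiff (φ : ℝ[X] →ₗ[ℝ] ℝ) : ℝ[X] →ₗ[ℝ] ℝ[X] :=
  powerFunctional fun m => ∑ p ∈ Finset.range m, φ (X ^ p) • X ^ (m - 1 - p)

lemma dividedDiff_X_pow (φ : ℝ[X] →ₗ[ℝ] ℝ) (m : ℕ) :
    dividedDiff φ (X ^ m) = ∑ p ∈ Finset.range m, φ (X ^ p) • X ^ (m - 1 - p) :=
  powerFunctional_X_pow _ m

lemma dividedDiff_one (φ : ℝ[X] →ₗ[ℝ] ℝ) : dividedDiff φ 1 = 0 := by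
  simpa using dividedDiff_X_pow φ 0

lemma dividedDiff_X_mul (φ : ℝ[X] →ₗ[ℝ] ℝ) (q : ℝ[X]) :
    dividedDiff φ (X * q) = X * dividedDiff φ q + C (φ q) := by
  have h : (dividedDiff φ).comp (LinearMap.mulLeft ℝ X) =
      (LinearMap.mulLeft ℝ X).comp (dividedDiff φ) + (Polynomial.CAlgHom.toLinearMap).comp φ := by
    refine Polynomial.linearMap_ext fun m => ?_
    simp only [LinearMap.comp_apply, LinearMap.mulLeft_apply, LinearMap.add_apply, ← pow_succ',
      dividedDiff_X_pow, Finset.sum_range_succ, Finset.mul_sum]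
    refine congrArg₂ _ (Finset.sum_congr rfl fun p hp => ?_) ?_
    · have : m + 1 - 1 - p = (m - 1 - p) + 1 := by
        have := Finset.mem_range.1 hp
        omega
      rw [this, pow_succ', mul_smul_comm]
    · simp [Polynomial.smul_eq_C_mul]
  exact LinearMap.congr_fun h q

lemma dividedDiff_smul_add (φ ψ : ℝ[X] →ₗ[ℝ] ℝ) (a : ℝ) (q : ℝ[X]) :
    dividedDiff (a • φ + ψ) q = a • dividedDiff φ q + dividedDiff ψ q := by
  have h : dividedDiff (a • φ + ψ) = a • dividedDiff φ + dividedDiff ψ := by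
    refine Polynomial.linearMap_ext fun m => ?_
    simp [dividedDiff_X_pow, add_smul, Finset.sum_add_distrib, Finset.smul_sum, mul_smul]
  rw [h]
  rfl

lemma dividedDiff_symm (φ ψ : ℝ[X] →ₗ[ℝ] ℝ) (q : ℝ[X]) :
    ψ (dividedDiff φ q) = φ (dividedDiff ψ q) := by
  have h : ψ.comp (dividedDiff φ) = φ.comp (dividedDiff ψ) := by
    refine Polynomial.linearMap_ext fun m => ?_
    simp only [LinearMap.comp_apply, dividedDiff_X_pow, map_sum, map_smul, smul_eq_mul]
    rw [← Finset.sum_range_reflect]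
    refine Finset.sum_congr rfl fun p hp => ?_
    have : m - 1 - (m - 1 - p) = p := by
      have := Finset.mem_range.1 hp
      omega
    rw [this, mul_comm]
  exact LinearMap.congr_fun h q

/-- The expansion of the double trace around its semicircle limit. -/
lemma dividedDiff_perturb (φ ψ : ℝ[X] →ₗ[ℝ] ℝ) (a : ℝ) (q : ℝ[X]) :
    (a • φ + ψ) (dividedDiff (a • φ + ψ) q) =
      a ^ 2 * φ (dividedDiff φ q) + 2 * a * ψ (dividedDiff φ q) + ψ (dividedDiff ψ q) := by
  rw [dividedDiff_smul_add]
  simp only [LinearMap.add_apply, LinearMap.smul_apply, map_add, map_smul, smul_eq_mul,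
    dividedDiff_symm ψ φ]
  ring

/-- The fixed point equation of the semicircle law. -/
lemma semicircle_X_mul (q : ℝ[X]) :
    semicircle (X * q) = 1 / 4 * semicircle (dividedDiff semicircle q) := by
  have h : semicircle.comp (LinearMap.mulLeft ℝ X) =
      (1 / 4 : ℝ) • semicircle.comp (dividedDiff semicircle) := by
    refine Polynomial.linearMap_ext fun m => ?_
    simp only [LinearMap.comp_apply, LinearMap.mulLeft_apply, LinearMap.smul_apply, ← pow_succ',
      dividedDiff_X_pow, map_sum, map_smul, semicircle_X_pow, semicircleMoment_succ, smul_eq_mul]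
  exact LinearMap.congr_fun h q

/-- The Chebyshev polynomials of the second kind are centered for the semicircle law, and
averaging their divided differences against it lowers the index by one. -/
lemma dividedDiff_semicircle_U (m : ℕ) :
    dividedDiff semicircle (Chebyshev.U ℝ m) = 2 * Chebyshev.U ℝ (m - 1) ∧
      semicircle (Chebyshev.U ℝ (m + 1)) = 0 := by
  have h2 : ∀ q : ℝ[X], (2 : ℝ[X]) * X * q = (2 : ℝ) • (X * q) := fun q => by
    rw [Polynomial.smul_eq_C_mul, mul_assoc]
    rfl
  have hC : ∀ q : ℝ[X], (2 : ℝ[X]) * q = (2 : ℝ) • q := fun q => by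
    rw [Polynomial.smul_eq_C_mul]
    rfl
  induction m using Nat.strong_induction_on with
  | _ m ih =>
    have hD : dividedDiff semicircle (Chebyshev.U ℝ m) = 2 * Chebyshev.U ℝ (m - 1) := by
      match m, ih with
      | 0, _ => simp [dividedDiff_one]
      | 1, _ =>
        have := dividedDiff_X_mul semicircle 1
        rw [mul_one, dividedDiff_one, semicircle_one] at this
        simp [hC, map_smul, this]
      | m + 2, ih =>
        obtain ⟨h0, h1⟩ := ih m (by omega)
        obtain ⟨h0', -⟩ := ih (m + 1) (by omega)
        push_cast at h0' ⊢
        rw [Chebyshev.U_add_two, h2, map_sub, map_smul, dividedDiff_X_mul, h0', h0, h1]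
        have := Chebyshev.U_add_one ℝ (m : ℤ)
        rw [show (m : ℤ) + 2 - 1 = m + 1 by ring, this, add_sub_cancel_right, ← hC]
        simp
        ring
    refine ⟨hD, ?_⟩
    rw [Chebyshev.U_add_one, h2, map_sub, map_smul, semicircle_X_mul, hD, hC, map_smul]
    simp
    ring

lemma semicircle_U_mul_U (i j : ℕ) :
    semicircle (Chebyshev.U ℝ i * Chebyshev.U ℝ j) = if i = j then 1 else 0 := by
  have h0 : ∀ j : ℕ, semicircle (Chebyshev.U ℝ j) = if j = 0 then 1 else 0 := fun j => by
    cases j with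
    | zero => simp [semicircle_one]
    | succ j => simpa using (dividedDiff_semicircle_U j).2
  have hX : ∀ j : ℤ, 2 * X * Chebyshev.U ℝ j = Chebyshev.U ℝ (j + 1) + Chebyshev.U ℝ (j - 1) :=
    fun j => by rw [Chebyshev.U_add_one]; ring
  induction i using Nat.strong_induction_on generalizing j with
  | _ i ih =>
    match i, ih with
    | 0, _ => simp [h0, eq_comm]
    | 1, _ =>
      have h1 : Chebyshev.U ℝ ((1 : ℕ) : ℤ) * Chebyshev.U ℝ j =
          Chebyshev.U ℝ ((j + 1 : ℕ) : ℤ) + Chebyshev.U ℝ (j - 1) := by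
        rw [Nat.cast_one, Chebyshev.U_one, hX]
        push_cast
        rfl
      rw [h1, map_add, h0]
      cases j with
      | zero => simp
      | succ j => simp [h0, eq_comm]
    | i + 2, ih =>
      have h1 : Chebyshev.U ℝ ((i + 2 : ℕ) : ℤ) * Chebyshev.U ℝ j =
          Chebyshev.U ℝ ((i + 1 : ℕ) : ℤ) * Chebyshev.U ℝ ((j + 1 : ℕ) : ℤ) +
          Chebyshev.U ℝ ((i + 1 : ℕ) : ℤ) * Chebyshev.U ℝ (j - 1) -
          Chebyshev.U ℝ (i : ℤ) * Chebyshev.U ℝ j := by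
        push_cast
        rw [← mul_add, ← hX, Chebyshev.U_add_two]
        ring
      rw [h1, map_sub, map_add, ih (i + 1) (by omega), ih i (by omega)]
      cases j with
      | zero => simp
      | succ j =>
        have h2 := ih (i + 1) (by omega) j
        have : ((j + 1 : ℕ) : ℤ) - 1 = j := by simp
        rw [this, h2]
        by_cases hij : i = j + 1
        · subst hij
          simp
          omega
        · simp [hij]

end Semicircle

/-! ### Boundedness of the mixed moments of the centered traces -/

/-- A family of real numbers with a common bound. -/
def UniformlyBounded {I : Type*} (f : I → ℝ) : Prop := ∃ C, ∀ i, |f i| ≤ C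

namespace UniformlyBounded

variable {I : Type*} {f g : I → ℝ}

lemma const (c : ℝ) : UniformlyBounded fun _ : I => c := ⟨|c|, fun _ => le_rfl⟩

lemma of_le (hg : UniformlyBounded g) (h : ∀ i, |f i| ≤ g i) : UniformlyBounded f := by
  obtain ⟨C, hC⟩ := hg
  exact ⟨C, fun i => (h i).trans ((le_abs_self _).trans (hC i))⟩

lemma add (hf : UniformlyBounded f) (hg : UniformlyBounded g) :
    UniformlyBounded fun i => f i + g i := by
  obtain ⟨C, hC⟩ := hf
  obtain ⟨D, hD⟩ := hg
  exact ⟨C + D, fun i => (abs_add_le _ _).trans (add_le_add (hC i) (hD i))⟩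

lemma mul (hf : UniformlyBounded f) (hg : UniformlyBounded g) :
    UniformlyBounded fun i => f i * g i := by
  obtain ⟨C, hC⟩ := hf
  obtain ⟨D, hD⟩ := hg
  refine ⟨C * D, fun i => ?_⟩
  rw [abs_mul]
  exact mul_le_mul (hC i) (hD i) (abs_nonneg _) ((abs_nonneg _).trans (hC i))

lemma const_mul (c : ℝ) (hf : UniformlyBounded f) : UniformlyBounded fun i => c * f i :=
  (const c).mul hf

lemma sum {κ : Type*} (s : Finset κ) {f : κ → I → ℝ} (hf : ∀ k ∈ s, UniformlyBounded (f k)) :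
    UniformlyBounded fun i => ∑ k ∈ s, f k i := by
  classical
  induction s using Finset.induction_on with
  | empty => simpa using const (I := I) 0
  | insert a s ha ih =>
    simp_rw [Finset.sum_insert ha]
    exact (hf a (by simp)).add (ih fun i hi => hf i (by simp [hi]))

lemma multiset_sum {κ : Type*} (s : Multiset κ) {f : κ → I → ℝ}
    (hf : ∀ k ∈ s, UniformlyBounded (f k)) :
    UniformlyBounded fun i => (s.map fun k => f k i).sum := by
  induction s using Multiset.induction_on with
  | empty => simpa using const (I := I) 0
  | cons a s ih =>
    simp_rw [Multiset.map_cons, Multiset.sum_cons]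
    exact (hf a (by simp)).add (ih fun i hi => hf i (by simp [hi]))

end UniformlyBounded

/-- The recursion (loop equation) for the mixed moments `m s = 𝔼 ∏_{a ∈ s} τ(X ^ a)` of the traces
of powers centered at the semicircle law, with `ε = 1 / n`. -/
structure LoopEquations (κ ρ ε : ℝ) (m : Multiset ℕ → ℝ) : Prop where
  zero : m 0 = 1
  zero_cons : ∀ s, m (0 ::ₘ s) = 0
  succ_cons : ∀ k s, m ((k + 1) ::ₘ s) =
    ∑ p ∈ Finset.range k, (ε / 4 * m (p ::ₘ (k - 1 - p) ::ₘ s) +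
      1 / 2 * semicircleMoment p * m ((k - 1 - p) ::ₘ s)) +
    κ * k / 4 * (ε * m ((k - 1) ::ₘ s) + semicircleMoment (k - 1) * m s) +
    (s.map fun a => ρ / 4 * a * (ε * m ((k + (a - 1)) ::ₘ s.erase a) +
      semicircleMoment (k + (a - 1)) * m (s.erase a))).sum

/-- Every term of the loop equations lowers the total degree, so that induction on the degree
bounds all mixed moments uniformly in `ε`. -/
lemma LoopEquations.uniformlyBounded {I : Type*} {κ ρ : ℝ} {ε : I → ℝ}
    (hε : UniformlyBounded ε) {m : I → Multiset ℕ → ℝ}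
    (h : ∀ i, LoopEquations κ ρ (ε i) (m i)) (s : Multiset ℕ) :
    UniformlyBounded fun i => m i s := by
  induction hN : s.sum using Nat.strong_induction_on generalizing s with
  | _ N ih =>
    subst hN
    by_cases h0 : (0 : ℕ) ∈ s
    · obtain ⟨t, rfl⟩ := Multiset.exists_cons_of_mem h0
      simpa [fun i => (h i).zero_cons t] using UniformlyBounded.const (I := I) 0
    rcases s.empty_or_exists_mem with rfl | ⟨a, ha⟩
    · simpa [fun i => (h i).zero] using UniformlyBounded.const (I := I) 1
    obtain ⟨t, rfl⟩ := Multiset.exists_cons_of_mem ha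
    obtain _ | k := a
    · exact absurd ha h0
    simp_rw [fun i => (h i).succ_cons k t]
    have ih' : ∀ u : Multiset ℕ, u.sum ≤ k + t.sum → UniformlyBounded fun i => m i u :=
      fun u hu => ih _ (by simp; omega) u rfl
    refine ((UniformlyBounded.sum _ fun p hp => ?_).add (UniformlyBounded.const_mul _ ?_)).add
      (UniformlyBounded.multiset_sum _ fun a ha => UniformlyBounded.const_mul _ ?_)
    · have := Finset.mem_range.1 hp
      have h1 : UniformlyBounded fun i => ε i / 4 := by
        simpa [div_eq_inv_mul] using hε.const_mul (1 / 4)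
      exact (h1.mul (ih' _ (by simp; omega))).add ((ih' _ (by simp; omega)).const_mul _)
    · exact (hε.mul (ih' _ (by simp))).add ((ih' _ (by simp)).const_mul _)
    · have h1 : (t.erase a).sum + a = t.sum := by
        rw [add_comm, ← Multiset.sum_cons, Multiset.cons_erase ha]
      exact (hε.mul (ih' _ (by simp; omega))).add ((ih' _ (by omega)).const_mul _)

/-! ### Traces of a Gaussian element of an algebra -/

/-- The properties of a Gaussian random self-adjoint matrix on which the proof rests. The element
`X x = ∑ i, ℓ i x • X (v i)` of the algebra `𝒜` has independent standard normal coordinates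
`ℓ i x` under `μ`, the functional `Tr` is a trace of mass `n`, and the last two fields are the
contraction rules of Gaussian matrices, for the powers of `X`; for the ensembles of parameter `β`,
`ρ = 2 / β` and `κ = 2 / β - 1`. -/
structure IsTraceModel {E 𝒜 ι : Type*} [NormedAddCommGroup E] [NormedSpace ℝ E]
    [MeasurableSpace E] [NormedRing 𝒜] [NormedAlgebra ℝ 𝒜] [Fintype ι] (μ : Measure E)
    (v : ι → E) (ℓ : ι → E →L[ℝ] ℝ) (X : E →L[ℝ] 𝒜) (Tr : 𝒜 →L[ℝ] ℝ) (n κ ρ : ℝ) : Prop where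
  finiteMoments : FiniteMoments μ
  ibp : ∀ i, IntegrationByParts μ (v i) (ℓ i)
  expand : ∀ x, X x = ∑ i, ℓ i x • X (v i)
  one_le : 1 ≤ n
  trace_one : Tr 1 = n
  trace_comm : ∀ a b, Tr (a * b) = Tr (b * a)
  sum_trace_mul : ∀ (x : E) (a b : ℕ), ∑ i, Tr (X x ^ a * X (v i) * X x ^ b * X (v i)) =
    1 / (4 * n) * (Tr (X x ^ a) * Tr (X x ^ b) + κ * Tr (X x ^ (a + b)))
  sum_mul_trace : ∀ (x : E) (a b : ℕ), ∑ i, Tr (X x ^ a * X (v i)) * Tr (X x ^ b * X (v i)) =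
    ρ / (4 * n) * Tr (X x ^ (a + b))

namespace IsTraceModel

section

open Polynomial

variable {E 𝒜 : Type*} [NormedAddCommGroup E] [NormedSpace ℝ E] [NormedRing 𝒜]
  [NormedAlgebra ℝ 𝒜]

/-- The functional `q ↦ Tr q(X)` on polynomials. -/
noncomputable def traceEval (Tr : 𝒜 →L[ℝ] ℝ)
    (a : 𝒜) : ℝ[X] →ₗ[ℝ] ℝ :=
  Tr.toLinearMap.comp (aeval a).toLinearMap

/-- The functional `q ↦ Tr q(X) - n σ(q)`, with `σ` the semicircle law. -/
noncomputable def centeredEval (Tr : 𝒜 →L[ℝ] ℝ)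
    (n : ℝ) (a : 𝒜) : ℝ[X] →ₗ[ℝ] ℝ :=
  traceEval Tr a - n • semicircle

lemma fderiv_trace_pow_mul (A : E →L[ℝ] 𝒜) (Tr : 𝒜 →L[ℝ] ℝ) (k : ℕ) (B : 𝒜) (x w : E) :
    fderiv ℝ (fun x => Tr (A x ^ k * B)) x w =
      ∑ p ∈ Finset.range k, Tr (A x ^ (k - 1 - p) * A w * A x ^ p * B) := by
  have h : HasFDerivAt (fun x => Tr (A x ^ k * B)) _ x :=
    Tr.hasFDerivAt.comp x ((A.hasFDerivAt.pow' k).mul_const' B)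
  rw [h.fderiv]
  simp [Finset.sum_mul, map_sum, mul_assoc]

lemma tame_trace_pow_mul (A : E →L[ℝ] 𝒜) (Tr : 𝒜 →L[ℝ] ℝ) (k : ℕ) (B : 𝒜) :
    Tame (fun x => Tr (A x ^ k * B)) :=
  (Tame.clm Tr).comp (((Tame.clm A).pow k).mul (Tame.const B))

lemma tame_trace_pow (A : E →L[ℝ] 𝒜) (Tr : 𝒜 →L[ℝ] ℝ) (k : ℕ) : Tame (fun x => Tr (A x ^ k)) :=
  (Tame.clm Tr).comp ((Tame.clm A).pow k)

lemma traceEval_X_pow (Tr : 𝒜 →L[ℝ] ℝ) (a : 𝒜) (k : ℕ) : traceEval Tr a (X ^ k) = Tr (a ^ k) := by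
  simp [traceEval]

lemma tame_traceEval (Tr : 𝒜 →L[ℝ] ℝ) (A : E →L[ℝ] 𝒜) (q : ℝ[X]) :
    Tame fun x => traceEval Tr (A x) q := by
  induction q using Polynomial.induction_on' with
  | add p q hp hq => simpa only [map_add] using hp.add hq
  | monomial m a =>
    simp_rw [← C_mul_X_pow_eq_monomial, ← smul_eq_C_mul, map_smul, traceEval_X_pow, smul_eq_mul]
    exact (tame_trace_pow A Tr m).const_mul a

lemma tame_centeredEval (Tr : 𝒜 →L[ℝ] ℝ) (A : E →L[ℝ] 𝒜) (n : ℝ) (q : ℝ[X]) :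
    Tame fun x => centeredEval Tr n (A x) q :=
  (tame_traceEval Tr A q).sub (Tame.const (n * semicircle q))

lemma tame_dividedDiff {φ ψ : E → ℝ[X] →ₗ[ℝ] ℝ} (hφ : ∀ q, Tame fun x => φ x q)
    (hψ : ∀ q, Tame fun x => ψ x q) (q : ℝ[X]) : Tame fun x => ψ x (dividedDiff (φ x) q) := by
  induction q using Polynomial.induction_on' with
  | add p q hp hq => simpa only [map_add] using hp.add hq
  | monomial m a =>
    simp_rw [← C_mul_X_pow_eq_monomial, ← smul_eq_C_mul, map_smul, dividedDiff_X_pow, map_sum,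
      map_smul, smul_eq_mul]
    exact (Tame.sum _ fun p _ => (hφ _).mul (hψ _)).const_mul a

lemma tame_trace_aeval_mul (Tr : 𝒜 →L[ℝ] ℝ) (A : E →L[ℝ] 𝒜) (q : ℝ[X]) (B : 𝒜) :
    Tame fun x => Tr (aeval (A x) q * B) := by
  induction q using Polynomial.induction_on' with
  | add p q hp hq => simpa only [map_add, add_mul] using hp.add hq
  | monomial m a =>
    simp_rw [← C_mul_X_pow_eq_monomial, ← smul_eq_C_mul, map_smul, map_pow, aeval_X,
      smul_mul_assoc, map_smul, smul_eq_mul]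
    exact (tame_trace_pow_mul A Tr m B).const_mul a

lemma traceEval_eq (Tr : 𝒜 →L[ℝ] ℝ) (n : ℝ) (a : 𝒜) :
    traceEval Tr a = n • semicircle + centeredEval Tr n a := by
  simp [centeredEval]

end

section

variable {E 𝒜 ι : Type*} [NormedAddCommGroup E] [NormedSpace ℝ E]
  [MeasurableSpace E] [NormedRing 𝒜] [NormedAlgebra ℝ 𝒜] [Fintype ι] {μ : Measure E}
  {v : ι → E} {ℓ : ι → E →L[ℝ] ℝ} {X : E →L[ℝ] 𝒜} {Tr : 𝒜 →L[ℝ] ℝ} {n κ ρ : ℝ}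

lemma ne_zero (h : IsTraceModel μ v ℓ X Tr n κ ρ) : n ≠ 0 := (one_pos.trans_le h.one_le).ne'

lemma fderiv_trace_pow (h : IsTraceModel μ v ℓ X Tr n κ ρ) (k : ℕ) (x w : E) :
    fderiv ℝ (fun x => Tr (X x ^ k)) x w = k * Tr (X x ^ (k - 1) * X w) := by
  have h1 := fderiv_trace_pow_mul X Tr k 1 x w
  simp only [mul_one] at h1
  rw [h1, Finset.sum_congr rfl (g := fun _ => Tr (X x ^ (k - 1) * X w)) fun p hp => ?_]
  · simp
  · have hp := Finset.mem_range.1 hp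
    rw [h.trace_comm, ← mul_assoc, ← pow_add]
    congr 4
    omega

variable [OpensMeasurableSpace E] [SecondCountableTopology E] [IsProbabilityMeasure μ]

lemma integrable_mul_fderiv (h : IsTraceModel μ v ℓ X Tr n κ ρ) {f P : E → ℝ} (hf : Tame f)
    (hP : Tame P) (w : E) : Integrable (fun x => f x * fderiv ℝ P x w) μ :=
  (hf.growth.of_le_mul (hP.growth_fderiv_apply w) fun _ => norm_mul_le _ _).integrable
    h.finiteMoments (hf.continuous.mul (hP.continuous_fderiv_apply w))

/-- Gaussian integration by parts for a power of `X`. -/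
lemma integral_trace_pow_succ (h : IsTraceModel μ v ℓ X Tr n κ ρ) (k : ℕ) {P : E → ℝ}
    (hP : Tame P) :
    ∫ x, Tr (X x ^ (k + 1)) * P x ∂μ =
      ∫ x, (1 / (4 * n) * ∑ p ∈ Finset.range k, (Tr (X x ^ p) * Tr (X x ^ (k - 1 - p)) +
        κ * Tr (X x ^ (k - 1)))) * P x ∂μ +
      ∑ i, ∫ x, Tr (X x ^ k * X (v i)) * fderiv ℝ P x (v i) ∂μ := by
  have ht := fun i => tame_trace_pow_mul X Tr k (X (v i))
  have hI := h.finiteMoments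
  have e1 : ∀ x, Tr (X x ^ (k + 1)) * P x =
      ∑ i, ℓ i x * (Tr (X x ^ k * X (v i)) * P x) := fun x => by
    rw [pow_succ, congrArg (fun y => Tr (X x ^ k * y)) (h.expand x), Finset.mul_sum, map_sum,
      Finset.sum_mul]
    refine Finset.sum_congr rfl fun i _ => ?_
    rw [mul_smul_comm, map_smul, smul_eq_mul, mul_assoc]
  have e2 : ∀ i x, fderiv ℝ (fun x => Tr (X x ^ k * X (v i)) * P x) x (v i) =
      (∑ p ∈ Finset.range k, Tr (X x ^ (k - 1 - p) * X (v i) * X x ^ p * X (v i))) * P x +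
        Tr (X x ^ k * X (v i)) * fderiv ℝ P x (v i) := fun i x => by
    rw [fderiv_fun_mul ((ht i).differentiable x) (hP.differentiable x),
      ← fderiv_trace_pow_mul]
    simp only [_root_.add_apply, _root_.smul_apply, smul_eq_mul]
    ring
  have ht2 : ∀ i, Integrable (fun x => (∑ p ∈ Finset.range k,
      Tr (X x ^ (k - 1 - p) * X (v i) * X x ^ p * X (v i))) * P x) μ := fun i =>
    ((Tame.sum _ fun p _ => (Tame.clm Tr).comp (((((Tame.clm X).pow _).mul (Tame.const _)).mul
      ((Tame.clm X).pow _)).mul (Tame.const _))).mul hP).integrable hI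
  have ht3 := fun i => h.integrable_mul_fderiv (ht i) hP (v i)
  simp_rw [e1]
  rw [integral_finsetSum _ fun i _ => ((Tame.clm (ℓ i)).mul ((ht i).mul hP)).integrable hI]
  simp_rw [fun i => h.ibp i _ ((ht i).mul hP), e2, fun i => integral_add (ht2 i) (ht3 i)]
  rw [Finset.sum_add_distrib, ← integral_finsetSum _ fun i _ => ht2 i]
  congr 1
  refine integral_congr_ae (ae_of_all _ fun x => ?_)
  simp only
  rw [← Finset.sum_mul, Finset.sum_comm, Finset.mul_sum]
  congr 1
  refine Finset.sum_congr rfl fun p hp => ?_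
  have hp := Finset.mem_range.1 hp
  rw [h.sum_trace_mul, show k - 1 - p + p = k - 1 by omega]
  ring

end

section

open Polynomial

variable {E 𝒜 ι : Type*} [NormedAddCommGroup E] [NormedSpace ℝ E]
  [MeasurableSpace E] [NormedRing 𝒜] [NormedAlgebra ℝ 𝒜] [Fintype ι] {μ : Measure E}
  {v : ι → E} {ℓ : ι → E →L[ℝ] ℝ} {A : E →L[ℝ] 𝒜} {Tr : 𝒜 →L[ℝ] ℝ} {n κ ρ : ℝ}

variable [OpensMeasurableSpace E] [SecondCountableTopology E] [IsProbabilityMeasure μ]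

lemma integral_traceEval_X_mul (h : IsTraceModel μ v ℓ A Tr n κ ρ) (q : ℝ[X]) {P : E → ℝ}
    (hP : Tame P) :
    ∫ x, traceEval Tr (A x) (X * q) * P x ∂μ =
      ∫ x, (1 / (4 * n) * (traceEval Tr (A x) (dividedDiff (traceEval Tr (A x)) q) +
        κ * traceEval Tr (A x) (derivative q))) * P x ∂μ +
      ∑ i, ∫ x, Tr (aeval (A x) q * A (v i)) * fderiv ℝ P x (v i) ∂μ := by
  have hI := h.finiteMoments
  have ht := tame_traceEval Tr A
  have h2 := fun q : ℝ[X] => (((tame_dividedDiff ht ht q).add ((ht (derivative q)).const_mul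
    κ)).const_mul (1 / (4 * n))).mul hP
  have h3 := fun (q : ℝ[X]) i => h.integrable_mul_fderiv (tame_trace_aeval_mul Tr A q (A (v i)))
    hP (v i)
  induction q using Polynomial.induction_on' with
  | add p q hp hq =>
    have e1 : ∀ x, traceEval Tr (A x) (X * (p + q)) * P x =
        traceEval Tr (A x) (X * p) * P x + traceEval Tr (A x) (X * q) * P x := fun x => by
      rw [mul_add, map_add, add_mul]
    have e2 : ∀ x, (1 / (4 * n) * (traceEval Tr (A x) (dividedDiff (traceEval Tr (A x)) (p + q)) +
        κ * traceEval Tr (A x) (derivative (p + q)))) * P x =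
        (1 / (4 * n) * (traceEval Tr (A x) (dividedDiff (traceEval Tr (A x)) p) +
          κ * traceEval Tr (A x) (derivative p))) * P x +
        (1 / (4 * n) * (traceEval Tr (A x) (dividedDiff (traceEval Tr (A x)) q) +
          κ * traceEval Tr (A x) (derivative q))) * P x := fun x => by
      simp only [map_add]
      ring
    have e3 : ∀ i x, Tr (aeval (A x) (p + q) * A (v i)) * fderiv ℝ P x (v i) =
        Tr (aeval (A x) p * A (v i)) * fderiv ℝ P x (v i) +
        Tr (aeval (A x) q * A (v i)) * fderiv ℝ P x (v i) := fun i x => by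
      simp only [map_add, add_mul]
    simp_rw [e1, e2, e3, fun i => integral_add (h3 p i) (h3 q i)]
    rw [integral_add (((ht _).mul hP).integrable hI) (((ht _).mul hP).integrable hI),
      integral_add ((h2 p).integrable hI) ((h2 q).integrable hI), hp, hq, Finset.sum_add_distrib]
    ring
  | monomial m a =>
    have e1 : ∀ x, traceEval Tr (A x) (X * monomial m a) * P x =
        a * (Tr (A x ^ (m + 1)) * P x) := fun x => by
      rw [← C_mul_X_pow_eq_monomial, ← smul_eq_C_mul, mul_smul_comm, ← pow_succ', map_smul,
        traceEval_X_pow, smul_eq_mul, mul_assoc]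
    have e2 : ∀ x, (1 / (4 * n) * (traceEval Tr (A x) (dividedDiff (traceEval Tr (A x))
          (monomial m a)) + κ * traceEval Tr (A x) (derivative (monomial m a)))) * P x =
        a * ((1 / (4 * n) * ∑ p ∈ Finset.range m, (Tr (A x ^ p) * Tr (A x ^ (m - 1 - p)) +
          κ * Tr (A x ^ (m - 1)))) * P x) := fun x => by
      rw [← C_mul_X_pow_eq_monomial, ← smul_eq_C_mul]
      simp only [map_smul, dividedDiff_X_pow, map_sum, traceEval_X_pow, smul_eq_mul,
        derivative_X_pow, Finset.sum_add_distrib, Finset.sum_const, Finset.card_range,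
        nsmul_eq_mul, ← smul_eq_C_mul]
      ring
    have e3 : ∀ i x, Tr (aeval (A x) (monomial m a) * A (v i)) * fderiv ℝ P x (v i) =
        a * (Tr (A x ^ m * A (v i)) * fderiv ℝ P x (v i)) := fun i x => by
      rw [← C_mul_X_pow_eq_monomial, ← smul_eq_C_mul, map_smul, map_pow, aeval_X,
        smul_mul_assoc, map_smul, smul_eq_mul, mul_assoc]
    simp_rw [e1, e2, e3, integral_const_mul]
    rw [h.integral_trace_pow_succ m hP, ← Finset.mul_sum]
    ring

/-- The loop equation for the centered traces: the semicircle law is chosen so that the terms of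
order `n` cancel. -/
lemma integral_centeredEval_X_mul (h : IsTraceModel μ v ℓ A Tr n κ ρ) (q : ℝ[X]) {P : E → ℝ}
    (hP : Tame P) :
    ∫ x, (centeredEval Tr n (A x) (X * q) -
        1 / 2 * centeredEval Tr n (A x) (dividedDiff semicircle q)) * P x ∂μ =
      ∫ x, (1 / (4 * n) * (centeredEval Tr n (A x) (dividedDiff (centeredEval Tr n (A x)) q) +
        κ * centeredEval Tr n (A x) (derivative q)) + κ / 4 * semicircle (derivative q)) * P x ∂μ +
      ∑ i, ∫ x, Tr (aeval (A x) q * A (v i)) * fderiv ℝ P x (v i) ∂μ := by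
  have hI := h.finiteMoments
  have hn := h.ne_zero
  have ht := tame_traceEval Tr A
  have hc := tame_centeredEval Tr A n
  have h1 := h.integral_traceEval_X_mul q hP
  rw [← sub_eq_iff_eq_add'] at h1 ⊢
  rw [← h1, ← integral_sub ((((hc _).sub ((hc _).const_mul _)).mul hP).integrable hI)
    ((((((tame_dividedDiff hc hc q).add ((hc _).const_mul κ)).const_mul (1 / (4 * n))).add
      (Tame.const _)).mul hP).integrable hI),
    ← integral_sub (((ht _).mul hP).integrable hI) (((((tame_dividedDiff ht ht q).add
      ((ht _).const_mul κ)).const_mul (1 / (4 * n))).mul hP).integrable hI)]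
  refine integral_congr_ae (ae_of_all _ fun x => ?_)
  simp only
  have h2 := dividedDiff_perturb semicircle (centeredEval Tr n (A x)) n q
  rw [← traceEval_eq] at h2
  rw [h2]
  simp only [traceEval_eq Tr n (A x), LinearMap.add_apply, LinearMap.smul_apply, smul_eq_mul,
    semicircle_X_mul]
  field_simp
  ring

end

end IsTraceModel

/-! ### The mixed moments of a trace model -/

lemma sum_multiset_map_sum {ι κ : Type*} (t : Finset ι) (s : Multiset κ) (f : ι → κ → ℝ) :
    ∑ i ∈ t, (s.map (f i)).sum = (s.map fun a => ∑ i ∈ t, f i a).sum := by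
  induction s using Multiset.induction_on with
  | empty => simp
  | cons a s ih => simp [Finset.sum_add_distrib, ih]

lemma integrable_multiset_map_sum {Ω κ : Type*} [MeasurableSpace Ω] {μ : Measure Ω}
    (s : Multiset κ) {f : κ → Ω → ℝ} (hf : ∀ a, Integrable (f a) μ) :
    Integrable (fun x => (s.map fun a => f a x).sum) μ := by
  induction s using Multiset.induction_on with
  | empty => simp
  | cons a s ih =>
    simp only [Multiset.map_cons, Multiset.sum_cons]
    exact (hf a).fun_add ih

lemma integral_multiset_map_sum {Ω κ : Type*} [MeasurableSpace Ω] {μ : Measure Ω}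
    (s : Multiset κ) {f : κ → Ω → ℝ} (hf : ∀ a, Integrable (f a) μ) :
    ∫ x, (s.map fun a => f a x).sum ∂μ = (s.map fun a => ∫ x, f a x ∂μ).sum := by
  induction s using Multiset.induction_on with
  | empty => simp
  | cons a s ih =>
    simp only [Multiset.map_cons, Multiset.sum_cons]
    rw [integral_add (hf a) (integrable_multiset_map_sum s hf), ih]

namespace IsTraceModel

open Polynomial

section

variable {E 𝒜 ι : Type*} [NormedAddCommGroup E] [NormedSpace ℝ E]
  [MeasurableSpace E] [NormedRing 𝒜] [NormedAlgebra ℝ 𝒜] [Fintype ι] {μ : Measure E}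
  {v : ι → E} {ℓ : ι → E →L[ℝ] ℝ} {A : E →L[ℝ] 𝒜} {Tr : 𝒜 →L[ℝ] ℝ} {n κ ρ : ℝ}

lemma fderiv_traceEval (h : IsTraceModel μ v ℓ A Tr n κ ρ) (q : ℝ[X]) (x w : E) :
    fderiv ℝ (fun x => traceEval Tr (A x) q) x w = Tr (aeval (A x) (derivative q) * A w) := by
  induction q using Polynomial.induction_on' with
  | add p q hp hq =>
    simp only [map_add, add_mul]
    rw [fderiv_fun_add ((tame_traceEval Tr A p).differentiable x)
      ((tame_traceEval Tr A q).differentiable x), _root_.add_apply, hp, hq]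
  | monomial m a =>
    simp_rw [← C_mul_X_pow_eq_monomial, ← smul_eq_C_mul, map_smul, traceEval_X_pow, smul_eq_mul]
    rw [fderiv_const_mul ((tame_trace_pow A Tr m).differentiable x), _root_.smul_apply,
      h.fderiv_trace_pow, derivative_X_pow, ← smul_eq_C_mul, map_smul, map_pow, aeval_X]
    simp only [smul_mul_assoc, map_smul, smul_eq_mul]

lemma fderiv_centeredEval (h : IsTraceModel μ v ℓ A Tr n κ ρ) (q : ℝ[X]) (x w : E) :
    fderiv ℝ (fun x => centeredEval Tr n (A x) q) x w =
      Tr (aeval (A x) (derivative q) * A w) := by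
  rw [← h.fderiv_traceEval q x w]
  change fderiv ℝ (fun x => traceEval Tr (A x) q - n * semicircle q) x w = _
  rw [fderiv_sub_const]

lemma sum_trace_aeval_mul (h : IsTraceModel μ v ℓ A Tr n κ ρ) (p q : ℝ[X]) (x : E) :
    ∑ i, Tr (aeval (A x) p * A (v i)) * Tr (aeval (A x) q * A (v i)) =
      ρ / (4 * n) * traceEval Tr (A x) (p * q) := by
  induction p using Polynomial.induction_on' with
  | add p p' hp hp' => simp only [map_add, add_mul, Finset.sum_add_distrib, hp, hp', mul_add]
  | monomial m a =>
    induction q using Polynomial.induction_on' with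
    | add q q' hq hq' => simp only [map_add, mul_add, add_mul, Finset.sum_add_distrib, hq, hq']
    | monomial k b =>
      simp only [← C_mul_X_pow_eq_monomial, ← smul_eq_C_mul, map_smul, map_pow, aeval_X,
        smul_mul_assoc, mul_smul_comm, smul_eq_mul, ← pow_add, traceEval_X_pow]
      have := h.sum_mul_trace x m k
      calc _ = a * b * ∑ i, Tr (A x ^ m * A (v i)) * Tr (A x ^ k * A (v i)) := by
            rw [Finset.mul_sum]
            exact Finset.sum_congr rfl fun i _ => by ring
        _ = _ := by rw [this]; ring

lemma traceEval_one (h : IsTraceModel μ v ℓ A Tr n κ ρ) (a : 𝒜) : traceEval Tr a 1 = n := by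
  simpa [h.trace_one] using traceEval_X_pow Tr a 0

lemma centeredEval_one (h : IsTraceModel μ v ℓ A Tr n κ ρ) (a : 𝒜) :
    centeredEval Tr n a 1 = 0 := by
  simp [centeredEval, h.traceEval_one, semicircle_one]

lemma fderiv_prod_centeredEval (h : IsTraceModel μ v ℓ A Tr n κ ρ) (s : Multiset ℕ) (x w : E) :
    fderiv ℝ (fun x => (s.map fun a => centeredEval Tr n (A x) (X ^ a)).prod) x w =
      (s.map fun a => ((s.erase a).map fun b => centeredEval Tr n (A x) (X ^ b)).prod *
        Tr (aeval (A x) (derivative (X ^ a : ℝ[X])) * A w)).sum := by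
  have h1 := HasFDerivAt.multiset_prod (u := s) (x := x)
    (g := fun a x => centeredEval Tr n (A x) (X ^ a)) (g' := fun a => _)
    fun a _ => ((tame_centeredEval Tr A n (X ^ a)).differentiable x).hasFDerivAt
  rw [h1.fderiv]
  have h2 := map_multiset_sum (ContinuousLinearMap.apply ℝ ℝ w) (s.map fun a =>
    ((s.erase a).map fun b => centeredEval Tr n (A x) (X ^ b)).prod •
      fderiv ℝ (fun x => centeredEval Tr n (A x) (X ^ a)) x)
  rw [ContinuousLinearMap.apply_apply] at h2
  rw [h2, Multiset.map_map]
  congr 2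
  ext a
  simp [h.fderiv_centeredEval]

variable [OpensMeasurableSpace E] [SecondCountableTopology E] [IsProbabilityMeasure μ]

lemma loopEquations (h : IsTraceModel μ v ℓ A Tr n κ ρ) :
    LoopEquations κ ρ (1 / n) fun s =>
      ∫ x, (s.map fun a => centeredEval Tr n (A x) (X ^ a)).prod ∂μ where
  zero := by simp
  zero_cons s := by simp [h.centeredEval_one]
  succ_cons k s := by
    have hn := h.ne_zero
    have hI := h.finiteMoments
    have hc := tame_centeredEval Tr A n
    have hP : ∀ s : Multiset ℕ, Tame fun x =>
        (s.map fun a => centeredEval Tr n (A x) (X ^ a)).prod :=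
      fun s => Tame.multiset_prod s fun a => hc (X ^ a)
    have h1 := h.integral_centeredEval_X_mul (X ^ k) (hP s)
    have h2 : ∀ x, ∑ i, Tr (aeval (A x) (X ^ k : ℝ[X]) * A (v i)) *
        fderiv ℝ (fun x => (s.map fun a => centeredEval Tr n (A x) (X ^ a)).prod) x (v i) =
        (s.map fun a => ρ / 4 * a *
          (1 / n * ((((k + (a - 1)) ::ₘ s.erase a).map
            fun b => centeredEval Tr n (A x) (X ^ b)).prod) +
          semicircleMoment (k + (a - 1)) *
            ((s.erase a).map fun b => centeredEval Tr n (A x) (X ^ b)).prod)).sum := by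
      intro x
      simp_rw [h.fderiv_prod_centeredEval, ← Multiset.sum_map_mul_left]
      rw [sum_multiset_map_sum]
      congr 2
      ext a
      simp_rw [mul_left_comm _ (Multiset.prod _), ← Finset.mul_sum, h.sum_trace_aeval_mul]
      rw [derivative_X_pow, ← smul_eq_C_mul, mul_smul_comm, ← pow_add, map_smul, traceEval_eq Tr n]
      simp only [LinearMap.add_apply, LinearMap.smul_apply, smul_eq_mul, semicircle_X_pow,
        Multiset.map_cons, Multiset.prod_cons]
      field_simp
      ring
    rw [← integral_finsetSum _ fun i _ =>
      h.integrable_mul_fderiv (tame_trace_aeval_mul Tr A (X ^ k) (A (v i))) (hP s) (v i)] at h1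
    simp_rw [h2] at h1
    rw [integral_multiset_map_sum s fun a => (((hP _).integrable hI).const_mul _).fun_add
      (((hP _).integrable hI).const_mul _) |>.const_mul _] at h1
    simp_rw [integral_const_mul, fun a => integral_add
      (((hP ((k + (a - 1)) ::ₘ s.erase a)).integrable hI).const_mul (1 / n))
      (((hP (s.erase a)).integrable hI).const_mul (semicircleMoment (k + (a - 1)))),
      integral_const_mul] at h1
    have hPi := fun s => (hP s).integrable hI
    have h3 : ∫ x, (centeredEval Tr n (A x) (X * X ^ k) -
        1 / 2 * centeredEval Tr n (A x) (dividedDiff semicircle (X ^ k))) *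
          (s.map fun a => centeredEval Tr n (A x) (X ^ a)).prod ∂μ =
        ∫ x, (((k + 1) ::ₘ s).map fun a => centeredEval Tr n (A x) (X ^ a)).prod ∂μ -
        ∑ p ∈ Finset.range k, 1 / 2 * semicircleMoment p *
          ∫ x, (((k - 1 - p) ::ₘ s).map fun a => centeredEval Tr n (A x) (X ^ a)).prod ∂μ := by
      simp_rw [← integral_const_mul]
      rw [← integral_finsetSum _ fun p _ => (hPi _).const_mul _, ← integral_sub (hPi _)
        (integrable_finsetSum _ fun p _ => (hPi _).const_mul _)]
      refine integral_congr_ae (ae_of_all _ fun x => ?_)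
      simp only [← pow_succ', dividedDiff_X_pow, map_sum, map_smul, smul_eq_mul,
        Multiset.map_cons, Multiset.prod_cons, semicircle_X_pow, sub_mul, Finset.mul_sum,
        Finset.sum_mul, mul_assoc]
    have h4 : ∫ x, (1 / (4 * n) * (centeredEval Tr n (A x)
          (dividedDiff (centeredEval Tr n (A x)) (X ^ k)) +
          κ * centeredEval Tr n (A x) (derivative (X ^ k))) +
          κ / 4 * semicircle (derivative (X ^ k))) *
          (s.map fun a => centeredEval Tr n (A x) (X ^ a)).prod ∂μ =
        ∑ p ∈ Finset.range k, 1 / n / 4 * ∫ x, ((p ::ₘ (k - 1 - p) ::ₘ s).map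
          fun a => centeredEval Tr n (A x) (X ^ a)).prod ∂μ +
        κ * k / 4 * (1 / n * ∫ x, (((k - 1) ::ₘ s).map
          fun a => centeredEval Tr n (A x) (X ^ a)).prod ∂μ + semicircleMoment (k - 1) *
          ∫ x, (s.map fun a => centeredEval Tr n (A x) (X ^ a)).prod ∂μ) := by
      simp_rw [← integral_const_mul]
      rw [← integral_add ((hPi _).const_mul _) ((hPi _).const_mul _), ← integral_const_mul,
        ← integral_finsetSum _ fun p _ => (hPi _).const_mul _,
        ← integral_add (integrable_finsetSum _ fun p _ => (hPi _).const_mul _)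
          ((((hPi _).const_mul _).fun_add ((hPi _).const_mul _)).const_mul _)]
      refine integral_congr_ae (ae_of_all _ fun x => ?_)
      simp only [dividedDiff_X_pow, map_sum, map_smul, smul_eq_mul, derivative_X_pow,
        ← smul_eq_C_mul, semicircle_X_pow, Multiset.map_cons, Multiset.prod_cons, mul_add, add_mul,
        Finset.mul_sum, Finset.sum_mul, add_assoc]
      exact congrArg₂ _ (Finset.sum_congr rfl fun p _ => by ring) (by ring)
    rw [h3, h4] at h1
    rw [Finset.sum_add_distrib]
    linear_combination h1

end

end IsTraceModel

/-! ### Stein's identity for Chebyshev traces and the upper bound -/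

namespace IsTraceModel

open Polynomial

/-- For a linear expression in a polynomial, bounded first absolute moments for the powers of `X`
imply the same for all polynomials. -/
lemma uniformlyBounded_of_X_pow {I : Type*} {E : I → Type*} [∀ i, MeasurableSpace (E i)]
    {μ : ∀ i, Measure (E i)} {F : ∀ i, E i → ℝ[X] →ₗ[ℝ] ℝ}
    (hF : ∀ i q, Integrable (fun x => F i x q) (μ i))
    (h : ∀ a : ℕ, UniformlyBounded fun i => ∫ x, |F i x (X ^ a)| ∂(μ i)) (q : ℝ[X]) :
    UniformlyBounded fun i => ∫ x, |F i x q| ∂(μ i) := by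
  induction q using Polynomial.induction_on' with
  | add p q hp hq =>
    refine (hp.add hq).of_le fun i => ?_
    rw [abs_of_nonneg (integral_nonneg fun x => abs_nonneg _),
      ← integral_add (hF i p).abs (hF i q).abs]
    refine integral_mono (hF i _).abs ((hF i p).abs.add (hF i q).abs) fun x => ?_
    simp only [map_add]
    exact abs_add_le _ _
  | monomial m a =>
    simp_rw [← C_mul_X_pow_eq_monomial, ← smul_eq_C_mul, map_smul, smul_eq_mul, abs_mul,
      integral_const_mul]
    exact (h m).const_mul _

section Family

variable {I : Type*} {E 𝒜 ι : I → Type*} [∀ i, NormedAddCommGroup (E i)]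
  [∀ i, NormedSpace ℝ (E i)] [∀ i, MeasurableSpace (E i)] [∀ i, NormedRing (𝒜 i)]
  [∀ i, NormedAlgebra ℝ (𝒜 i)] [∀ i, Fintype (ι i)] [∀ i, OpensMeasurableSpace (E i)]
  [∀ i, SecondCountableTopology (E i)] {μ : ∀ i, Measure (E i)}
  [∀ i, IsProbabilityMeasure (μ i)] {v : ∀ i, ι i → E i} {ℓ : ∀ i, ι i → E i →L[ℝ] ℝ}
  {A : ∀ i, E i →L[ℝ] 𝒜 i} {Tr : ∀ i, 𝒜 i →L[ℝ] ℝ} {n : I → ℝ} {κ ρ : ℝ}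

lemma uniformlyBounded_sq (h : ∀ i, IsTraceModel (μ i) (v i) (ℓ i) (A i) (Tr i) (n i) κ ρ)
    (a : ℕ) :
    UniformlyBounded fun i => ∫ x, centeredEval (Tr i) (n i) (A i x) (X ^ a) ^ 2 ∂(μ i) := by
  have hε : UniformlyBounded fun i => 1 / n i := ⟨1, fun i => by
    have := (h i).one_le
    rw [abs_of_nonneg (by positivity)]
    exact (div_le_one (by linarith)).2 this⟩
  simpa [sq] using LoopEquations.uniformlyBounded hε (fun i => (h i).loopEquations) {a, a}

lemma uniformlyBounded_mul (h : ∀ i, IsTraceModel (μ i) (v i) (ℓ i) (A i) (Tr i) (n i) κ ρ)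
    (a b : ℕ) :
    UniformlyBounded fun i => ∫ x, |centeredEval (Tr i) (n i) (A i x) (X ^ a) *
      centeredEval (Tr i) (n i) (A i x) (X ^ b)| ∂(μ i) := by
  refine ((uniformlyBounded_sq h a).add (uniformlyBounded_sq h b)).of_le fun i => ?_
  have hI := (h i).finiteMoments
  have hc := tame_centeredEval (Tr i) (A i) (n i)
  rw [abs_of_nonneg (integral_nonneg fun x => abs_nonneg _), ← integral_add
    (((hc _).pow 2).integrable hI) (((hc _).pow 2).integrable hI)]
  refine integral_mono (((hc _).mul (hc _)).integrable hI).abs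
    ((((hc _).pow 2).add ((hc _).pow 2)).integrable hI) fun x => ?_
  simp only [abs_mul]
  nlinarith [sq_abs (centeredEval (Tr i) (n i) (A i x) (X ^ a)),
    sq_abs (centeredEval (Tr i) (n i) (A i x) (X ^ b)),
    sq_nonneg (|centeredEval (Tr i) (n i) (A i x) (X ^ a)| -
      |centeredEval (Tr i) (n i) (A i x) (X ^ b)|),
    sq_nonneg (centeredEval (Tr i) (n i) (A i x) (X ^ a)),
    sq_nonneg (centeredEval (Tr i) (n i) (A i x) (X ^ b))]

lemma uniformlyBounded_centeredEval
    (h : ∀ i, IsTraceModel (μ i) (v i) (ℓ i) (A i) (Tr i) (n i) κ ρ) (q : ℝ[X]) :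
    UniformlyBounded fun i => ∫ x, |centeredEval (Tr i) (n i) (A i x) q| ∂(μ i) := by
  refine uniformlyBounded_of_X_pow (F := fun i x => centeredEval (Tr i) (n i) (A i x))
    (fun i q => (tame_centeredEval (Tr i) (A i) (n i) q).integrable (h i).finiteMoments)
    (fun a => ?_) q
  refine ((UniformlyBounded.const 1).add (uniformlyBounded_sq h a)).of_le fun i => ?_
  have hI := (h i).finiteMoments
  have hc := tame_centeredEval (Tr i) (A i) (n i)
  have h1 : 1 = ∫ _, (1 : ℝ) ∂(μ i) := by simp
  rw [abs_of_nonneg (integral_nonneg fun x => abs_nonneg _)]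
  rw [h1, ← integral_add (integrable_const _) (((hc _).pow 2).integrable hI)]
  refine integral_mono ((hc _).integrable hI).abs
    (((Tame.const 1).add ((hc _).pow 2)).integrable hI) fun x => ?_
  simp only
  nlinarith [sq_abs (centeredEval (Tr i) (n i) (A i x) (X ^ a)),
    sq_nonneg (|centeredEval (Tr i) (n i) (A i x) (X ^ a)| - 1)]

lemma uniformlyBounded_dividedDiff
    (h : ∀ i, IsTraceModel (μ i) (v i) (ℓ i) (A i) (Tr i) (n i) κ ρ) (q : ℝ[X]) :
    UniformlyBounded fun i => ∫ x, |centeredEval (Tr i) (n i) (A i x)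
      (dividedDiff (centeredEval (Tr i) (n i) (A i x)) q)| ∂(μ i) := by
  have hc := fun i => tame_centeredEval (Tr i) (A i) (n i)
  refine uniformlyBounded_of_X_pow (F := fun i x => (centeredEval (Tr i) (n i) (A i x)).comp
      (dividedDiff (centeredEval (Tr i) (n i) (A i x))))
    (fun i q => (tame_dividedDiff (hc i) (hc i) q).integrable (h i).finiteMoments)
    (fun a => ?_) q
  refine (UniformlyBounded.sum (Finset.range a) fun p _ =>
    uniformlyBounded_mul h p (a - 1 - p)).of_le fun i => ?_
  have hI := fun p => (((hc i (X ^ p)).mul (hc i (X ^ (a - 1 - p)))).integrable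
    (h i).finiteMoments).abs
  rw [abs_of_nonneg (integral_nonneg fun x => abs_nonneg _),
    ← integral_finsetSum _ fun p _ => hI p]
  refine integral_mono ((tame_dividedDiff (hc i) (hc i) _).integrable (h i).finiteMoments).abs
    (integrable_finsetSum _ fun p _ => hI p) fun x => ?_
  simp only [LinearMap.comp_apply, dividedDiff_X_pow, map_sum, map_smul, smul_eq_mul]
  exact Finset.abs_sum_le_sum_abs _ _

end Family

section Errors

variable {E 𝒜 : Type*} [NormedAddCommGroup E] [NormedSpace ℝ E] [NormedRing 𝒜]
  [NormedAlgebra ℝ 𝒜]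

/-- The part of the loop equation for `T_{k + 1}` that is of order `1 / n`. -/
noncomputable def loopError (A : E →L[ℝ] 𝒜) (Tr : 𝒜 →L[ℝ] ℝ) (n κ : ℝ) (k : ℕ) (x : E) : ℝ :=
  1 / (4 * n) * (centeredEval Tr n (A x)
    (dividedDiff (centeredEval Tr n (A x)) (Chebyshev.U ℝ k)) +
    κ * centeredEval Tr n (A x) (derivative (Chebyshev.U ℝ k)))

/-- The deviation from its limit of the inner product of the gradients of the traces of `T_{j + 1}`
and `T_{k + 1}`, divided by `k + 1`. -/
noncomputable def gradientError (A : E →L[ℝ] 𝒜) (Tr : 𝒜 →L[ℝ] ℝ) (n ρ : ℝ) (j k : ℕ) (x : E) : ℝ :=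
  (j + 1) * ρ / (4 * n) * centeredEval Tr n (A x) (Chebyshev.U ℝ k * Chebyshev.U ℝ j)

lemma tame_loopError (A : E →L[ℝ] 𝒜) (Tr : 𝒜 →L[ℝ] ℝ) (n κ : ℝ) (k : ℕ) :
    Tame (loopError A Tr n κ k) :=
  (((tame_dividedDiff (tame_centeredEval Tr A n) (tame_centeredEval Tr A n) _).add
    ((tame_centeredEval Tr A n _).const_mul κ))).const_mul _

lemma tame_gradientError (A : E →L[ℝ] 𝒜) (Tr : 𝒜 →L[ℝ] ℝ) (n ρ : ℝ) (j k : ℕ) :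
    Tame (gradientError A Tr n ρ j k) :=
  (tame_centeredEval Tr A n _).const_mul _

end Errors

section Stein

variable {E 𝒜 ι : Type*} [NormedAddCommGroup E] [NormedSpace ℝ E]
  [MeasurableSpace E] [NormedRing 𝒜] [NormedAlgebra ℝ 𝒜] [Fintype ι] {μ : Measure E}
  {v : ι → E} {ℓ : ι → E →L[ℝ] ℝ} {A : E →L[ℝ] 𝒜} {Tr : 𝒜 →L[ℝ] ℝ} {n κ ρ : ℝ}

/-- The vector of the traces of the Chebyshev polynomials `T_1, …, T_d`, centered at their
expectations. -/
noncomputable def chebyshevVector (μ : Measure E) (A : E →L[ℝ] 𝒜) (Tr : 𝒜 →L[ℝ] ℝ) (n : ℝ) (d : ℕ)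
    (x : E) : EuclideanSpace ℝ (Fin d) :=
  WithLp.toLp 2 fun j => centeredEval Tr n (A x) (Chebyshev.T ℝ ((j : ℕ) + 1 : ℕ)) -
    ∫ y, centeredEval Tr n (A y) (Chebyshev.T ℝ ((j : ℕ) + 1 : ℕ)) ∂μ

lemma tame_chebyshevVector (μ : Measure E) (A : E →L[ℝ] 𝒜) (Tr : 𝒜 →L[ℝ] ℝ) (n : ℝ) (d : ℕ) :
    Tame (chebyshevVector μ A Tr n d) := by
  have h : ∀ x, chebyshevVector μ A Tr n d x = ∑ j : Fin d,
      (centeredEval Tr n (A x) (Chebyshev.T ℝ ((j : ℕ) + 1 : ℕ)) -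
      ∫ y, centeredEval Tr n (A y) (Chebyshev.T ℝ ((j : ℕ) + 1 : ℕ)) ∂μ) •
        EuclideanSpace.single j (1 : ℝ) := fun x => by
    ext i
    simp [chebyshevVector, Finset.sum_apply, Pi.single_apply]
  rw [funext h]
  exact Tame.sum _ fun j _ => (Tame.clm ((ContinuousLinearMap.id ℝ ℝ).smulRight
    (EuclideanSpace.single j (1 : ℝ)))).comp ((tame_centeredEval Tr A n _).sub (Tame.const _))

/-- The derivative of a function of the traces, by the chain rule. -/
lemma fderiv_comp_chebyshevVector (h : IsTraceModel μ v ℓ A Tr n κ ρ) {d : ℕ}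
    {g : EuclideanSpace ℝ (Fin d) → ℝ} (hg : BddC1 g) (x w : E) :
    fderiv ℝ (fun x => g (chebyshevVector μ A Tr n d x)) x w =
      ∑ j : Fin d, ((j : ℕ) + 1) * Tr (aeval (A x) (Chebyshev.U ℝ (j : ℕ)) * A w) *
        fderiv ℝ g (chebyshevVector μ A Tr n d x) (EuclideanSpace.single j 1) := by
  have hW := tame_chebyshevVector μ A Tr n d
  rw [fderiv_fun_comp x (hg.tame.differentiable _) (hW.differentiable x),
    ContinuousLinearMap.comp_apply, EuclideanSpace.clm_apply_eq_sum]
  refine Finset.sum_congr rfl fun j _ => ?_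
  congr 1
  have h1 : HasFDerivAt (fun x => chebyshevVector μ A Tr n d x j)
      ((EuclideanSpace.proj (𝕜 := ℝ) j : EuclideanSpace ℝ (Fin d) →L[ℝ] ℝ).comp
        (fderiv ℝ (chebyshevVector μ A Tr n d) x)) x :=
    (EuclideanSpace.proj (𝕜 := ℝ) j : EuclideanSpace ℝ (Fin d) →L[ℝ] ℝ).hasFDerivAt.comp x
      (hW.differentiable x).hasFDerivAt
  have h2 : fderiv ℝ (fun x => chebyshevVector μ A Tr n d x j) x w =
      ((j : ℕ) + 1) * Tr (aeval (A x) (Chebyshev.U ℝ (j : ℕ)) * A w) := by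
    change fderiv ℝ (fun x => centeredEval Tr n (A x) (Chebyshev.T ℝ ((j : ℕ) + 1 : ℕ)) -
      ∫ y, centeredEval Tr n (A y) (Chebyshev.T ℝ ((j : ℕ) + 1 : ℕ)) ∂μ) x w = _
    rw [fderiv_sub_const, h.fderiv_centeredEval, Chebyshev.T_derivative_eq_U]
    have h3 : ((((j : ℕ) + 1 : ℕ) : ℤ) : ℝ[X]) * Chebyshev.U ℝ ((((j : ℕ) + 1 : ℕ) : ℤ) - 1) =
        ((j : ℕ) + 1 : ℝ) • Chebyshev.U ℝ (j : ℕ) := by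
      rw [smul_eq_C_mul]
      simp
    rw [h3, map_smul, smul_mul_assoc, map_smul, smul_eq_mul]
  rw [← h2, h1.fderiv]
  rfl

variable [OpensMeasurableSpace E] [SecondCountableTopology E] [IsProbabilityMeasure μ]

/-- The loop equation for the Chebyshev polynomial `T_{k + 1}`: in this basis the linear part of
the equation is diagonal. -/
lemma integral_chebyshev_mul (h : IsTraceModel μ v ℓ A Tr n κ ρ) (k : ℕ) {P : E → ℝ}
    (hP : Tame P) :
    ∫ x, centeredEval Tr n (A x) (Chebyshev.T ℝ (k + 1 : ℕ)) * P x ∂μ =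
      ∫ x, (loopError A Tr n κ k x + κ / 4 * semicircle (derivative (Chebyshev.U ℝ k))) * P x ∂μ +
      ∫ x, ∑ i, Tr (aeval (A x) (Chebyshev.U ℝ k) * A (v i)) * fderiv ℝ P x (v i) ∂μ := by
  have h1 := h.integral_centeredEval_X_mul (Chebyshev.U ℝ k) hP
  rw [← integral_finsetSum _ fun i _ => h.integrable_mul_fderiv (tame_trace_aeval_mul Tr A _ _)
    hP (v i)] at h1
  have h2 : X * Chebyshev.U ℝ k - (1 / 2 : ℝ) • dividedDiff semicircle (Chebyshev.U ℝ k) =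
      Chebyshev.T ℝ (k + 1 : ℕ) := by
    have h3 := Chebyshev.T_eq_X_mul_U_sub_U ℝ ((k : ℤ) - 1)
    rw [show (k : ℤ) - 1 + 2 = (k + 1 : ℕ) by push_cast; ring, sub_add_cancel] at h3
    rw [(dividedDiff_semicircle_U k).1, h3, smul_eq_C_mul, ← mul_assoc,
      show (2 : ℝ[X]) = C 2 from rfl, ← C_mul]
    norm_num
  simp_rw [← h2, map_sub, map_smul, smul_eq_mul]
  exact h1

/-- The centered Chebyshev traces satisfy Stein's identity up to errors of order `1 / n`. -/
theorem steinIdentity (h : IsTraceModel μ v ℓ A Tr n κ ρ) (hρ : 0 < ρ) (d : ℕ) :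
    SteinIdentity μ (chebyshevVector μ A Tr n d) (fun j => √(ρ * ((j : ℕ) + 1) / 4))
      (fun j k => gradientError A Tr n ρ j k)
      (fun k x => loopError A Tr n κ k x - ∫ y, loopError A Tr n κ k y ∂μ) := by
  intro g hg k
  have hI := h.finiteMoments
  have hn := h.ne_zero
  have hW := tame_chebyshevVector μ A Tr n d
  have hP : Tame fun x => g (chebyshevVector μ A Tr n d x) := hg.tame.comp hW
  have hS := tame_loopError A Tr n κ k
  have hT := tame_centeredEval Tr A n (Chebyshev.T ℝ ((k : ℕ) + 1 : ℕ))
  have h0 := h.integral_chebyshev_mul k (Tame.const (1 : ℝ))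
  have h1 := h.integral_chebyshev_mul k hP
  simp only [mul_one, fderiv_fun_const, Pi.zero_apply, _root_.zero_apply, mul_zero,
    Finset.sum_const_zero, integral_zero, add_zero] at h0
  rw [integral_add (hS.integrable hI) (integrable_const _), integral_const, probReal_univ,
    one_smul] at h0
  have hgrad : ∀ x, ∑ i, Tr (aeval (A x) (Chebyshev.U ℝ (k : ℕ)) * A (v i)) *
      fderiv ℝ (fun x => g (chebyshevVector μ A Tr n d x)) x (v i) =
      ∑ j : Fin d, gradientError A Tr n ρ j k x *
        fderiv ℝ g (chebyshevVector μ A Tr n d x) (EuclideanSpace.single j 1) +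
      ρ * ((k : ℕ) + 1) / 4 *
        fderiv ℝ g (chebyshevVector μ A Tr n d x) (EuclideanSpace.single k 1) := by
    intro x
    have e1 : ∀ j : Fin d, ((j : ℕ) + 1) * (ρ / (4 * n)) * traceEval Tr (A x)
        (Chebyshev.U ℝ (k : ℕ) * Chebyshev.U ℝ (j : ℕ)) = gradientError A Tr n ρ j k x +
        if k = j then ρ * ((k : ℕ) + 1) / 4 else 0 := fun j => by
      rw [traceEval_eq Tr n, LinearMap.add_apply, LinearMap.smul_apply, semicircle_U_mul_U,
        gradientError]
      by_cases hkj : k = j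
      · subst hkj
        simp only [if_true, smul_eq_mul]
        field_simp
        ring
      · rw [if_neg hkj, if_neg fun h => hkj (Fin.ext h)]
        simp only [smul_eq_mul]
        ring
    have e2 : ∀ j : Fin d, ∑ i, Tr (aeval (A x) (Chebyshev.U ℝ (k : ℕ)) * A (v i)) *
        (((j : ℕ) + 1) * Tr (aeval (A x) (Chebyshev.U ℝ (j : ℕ)) * A (v i)) *
        fderiv ℝ g (chebyshevVector μ A Tr n d x) (EuclideanSpace.single j 1)) =
        (gradientError A Tr n ρ j k x + if k = j then ρ * ((k : ℕ) + 1) / 4 else 0) *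
        fderiv ℝ g (chebyshevVector μ A Tr n d x) (EuclideanSpace.single j 1) := fun j => by
      rw [← e1, mul_assoc _ (ρ / (4 * n)), ← h.sum_trace_aeval_mul, Finset.mul_sum, Finset.sum_mul]
      exact Finset.sum_congr rfl fun i _ => by ring
    simp_rw [h.fderiv_comp_chebyshevVector hg, Finset.mul_sum]
    rw [Finset.sum_comm]
    simp_rw [e2, add_mul, Finset.sum_add_distrib, ite_mul, zero_mul]
    simp
  have hgi := fun j => hg.tame.continuous_fderiv_apply (EuclideanSpace.single j (1 : ℝ))
  have hD : ∀ (j : Fin d) (f : E → ℝ), Tame f → Integrable (fun x => f x *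
      fderiv ℝ g (chebyshevVector μ A Tr n d x) (EuclideanSpace.single j 1)) μ := fun j f hf =>
    (hf.growth.of_le_mul ((hg.tame.growth_fderiv_apply _).comp hW.growth)
      fun _ => norm_mul_le _ _).integrable hI (hf.continuous.mul ((hgi j).comp hW.continuous))
  have hD1 := hD k _ (Tame.const 1)
  simp only [one_mul] at hD1
  simp_rw [hgrad] at h1
  rw [integral_add (integrable_finsetSum _ fun j _ => hD j _ (tame_gradientError A Tr n ρ j k))
    (hD1.const_mul _), integral_finsetSum _ fun j _ => hD j _ (tame_gradientError A Tr n ρ j k),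
    integral_const_mul] at h1
  have h2 : ∫ x, chebyshevVector μ A Tr n d x k * g (chebyshevVector μ A Tr n d x) ∂μ =
      ∫ x, centeredEval Tr n (A x) (Chebyshev.T ℝ ((k : ℕ) + 1 : ℕ)) *
        g (chebyshevVector μ A Tr n d x) ∂μ -
      (∫ y, centeredEval Tr n (A y) (Chebyshev.T ℝ ((k : ℕ) + 1 : ℕ)) ∂μ) *
        ∫ x, g (chebyshevVector μ A Tr n d x) ∂μ := by
    rw [← integral_const_mul, ← integral_sub ((hT.mul hP).integrable hI)
      ((hP.integrable hI).const_mul _)]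
    simp only [← sub_mul]
    rfl
  simp_rw [add_mul] at h1
  rw [integral_add ((hS.mul hP).integrable hI) ((hP.integrable hI).const_mul _),
    integral_const_mul] at h1
  simp_rw [sub_mul]
  rw [integral_sub ((hS.mul hP).integrable hI) ((hP.integrable hI).const_mul _),
    integral_const_mul, h2, h1, h0, Real.sq_sqrt (by positivity)]
  ring

end Stein

section Family

variable {I : Type*} {E 𝒜 ι : I → Type*} [∀ i, NormedAddCommGroup (E i)]
  [∀ i, NormedSpace ℝ (E i)] [∀ i, MeasurableSpace (E i)] [∀ i, NormedRing (𝒜 i)]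
  [∀ i, NormedAlgebra ℝ (𝒜 i)] [∀ i, Fintype (ι i)] [∀ i, BorelSpace (E i)]
  [∀ i, SecondCountableTopology (E i)] {μ : ∀ i, Measure (E i)}
  [∀ i, IsProbabilityMeasure (μ i)] {v : ∀ i, ι i → E i} {ℓ : ∀ i, ι i → E i →L[ℝ] ℝ}
  {A : ∀ i, E i →L[ℝ] 𝒜 i} {Tr : ∀ i, 𝒜 i →L[ℝ] ℝ} {n : I → ℝ} {κ ρ : ℝ}

lemma integral_abs_sub_integral_le {Ω : Type*} [MeasurableSpace Ω] {μ : Measure Ω}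
    [IsProbabilityMeasure μ] {f : Ω → ℝ} (hf : Integrable f μ) :
    ∫ x, |f x - ∫ y, f y ∂μ| ∂μ ≤ 2 * ∫ x, |f x| ∂μ := by
  calc ∫ x, |f x - ∫ y, f y ∂μ| ∂μ ≤ ∫ x, (|f x| + |∫ y, f y ∂μ|) ∂μ :=
        integral_mono (hf.sub (integrable_const _)).abs (hf.abs.add (integrable_const _))
          fun x => abs_sub _ _
    _ = ∫ x, |f x| ∂μ + |∫ y, f y ∂μ| := by
        rw [integral_add hf.abs (integrable_const _)]
        simp
    _ ≤ _ := by
        rw [two_mul]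
        exact add_le_add le_rfl abs_integral_le_integral_abs

/-- The quantitative central limit theorem for the Chebyshev traces of a family of trace models. -/
theorem exists_wassersteinDist_le
    (h : ∀ i, IsTraceModel (μ i) (v i) (ℓ i) (A i) (Tr i) (n i) κ ρ) (hρ : 0 < ρ) (d : ℕ) :
    ∃ K : ℝ, 0 < K ∧ ∀ i, wassersteinDist ((μ i).map (chebyshevVector (μ i) (A i) (Tr i) (n i) d))
      ((stdNormal d).map (diagScale fun j => √(ρ * ((j : ℕ) + 1) / 4))) ≤
        ENNReal.ofReal (K / n i) := by
  have hG : ∀ j k : Fin d, UniformlyBounded fun i =>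
      n i * ∫ x, |gradientError (A i) (Tr i) (n i) ρ j k x| ∂(μ i) := fun j k => by
    refine ((uniformlyBounded_centeredEval h (Chebyshev.U ℝ (k : ℕ) *
      Chebyshev.U ℝ (j : ℕ))).const_mul (((j : ℕ) + 1) * ρ / 4)).of_le fun i => le_of_eq ?_
    have hn := (h i).one_le
    rw [abs_of_nonneg (mul_nonneg (by linarith) (integral_nonneg fun _ => abs_nonneg _))]
    simp only [gradientError, abs_mul, integral_const_mul]
    rw [abs_of_nonneg (by positivity)]
    field_simp
  have hR : ∀ k : Fin d, UniformlyBounded fun i => n i * ∫ x, |loopError (A i) (Tr i) (n i) κ k x -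
      ∫ y, loopError (A i) (Tr i) (n i) κ k y ∂(μ i)| ∂(μ i) := fun k => by
    refine (((uniformlyBounded_dividedDiff h (Chebyshev.U ℝ (k : ℕ))).add
      ((uniformlyBounded_centeredEval h (derivative (Chebyshev.U ℝ (k : ℕ)))).const_mul
        |κ|)).const_mul (1 / 2)).of_le fun i => ?_
    have hn := (h i).one_le
    have hI := (h i).finiteMoments
    have hc := tame_centeredEval (Tr i) (A i) (n i)
    have hd := tame_dividedDiff hc hc (Chebyshev.U ℝ (k : ℕ))
    have hS := (tame_loopError (A i) (Tr i) (n i) κ k).integrable hI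
    have h1 := integral_abs_sub_integral_le hS
    have h2 : ∫ x, |loopError (A i) (Tr i) (n i) κ k x| ∂(μ i) ≤
        1 / (4 * n i) * (∫ x, |centeredEval (Tr i) (n i) (A i x)
          (dividedDiff (centeredEval (Tr i) (n i) (A i x)) (Chebyshev.U ℝ (k : ℕ)))| ∂(μ i) +
        |κ| * ∫ x, |centeredEval (Tr i) (n i) (A i x)
          (derivative (Chebyshev.U ℝ (k : ℕ)))| ∂(μ i)) := by
      rw [← integral_const_mul, ← integral_add (hd.integrable hI).abs
        (((hc _).integrable hI).abs.const_mul _), ← integral_const_mul]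
      refine integral_mono hS.abs (((hd.integrable hI).abs.add
        (((hc _).integrable hI).abs.const_mul _)).const_mul _) fun x => ?_
      simp only [loopError, abs_mul]
      rw [abs_of_nonneg (by positivity : 0 ≤ 1 / (4 * n i)), ← abs_mul κ]
      exact mul_le_mul_of_nonneg_left (abs_add_le _ _) (by positivity)
    rw [abs_of_nonneg (mul_nonneg (by linarith) (integral_nonneg fun _ => abs_nonneg _))]
    calc _ ≤ n i * (2 * (1 / (4 * n i) * _)) := mul_le_mul_of_nonneg_left
          (h1.trans (mul_le_mul_of_nonneg_left h2 zero_le_two)) (by linarith)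
      _ = _ := by
          field_simp
          norm_num
  obtain ⟨K, hK⟩ := UniformlyBounded.const_mul (Real.pi / 2)
    (UniformlyBounded.sum Finset.univ fun k _ => (UniformlyBounded.sum Finset.univ fun j _ =>
      (hG j k).const_mul (√(ρ * ((j : ℕ) + 1) / 4))⁻¹).add (hR k))
  refine ⟨max K 1, by positivity, fun i => ?_⟩
  have hn := (h i).one_le
  have hI := (h i).finiteMoments
  have hW := tame_chebyshevVector (μ i) (A i) (Tr i) (n i) d
  refine (((h i).steinIdentity hρ d).wassersteinDist_le hW.continuous.measurable
    (hW.integrable hI) (fun k => by positivity)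
    (fun j k => (tame_gradientError _ _ _ _ _ _).integrable hI)
    (fun k => ((tame_loopError _ _ _ _ _).integrable hI).sub (integrable_const _))).trans
    (ENNReal.ofReal_le_ofReal ?_)
  rw [le_div_iff₀ (by linarith)]
  refine le_trans (le_of_eq ?_) ((le_abs_self _).trans ((hK i).trans (le_max_left _ _)))
  rw [mul_assoc, Finset.sum_mul]
  congr 1
  refine Finset.sum_congr rfl fun k _ => ?_
  rw [add_mul, Finset.sum_mul]
  refine congrArg₂ _ (Finset.sum_congr rfl fun j _ => ?_) (mul_comm _ _)
  ring

end Family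

end IsTraceModel

/-! ### The lower bound -/

section TestFunctions

lemma hasDerivAt_exp_neg_sq (x : ℝ) :
    HasDerivAt (fun x : ℝ => Real.exp (-x ^ 2 / 2)) (-(x * Real.exp (-x ^ 2 / 2))) x := by
  have h := ((((hasDerivAt_id x).pow 2).neg).div_const 2).exp
  refine h.congr_deriv ?_
  simp
  ring

lemma hasDerivAt_mul_exp_neg_sq (x : ℝ) : HasDerivAt (fun x : ℝ => x * Real.exp (-x ^ 2 / 2))
    ((1 - x ^ 2) * Real.exp (-x ^ 2 / 2)) x := by
  refine ((hasDerivAt_id x).mul (hasDerivAt_exp_neg_sq x)).congr_deriv ?_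
  simp
  ring

lemma hasDerivAt_sq_mul_exp_neg_sq (x : ℝ) :
    HasDerivAt (fun x : ℝ => x ^ 2 * Real.exp (-x ^ 2 / 2))
      ((2 * x - x ^ 3) * Real.exp (-x ^ 2 / 2)) x := by
  refine (((hasDerivAt_id x).pow 2).mul (hasDerivAt_exp_neg_sq x)).congr_deriv ?_
  simp
  ring

/-- A polynomial dominated by the second order Taylor polynomial of `exp (x ^ 2 / 2)`. -/
lemma abs_mul_exp_neg_sq_le {p x C : ℝ} (hC : 0 ≤ C)
    (h : |p| ≤ C * (1 + x ^ 2 / 2 + (x ^ 2 / 2) ^ 2 / 2)) : |p * Real.exp (-x ^ 2 / 2)| ≤ C := by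
  have h1 := Real.quadratic_le_exp_of_nonneg (by positivity : 0 ≤ x ^ 2 / 2)
  rw [abs_mul, abs_of_pos (Real.exp_pos _), neg_div, Real.exp_neg, ← div_eq_mul_inv,
    div_le_iff₀ (Real.exp_pos _)]
  exact h.trans (mul_le_mul_of_nonneg_left h1 hC)

lemma abs_mul_exp_neg_sq_le_one (x : ℝ) : |x * Real.exp (-x ^ 2 / 2)| ≤ 1 := by
  refine abs_mul_exp_neg_sq_le zero_le_one ?_
  rw [abs_le]
  constructor <;> nlinarith [sq_nonneg (x - 1), sq_nonneg (x + 1), sq_nonneg (x ^ 2)]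

lemma abs_deriv_mul_exp_neg_sq_le (x : ℝ) : |(1 - x ^ 2) * Real.exp (-x ^ 2 / 2)| ≤ 2 := by
  refine abs_mul_exp_neg_sq_le zero_le_two ?_
  rw [abs_le]
  constructor <;> nlinarith [sq_nonneg x, sq_nonneg (x ^ 2)]

lemma lipschitzWith_mul_exp_neg_sq :
    LipschitzWith 2 fun x : ℝ => x * Real.exp (-x ^ 2 / 2) :=
  lipschitzWith_of_nnnorm_deriv_le (fun x => (hasDerivAt_mul_exp_neg_sq x).differentiableAt)
    fun x => by
      rw [(hasDerivAt_mul_exp_neg_sq x).deriv]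
      exact abs_deriv_mul_exp_neg_sq_le x

lemma lipschitzWith_sq_mul_exp_neg_sq :
    LipschitzWith 4 fun x : ℝ => x ^ 2 * Real.exp (-x ^ 2 / 2) :=
  lipschitzWith_of_nnnorm_deriv_le (fun x => (hasDerivAt_sq_mul_exp_neg_sq x).differentiableAt)
    fun x => by
      rw [(hasDerivAt_sq_mul_exp_neg_sq x).deriv]
      refine abs_mul_exp_neg_sq_le (C := 4) (by norm_num) ?_
      rw [abs_le]
      constructor <;> nlinarith [mul_nonneg (sq_nonneg (x + 1)) (by positivity : 0 ≤ 2 + x ^ 2),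
        mul_nonneg (sq_nonneg (x - 1)) (by positivity : 0 ≤ 2 + x ^ 2), sq_nonneg x]

variable {d : ℕ} (j : Fin d)

lemma lipschitzWith_apply : LipschitzWith 1 fun y : EuclideanSpace ℝ (Fin d) => y j :=
  LipschitzWith.of_dist_le_mul fun x y => by
    rw [NNReal.coe_one, one_mul, dist_eq_norm, dist_eq_norm]
    exact PiLp.norm_apply_le (x - y) j

lemma hasFDerivAt_exp_neg_sq (y : EuclideanSpace ℝ (Fin d)) :
    HasFDerivAt (fun y : EuclideanSpace ℝ (Fin d) => Real.exp (-y j ^ 2 / 2))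
      (-(y j * Real.exp (-y j ^ 2 / 2)) •
        (EuclideanSpace.proj (𝕜 := ℝ) j : EuclideanSpace ℝ (Fin d) →L[ℝ] ℝ)) y :=
  HasDerivAt.comp_hasFDerivAt (h₂ := fun t : ℝ => Real.exp (-t ^ 2 / 2)) y
    (hasDerivAt_exp_neg_sq (y j))
    (EuclideanSpace.proj (𝕜 := ℝ) j : EuclideanSpace ℝ (Fin d) →L[ℝ] ℝ).hasFDerivAt

lemma bddC1_exp_neg_sq :
    BddC1 fun y : EuclideanSpace ℝ (Fin d) => Real.exp (-y j ^ 2 / 2) := by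
  refine ⟨?_, ⟨1, fun y => ?_⟩, 1, fun y => ?_⟩
  · have : ContDiff ℝ 1 fun y : EuclideanSpace ℝ (Fin d) => y j :=
      (EuclideanSpace.proj (𝕜 := ℝ) j : EuclideanSpace ℝ (Fin d) →L[ℝ] ℝ).contDiff
    fun_prop
  · rw [Real.norm_of_nonneg (Real.exp_pos _).le, Real.exp_le_one_iff]
    have := sq_nonneg (y j)
    linarith
  · rw [(hasFDerivAt_exp_neg_sq j y).fderiv, norm_smul, norm_neg]
    refine mul_le_one₀ (abs_mul_exp_neg_sq_le_one _) (norm_nonneg _) ?_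
    exact ContinuousLinearMap.opNorm_le_bound _ zero_le_one fun v => by
      rw [one_mul]
      exact PiLp.norm_apply_le v j

/-- The function `z exp(-z² / 2)` has mean zero for a centered normal variable. -/
lemma integral_mul_exp_neg_sq (s : Fin d → ℝ) :
    ∫ z, diagScale s z j * Real.exp (-(diagScale s z j) ^ 2 / 2) ∂(stdNormal d) = 0 := by
  have hg := bddC1_exp_neg_sq j
  have h1 := integrationByParts_stdNormal j _ (hg.comp_clm_add (diagScale s) 0).tame
  simp only [fderiv_comp_clm_add hg.tame.differentiable, (hasFDerivAt_exp_neg_sq j _).fderiv] at h1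
  simp only [add_zero, diagScale_single, _root_.smul_apply, PiLp.proj_apply, PiLp.smul_apply,
    PiLp.single_apply, if_true, smul_eq_mul, mul_one, ContinuousLinearMap.proj_apply] at h1
  have h2 : ∫ z, diagScale s z j * Real.exp (-(diagScale s z j) ^ 2 / 2) ∂(stdNormal d) =
      s j * ∫ z, z j * Real.exp (-(diagScale s z j) ^ 2 / 2) ∂(stdNormal d) := by
    rw [← integral_const_mul]
    congr 1
    ext z
    rw [diagScale_apply]
    ring
  rw [integral_mul_const, integral_neg] at h1
  rw [h1] at h2
  nlinarith [sq_nonneg (s j)]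

lemma integral_sq_mul_exp_neg_sq_pos {s : Fin d → ℝ} (hs : s j ≠ 0) :
    0 < ∫ z, (diagScale s z j) ^ 2 * Real.exp (-(diagScale s z j) ^ 2 / 2) ∂(stdNormal d) := by
  have hc : Continuous fun x : ℝ => (s j * x) ^ 2 * Real.exp (-(s j * x) ^ 2 / 2) := by fun_prop
  have h1 : ∫ z, (diagScale s z j) ^ 2 * Real.exp (-(diagScale s z j) ^ 2 / 2) ∂(stdNormal d) =
      ∫ x, (s j * x) ^ 2 * Real.exp (-(s j * x) ^ 2 / 2) ∂(gaussianReal 0 1) := by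
    simp only [diagScale_apply]
    exact integral_comp_eval (μ := fun _ : Fin d => gaussianReal 0 1) (i := j)
      (f := fun x : ℝ => (s j * x) ^ 2 * Real.exp (-(s j * x) ^ 2 / 2)) hc.aestronglyMeasurable
  rw [h1, integral_pos_iff_support_of_nonneg (fun x => by positivity)]
  · have hsupp : Function.support (fun x : ℝ => (s j * x) ^ 2 * Real.exp (-(s j * x) ^ 2 / 2)) =
        {0}ᶜ := by
      ext x
      simp [hs, Real.exp_ne_zero]
    have := nullSingletonClass_gaussianReal (μ := 0) one_ne_zero
    rw [hsupp, prob_compl_eq_one_sub (measurableSet_singleton 0), measure_singleton]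
    simp
  · refine Integrable.of_bound hc.aestronglyMeasurable 2 (ae_of_all _ fun x => ?_)
    refine abs_mul_exp_neg_sq_le zero_le_two ?_
    rw [abs_of_nonneg (sq_nonneg _)]
    nlinarith [sq_nonneg (s j * x), sq_nonneg ((s j * x) ^ 2)]

end TestFunctions

lemma abs_integral_sub_le_wassersteinDist {d : ℕ} {μ ν : Measure (EuclideanSpace ℝ (Fin d))}
    (h : wassersteinDist μ ν ≠ ⊤) {f : EuclideanSpace ℝ (Fin d) → ℝ} {L : NNReal} (hL : L ≠ 0)
    (hf : LipschitzWith L f) : |∫ x, f x ∂μ - ∫ x, f x ∂ν| ≤ L * (wassersteinDist μ ν).toReal := by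
  have hL' : (0 : ℝ) < L := by positivity
  have hf1 : LipschitzWith 1 fun x => (L : ℝ)⁻¹ * f x := LipschitzWith.of_dist_le_mul fun x y => by
    rw [NNReal.coe_one, one_mul, Real.dist_eq, ← mul_sub, abs_mul, abs_of_pos (inv_pos.2 hL'),
      inv_mul_le_iff₀ hL', ← Real.dist_eq]
    exact hf.dist_le_mul x y
  have h1 := le_iSup (fun f : {f : EuclideanSpace ℝ (Fin d) → ℝ // LipschitzWith 1 f} =>
    ENNReal.ofReal |∫ x, f.1 x ∂μ - ∫ x, f.1 x ∂ν|) ⟨_, hf1⟩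
  have h2 := (ENNReal.ofReal_le_iff_le_toReal h).1 h1
  simp only [integral_const_mul, ← mul_sub] at h2
  rwa [abs_mul, abs_of_pos (inv_pos.2 hL'), inv_mul_le_iff₀ hL'] at h2

namespace IsTraceModel

open Polynomial

section

variable {E 𝒜 ι : Type*} [NormedAddCommGroup E] [NormedSpace ℝ E]
  [MeasurableSpace E] [BorelSpace E] [NormedRing 𝒜] [NormedAlgebra ℝ 𝒜] [Fintype ι] {μ : Measure E}
  {v : ι → E} {ℓ : ι → E →L[ℝ] ℝ} {A : E →L[ℝ] 𝒜} {Tr : 𝒜 →L[ℝ] ℝ} {n κ ρ : ℝ}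
  [SecondCountableTopology E] [IsProbabilityMeasure μ]

/-- With `w` the centered trace of `T_2`, the loop equation is the exact identity
`∫ w g(w) = ∫ (ρ / 2 + (ρ / n) (w + κ / 2)) g'(w)`, here for `g(w) = exp(-w² / 2)`. The term
`(ρ / n) w` makes the law skew. -/
lemma integral_mul_exp_neg_sq_chebyshevVector (h : IsTraceModel μ v ℓ A Tr n κ ρ) (hρ : 0 < ρ)
    {d : ℕ} {j : Fin d} (hj : (j : ℕ) = 1) :
    (1 + ρ / 2 + ρ * κ / (2 * n)) * ∫ x, chebyshevVector μ A Tr n d x j *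
        Real.exp (-(chebyshevVector μ A Tr n d x j) ^ 2 / 2) ∂μ =
      -(ρ / n * ∫ x, (chebyshevVector μ A Tr n d x j) ^ 2 *
        Real.exp (-(chebyshevVector μ A Tr n d x j) ^ 2 / 2) ∂μ) := by
  have hI := h.finiteMoments
  have hn := h.ne_zero
  have hW := tame_chebyshevVector μ A Tr n d
  set w : E → ℝ := fun x => chebyshevVector μ A Tr n d x j with hw
  have hwt : Tame w := (Tame.clm (EuclideanSpace.proj (𝕜 := ℝ) j :
    EuclideanSpace ℝ (Fin d) →L[ℝ] ℝ)).comp hW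
  have het : Tame fun x => Real.exp (-(w x) ^ 2 / 2) := (bddC1_exp_neg_sq j).tame.comp hW
  have hU : Chebyshev.U ℝ ((1 : ℕ) : ℤ) = (2 : ℝ) • (X * 1) := by
    rw [smul_eq_C_mul, mul_one, Nat.cast_one, Chebyshev.U_one]
    rfl
  have hloop : ∀ x, loopError A Tr n κ 1 x = 0 := fun x => by
    rw [loopError, hU, map_smul, dividedDiff_X_mul, dividedDiff_one, h.centeredEval_one, mul_one,
      derivative_smul, derivative_X, map_smul, map_smul, h.centeredEval_one]
    simp
  have hT2 : ∫ x, centeredEval Tr n (A x) (Chebyshev.T ℝ (1 + 1 : ℕ)) ∂μ = κ / 2 := by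
    have h0 := h.integral_chebyshev_mul 1 (Tame.const (1 : ℝ))
    simp only [mul_one, fderiv_fun_const, Pi.zero_apply, _root_.zero_apply, mul_zero,
      Finset.sum_const_zero, integral_zero, add_zero, hloop, zero_add, integral_const,
      probReal_univ, one_smul] at h0
    rw [h0, hU, map_smul, mul_one, derivative_X, map_smul, semicircle_one]
    norm_num
    ring
  have hgrad : ∀ x, gradientError A Tr n ρ 1 1 x = ρ / n * (w x + κ / 2) := fun x => by
    have hUU : Chebyshev.U ℝ ((1 : ℕ) : ℤ) * Chebyshev.U ℝ ((1 : ℕ) : ℤ) =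
        (2 : ℝ) • Chebyshev.T ℝ ((1 + 1 : ℕ) : ℤ) + (2 : ℝ) • 1 := by
      rw [smul_eq_C_mul, smul_eq_C_mul, show (C (2 : ℝ) : ℝ[X]) = 2 from rfl, Nat.cast_one,
        Chebyshev.U_one, show ((1 + 1 : ℕ) : ℤ) = 2 from rfl, Chebyshev.T_two]
      ring
    have hwx : w x = centeredEval Tr n (A x) (Chebyshev.T ℝ (1 + 1 : ℕ)) - κ / 2 := by
      rw [← hT2]
      simp only [hw, chebyshevVector, hj]
    rw [gradientError, hUU, map_add, map_smul, map_smul, h.centeredEval_one, hwx]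
    simp only [smul_eq_mul]
    field_simp
    norm_num
    ring
  have hS := h.steinIdentity hρ d _ (bddC1_exp_neg_sq j) j
  simp only [(hasFDerivAt_exp_neg_sq j _).fderiv, hj, hloop, integral_zero, sub_zero, zero_mul,
    add_zero, _root_.smul_apply, PiLp.proj_apply, PiLp.single_apply, smul_eq_mul] at hS
  rw [Finset.sum_eq_single j (fun i _ hi => by simp [Ne.symm hi]) (by simp), hj,
    Real.sq_sqrt (by positivity)] at hS
  simp only [hgrad, if_true, mul_one] at hS
  have hE1 := (hwt.mul het).integrable hI
  have hE2 := ((hwt.pow 2).mul het).integrable hI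
  have h1 : ∫ x, ρ / n * (w x + κ / 2) * -(w x * Real.exp (-(w x) ^ 2 / 2)) ∂μ =
      -(ρ / n) * ∫ x, w x ^ 2 * Real.exp (-(w x) ^ 2 / 2) ∂μ -
        ρ * κ / (2 * n) * ∫ x, w x * Real.exp (-(w x) ^ 2 / 2) ∂μ := by
    rw [← integral_const_mul, ← integral_const_mul,
      ← integral_sub (hE2.const_mul _) (hE1.const_mul _)]
    congr 1
    ext x
    field_simp
    ring
  rw [h1, integral_neg] at hS
  push_cast at hS
  linear_combination hS

/-- The rate `1 / n` cannot be improved. If `D` is the distance, the integrals of `w exp(-w² / 2)`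
and `w² exp(-w² / 2)` are within `2 D` and `4 D` of their values `0` and `S > 0` for the normal law,
and `integral_mul_exp_neg_sq_chebyshevVector` turns this into a lower bound for `D`. -/
theorem le_wassersteinDist (h : IsTraceModel μ v ℓ A Tr n κ ρ) (hρ : 0 < ρ) {d : ℕ} {j : Fin d}
    (hj : (j : ℕ) = 1) (s : Fin d → ℝ) :
    ENNReal.ofReal ((ρ * ∫ z, (diagScale s z j) ^ 2 * Real.exp (-(diagScale s z j) ^ 2 / 2)
        ∂(stdNormal d)) / (2 + 5 * ρ + ρ * |κ|) / n) ≤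
      wassersteinDist (μ.map (chebyshevVector μ A Tr n d)) ((stdNormal d).map (diagScale s)) := by
  by_cases htop : wassersteinDist (μ.map (chebyshevVector μ A Tr n d))
      ((stdNormal d).map (diagScale s)) = ⊤
  · rw [htop]
    exact le_top
  have hn := h.one_le
  have hW := (tame_chebyshevVector μ A Tr n d).continuous.measurable
  have hD := (diagScale s).continuous.measurable
  have hf1 := lipschitzWith_mul_exp_neg_sq.comp (lipschitzWith_apply j)
  have hf2 := lipschitzWith_sq_mul_exp_neg_sq.comp (lipschitzWith_apply j)
  have h1 := abs_integral_sub_le_wassersteinDist htop (by norm_num) hf1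
  have h2 := abs_integral_sub_le_wassersteinDist htop (by norm_num) hf2
  rw [integral_map hW.aemeasurable hf1.continuous.aestronglyMeasurable,
    integral_map hD.aemeasurable hf1.continuous.aestronglyMeasurable] at h1
  rw [integral_map hW.aemeasurable hf2.continuous.aestronglyMeasurable,
    integral_map hD.aemeasurable hf2.continuous.aestronglyMeasurable] at h2
  simp only [Function.comp_apply, integral_mul_exp_neg_sq, sub_zero, mul_one] at h1 h2
  have key := h.integral_mul_exp_neg_sq_chebyshevVector hρ hj
  refine ENNReal.ofReal_le_of_le_toReal ?_
  set D := (wassersteinDist (μ.map (chebyshevVector μ A Tr n d))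
    ((stdNormal d).map (diagScale s))).toReal
  have hD0 : 0 ≤ D := ENNReal.toReal_nonneg
  set S := ∫ z, (diagScale s z j) ^ 2 * Real.exp (-(diagScale s z j) ^ 2 / 2) ∂(stdNormal d)
  set a := ∫ x, chebyshevVector μ A Tr n d x j *
    Real.exp (-(chebyshevVector μ A Tr n d x j) ^ 2 / 2) ∂μ
  set b := ∫ x, (chebyshevVector μ A Tr n d x j) ^ 2 *
    Real.exp (-(chebyshevVector μ A Tr n d x j) ^ 2 / 2) ∂μ
  norm_num at h1 h2
  have h3 : S - 4 * D ≤ b := by linarith [(abs_le.1 h2).1]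
  have h4 : ρ * b = -((n * (1 + ρ / 2) + ρ * κ / 2) * a) := by
    field_simp at key
    linear_combination (1 / 2) * key
  have h5 : -((n * (1 + ρ / 2) + ρ * κ / 2) * a) ≤ n * (1 + ρ / 2 + ρ * |κ| / 2) * (2 * D) := by
    refine (neg_le_abs _).trans ?_
    rw [abs_mul]
    refine mul_le_mul ?_ h1 (abs_nonneg _) (by positivity)
    refine (abs_add_le _ _).trans ?_
    rw [abs_of_nonneg (by positivity : 0 ≤ n * (1 + ρ / 2)), abs_div, abs_mul, abs_of_pos hρ,
      abs_two]
    nlinarith [mul_nonneg hρ.le (abs_nonneg κ)]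
  rw [div_div, div_le_iff₀ (by positivity)]
  nlinarith [mul_nonneg hρ.le hD0, mul_nonneg (mul_nonneg hρ.le hD0) (sub_nonneg.2 hn),
    mul_le_mul_of_nonneg_left h3 hρ.le]

end

end IsTraceModel

/-! ### The Gaussian ensembles -/

/-- The coordinate identities of the standard real basis `u` of `𝔽 = ℝ, ℂ, ℍ` that enter the
contraction rules of the ensembles; `re` is the real part. -/
structure IsStandardBasis {𝔽 : Type*} [Ring 𝔽] [StarRing 𝔽] [Algebra ℝ 𝔽] {β : ℕ}
    (re : 𝔽 →ₗ[ℝ] ℝ) (u : Fin β → 𝔽) : Prop where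
  re_one : re 1 = 1
  re_mul_comm : ∀ p q, re (p * q) = re (q * p)
  re_star : ∀ q, re (star q) = re q
  eq_algebraMap : ∀ q, star q = q → q = algebraMap ℝ 𝔽 (re q)
  sum_mul_mul : ∀ q, ∑ c, u c * q * u c = (2 - β : ℝ) • star q
  sum_mul_star : ∑ c, u c * star (u c) = (β : ℝ) • (1 : 𝔽)
  sum_star_mul : ∑ c, star (u c) * u c = (β : ℝ) • (1 : 𝔽)
  sum_re_mul_re : ∀ p q, ∑ c, re (p * u c) * re (q * u c) = re (p * star q)

lemma isStandardBasis_real : IsStandardBasis (LinearMap.id : ℝ →ₗ[ℝ] ℝ) ![1] where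
  re_one := rfl
  re_mul_comm := fun p q => mul_comm p q
  re_star := fun q => rfl
  eq_algebraMap := fun q _ => rfl
  sum_mul_mul := fun q => by
    simp
    norm_num
  sum_mul_star := by simp
  sum_star_mul := by simp
  sum_re_mul_re := fun p q => by simp

lemma isStandardBasis_complex : IsStandardBasis Complex.reLm ![1, Complex.I] where
  re_one := rfl
  re_mul_comm := fun p q => by rw [mul_comm]
  re_star := fun q => rfl
  eq_algebraMap := fun q hq => (Complex.conj_eq_iff_re.1 hq).symm
  sum_mul_mul := fun q => by
    simp [mul_right_comm Complex.I q]
  sum_mul_star := by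
    simp [Fin.sum_univ_two]
    norm_num
  sum_star_mul := by
    simp [Fin.sum_univ_two]
    norm_num
  sum_re_mul_re := fun p q => by
    simp [Fin.sum_univ_two]

/-- The real part as a linear functional on the quaternions. -/
noncomputable def quaternionRe : ℍ[ℝ] →ₗ[ℝ] ℝ where
  toFun q := q.re
  map_add' _ _ := rfl
  map_smul' _ _ := rfl

lemma quaternionRe_apply (q : ℍ[ℝ]) : quaternionRe q = q.re := rfl

lemma isStandardBasis_quaternion_units {i j k : ℍ[ℝ]}
    (hi : i.re = 0 ∧ i.imI = 1 ∧ i.imJ = 0 ∧ i.imK = 0)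
    (hj : j.re = 0 ∧ j.imI = 0 ∧ j.imJ = 1 ∧ j.imK = 0)
    (hk : k.re = 0 ∧ k.imI = 0 ∧ k.imJ = 0 ∧ k.imK = 1) :
    IsStandardBasis quaternionRe ![1, i, j, k] where
  re_one := rfl
  re_mul_comm := fun p q => by
    simp only [quaternionRe_apply, Quaternion.re_mul]
    ring
  re_star := fun q => Quaternion.re_star q
  eq_algebraMap := fun q hq => Quaternion.star_eq_self.1 hq
  sum_mul_mul := fun q => by
    ext <;> simp [Fin.sum_univ_four, Quaternion.re_mul, Quaternion.imI_mul, Quaternion.imJ_mul,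
      Quaternion.imK_mul, hi, hj, hk] <;> ring
  sum_mul_star := by
    ext <;> simp [Fin.sum_univ_four, Quaternion.re_mul, Quaternion.imI_mul, Quaternion.imJ_mul,
      Quaternion.imK_mul, hi, hj, hk]
    norm_num
  sum_star_mul := by
    ext <;> simp [Fin.sum_univ_four, Quaternion.re_mul, Quaternion.imI_mul, Quaternion.imJ_mul,
      Quaternion.imK_mul, hi, hj, hk]
    norm_num
  sum_re_mul_re := fun p q => by
    simp [quaternionRe_apply, Fin.sum_univ_four, Quaternion.re_mul, hi, hj, hk]

lemma isStandardBasis_quaternion : IsStandardBasis quaternionRe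
    ![1, ⟨0, 1, 0, 0⟩, ⟨0, 0, 1, 0⟩, ⟨0, 0, 0, 1⟩] :=
  isStandardBasis_quaternion_units ⟨rfl, rfl, rfl, rfl⟩ ⟨rfl, rfl, rfl, rfl⟩ ⟨rfl, rfl, rfl, rfl⟩

namespace IsStandardBasis

section Algebra

open Matrix

lemma sum_re_mul_eq_re_trace {𝔽 : Type*} [Ring 𝔽] [Algebra ℝ 𝔽] (re : 𝔽 →ₗ[ℝ] ℝ) {n : ℕ}
    (M N : Matrix (Fin n) (Fin n) 𝔽) :
    ∑ i, ∑ j, re (M j i * N i j) = re (trace (M * N)) := by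
  rw [Finset.sum_comm, trace, map_sum]
  simp [mul_apply, map_sum]

variable {𝔽 : Type*} [Ring 𝔽] [StarRing 𝔽] [Algebra ℝ 𝔽] {β : ℕ}
  {re : 𝔽 →ₗ[ℝ] ℝ} {u : Fin β → 𝔽} {n : ℕ}

/-- The matrix of the ensemble whose only nonzero coordinate, up to normalization, is the one with
index `a`. -/
def pairMatrix (u : Fin β → 𝔽) (n : ℕ) (a : Fin n × Fin n × Fin β) : Matrix (Fin n) (Fin n) 𝔽 :=
  Matrix.single a.1 a.2.1 (u a.2.2) + Matrix.single a.2.1 a.1 (star (u a.2.2))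

lemma sum_star_mul_mul [StarModule ℝ 𝔽] (h : IsStandardBasis re u) (q : 𝔽) :
    ∑ c, star (u c) * q * star (u c) = (2 - β : ℝ) • star q := by
  have h1 := congrArg star (h.sum_mul_mul (star q))
  simpa [star_sum, mul_assoc] using h1

/-- The contraction rule for two Gaussian factors in one trace. -/
lemma sum_trace_pair [StarModule ℝ 𝔽] (h : IsStandardBasis re u) {M N : Matrix (Fin n) (Fin n) 𝔽}
    (hM : M.IsHermitian) :
    ∑ a, re (trace (N * pairMatrix u n a * M * pairMatrix u n a)) =
      2 * β * (re (trace N) * re (trace M)) + 2 * (2 - β) * re (trace (N * M)) := by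
  have hMe : ∀ i j, star (M i j) = M j i := fun i j => hM.apply j i
  have hMd : ∀ i, M i i = algebraMap ℝ 𝔽 (re (M i i)) := fun i => h.eq_algebraMap _ (hMe i i)
  have hterm : ∀ a : Fin n × Fin n × Fin β,
      re (trace (N * pairMatrix u n a * M * pairMatrix u n a)) =
      re (N a.2.1 a.1 * (u a.2.2 * M a.2.1 a.1 * u a.2.2)) +
      re (M a.2.1 a.2.1) * re (N a.1 a.1 * (u a.2.2 * star (u a.2.2))) +
      (re (M a.1 a.1) * re (N a.2.1 a.2.1 * (star (u a.2.2) * u a.2.2)) +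
      re (N a.1 a.2.1 * (star (u a.2.2) * M a.1 a.2.1 * star (u a.2.2)))) := by
    rintro ⟨i, j, c⟩
    have hc : ∀ k (p q : 𝔽), p * M k k * q = re (M k k) • (p * q) := fun k p q => by
      nth_rewrite 1 [hMd k]
      rw [← Algebra.commutes, mul_assoc, Algebra.smul_def]
    have hs : ∀ (k l k' l' : Fin n) (p q : 𝔽),
        re (trace (N * single k l p * M * single k' l' q)) = re (N l' k * (p * M l k' * q)) :=
      fun k l k' l' p q => by
        rw [mul_assoc N, mul_assoc N, single_mul_mul_single, trace_mul_single, op_smul_eq_mul]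
    simp only [pairMatrix, add_mul, mul_add, trace_add, map_add, hs]
    rw [hc, hc, mul_smul_comm, mul_smul_comm, map_smul, map_smul]
    simp only [smul_eq_mul]
    ring
  have hr : ∀ i j (q : 𝔽), re (N i j * ((2 - β : ℝ) • q)) = (2 - β) * re (N i j * q) := by simp
  have hb : ∀ i j, re (N i j * ((β : ℝ) • (1 : 𝔽))) = β * re (N i j) := by simp
  have htr : ∀ P : Matrix (Fin n) (Fin n) 𝔽, re (trace P) = ∑ i, re (P i i) := by
    simp [trace, map_sum]
  have h1 : ∑ i, ∑ j, re (N i j * M j i) = re (trace (N * M)) := by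
    rw [Finset.sum_comm, sum_re_mul_eq_re_trace]
  have hf : ∀ (f : Fin β → 𝔽) i j, ∑ c, re (N i j * f c) = re (N i j * ∑ c, f c) :=
    fun f i j => by rw [Finset.mul_sum, map_sum]
  simp only [hterm, Fintype.sum_prod_type, Finset.sum_add_distrib, hf, ← Finset.mul_sum,
    h.sum_mul_mul, h.sum_star_mul_mul, h.sum_mul_star, h.sum_star_mul, hMe, hr, hb, h1,
    sum_re_mul_eq_re_trace]
  rw [htr N, htr M]
  simp only [← Finset.mul_sum, ← Finset.sum_mul]
  ring

/-- The contraction rule for two Gaussian factors in two traces. -/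
lemma sum_trace_mul_trace_pair (h : IsStandardBasis re u) {M N : Matrix (Fin n) (Fin n) 𝔽}
    (hM : M.IsHermitian) (hN : N.IsHermitian) :
    ∑ a, re (trace (M * pairMatrix u n a)) * re (trace (N * pairMatrix u n a)) =
      4 * re (trace (M * N)) := by
  have hterm : ∀ {P : Matrix (Fin n) (Fin n) 𝔽}, P.IsHermitian → ∀ a : Fin n × Fin n × Fin β,
      re (trace (P * pairMatrix u n a)) = 2 * re (P a.2.1 a.1 * u a.2.2) := by
    rintro P hP ⟨i, j, c⟩
    simp only [pairMatrix, mul_add, trace_add, trace_mul_single, op_smul_eq_mul, map_add]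
    rw [← hP.apply i j, ← star_mul, h.re_star, h.re_mul_comm (u c)]
    ring
  calc _ = ∑ i, ∑ j, 4 * ∑ c, re (M j i * u c) * re (N j i * u c) := by
        simp only [hterm hM, hterm hN, Fintype.sum_prod_type, Finset.mul_sum]
        congr! 3
        ring
    _ = _ := by
        simp only [h.sum_re_mul_re, hN.apply, ← Finset.mul_sum, sum_re_mul_eq_re_trace]

end Algebra

end IsStandardBasis

/-! ### The ensembles as trace models -/

section Coordinates

instance (β n : ℕ) : IsProbabilityMeasure (normalCoords β n) := by
  unfold normalCoords
  infer_instance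

/-- The basis vector of the coordinate with index `a`. -/
def coordVector {β n : ℕ} (a : Fin n × Fin n × Fin β) : Fin n → Fin n → Fin β → ℝ :=
  Pi.single a.1 (Pi.single a.2.1 (Pi.single a.2.2 1))

/-- The coordinate functional with index `a`. -/
def coordFunctional {β n : ℕ} (a : Fin n × Fin n × Fin β) : (Fin n → Fin n → Fin β → ℝ) →L[ℝ] ℝ :=
  (((ContinuousLinearMap.id ℝ ℝ).comp (.proj a.2.2)).comp (.proj a.2.1)).comp (.proj a.1)

lemma coordFunctional_apply {β n : ℕ} (a : Fin n × Fin n × Fin β) (x : Fin n → Fin n → Fin β → ℝ) :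
    coordFunctional a x = x a.1 a.2.1 a.2.2 := rfl

lemma coordFunctional_coordVector {β n : ℕ} (a b : Fin n × Fin n × Fin β) :
    coordFunctional a (coordVector b) = if a = b then 1 else 0 := by
  obtain ⟨i, j, c⟩ := a
  obtain ⟨i', j', c'⟩ := b
  simp only [coordFunctional_apply, coordVector, Pi.single_apply, Prod.mk.injEq]
  by_cases hi : i = i' <;> by_cases hj : j = j' <;> simp [hi, hj, Pi.single_apply]

lemma finiteMoments_normalCoords (β n : ℕ) : FiniteMoments (normalCoords β n) :=
  .pi fun _ => .pi fun _ => .pi fun _ => finiteMoments_gaussianReal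

lemma integrationByParts_normalCoords {β n : ℕ} (a : Fin n × Fin n × Fin β) :
    IntegrationByParts (normalCoords β n) (coordVector a) (coordFunctional a) :=
  .pi (fun _ => .pi fun _ => .pi fun _ => finiteMoments_gaussianReal)
    (.pi (fun _ => .pi fun _ => finiteMoments_gaussianReal)
      (.pi (fun _ => finiteMoments_gaussianReal) integrationByParts_gaussianReal))

end Coordinates

section Ensemble

open Matrix IsStandardBasis

variable {𝔽 : Type} [Ring 𝔽] [StarRing 𝔽] [Algebra ℝ 𝔽] {β : ℕ}

/-- The normalized matrix `A / (2√n)` as a linear function of the coordinates. -/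
noncomputable def normalizedEnsemble (u : Fin β → 𝔽) (n : ℕ) :
    (Fin n → Fin n → Fin β → ℝ) →ₗ[ℝ] Matrix (Fin n) (Fin n) 𝔽 :=
  ((2 * √n)⁻¹ * (√(2 * β))⁻¹) •
    ∑ a, (coordFunctional a).toLinearMap.smulRight (pairMatrix u n a)

/-- The real part of the trace. -/
def reTrace {𝔽 : Type} [Ring 𝔽] [Algebra ℝ 𝔽] (re : 𝔽 →ₗ[ℝ] ℝ) (n : ℕ) :
    Matrix (Fin n) (Fin n) 𝔽 →ₗ[ℝ] ℝ :=
  re ∘ₗ traceLinearMap (Fin n) ℝ 𝔽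

lemma reTrace_apply {𝔽 : Type} [Ring 𝔽] [Algebra ℝ 𝔽] (re : 𝔽 →ₗ[ℝ] ℝ) (n : ℕ)
    (M : Matrix (Fin n) (Fin n) 𝔽) : reTrace re n M = re (trace M) := rfl

lemma normalizedEnsemble_coordVector (u : Fin β → 𝔽) (n : ℕ) (a : Fin n × Fin n × Fin β) :
    normalizedEnsemble u n (coordVector a) =
      ((2 * √n)⁻¹ * (√(2 * β))⁻¹) • pairMatrix u n a := by
  simp [normalizedEnsemble, coordFunctional_coordVector]

lemma normalizedEnsemble_eq_sum (u : Fin β → 𝔽) (n : ℕ) (x : Fin n → Fin n → Fin β → ℝ) :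
    normalizedEnsemble u n x =
      ∑ a, coordFunctional a x • normalizedEnsemble u n (coordVector a) := by
  simp only [normalizedEnsemble_coordVector, smul_comm (coordFunctional _ x), ← Finset.smul_sum]
  simp [normalizedEnsemble]

lemma coordMatrix_eq_sum {𝔽 : Type} [Ring 𝔽] [Algebra ℝ 𝔽] [StarRing 𝔽] (u : Fin β → 𝔽) (n : ℕ)
    (x : Fin n → Fin n → Fin β → ℝ) :
    coordMatrix u n x =
      ∑ a : Fin n × Fin n × Fin β, x a.1 a.2.1 a.2.2 • single a.1 a.2.1 (u a.2.2) := by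
  rw [matrix_eq_sum_single (coordMatrix u n x)]
  simp only [Fintype.sum_prod_type, coordMatrix, of_apply, smul_single]
  exact Finset.sum_congr rfl fun i _ => Finset.sum_congr rfl fun j _ =>
    map_sum (singleAddMonoidHom i j) _ _

lemma IsStandardBasis.reTrace_one {re : 𝔽 →ₗ[ℝ] ℝ} {u : Fin β → 𝔽}
    (h : IsStandardBasis re u) (n : ℕ) : reTrace re n 1 = n := by
  rw [reTrace_apply, trace_one, Fintype.card_fin, ← nsmul_one, map_nsmul, h.re_one, nsmul_one]

lemma IsStandardBasis.reTrace_mul_comm {re : 𝔽 →ₗ[ℝ] ℝ} {u : Fin β → 𝔽}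
    (h : IsStandardBasis re u) (n : ℕ) (M N : Matrix (Fin n) (Fin n) 𝔽) :
    reTrace re n (M * N) = reTrace re n (N * M) := by
  simp only [reTrace_apply, trace, diag_apply, mul_apply, map_sum]
  rw [Finset.sum_comm]
  exact Finset.sum_congr rfl fun i _ => Finset.sum_congr rfl fun j _ => h.re_mul_comm _ _

variable [StarModule ℝ 𝔽]

lemma normalizedEnsemble_apply (u : Fin β → 𝔽) (n : ℕ) (x : Fin n → Fin n → Fin β → ℝ) :
    normalizedEnsemble u n x = (2 * √n)⁻¹ • ensembleMatrix u n x := by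
  rw [normalizedEnsemble, ensembleMatrix, coordMatrix_eq_sum, conjTranspose_sum,
    ← Finset.sum_add_distrib]
  simp [pairMatrix, conjTranspose_single, coordFunctional_apply, mul_smul]

lemma isHermitian_normalizedEnsemble (u : Fin β → 𝔽) (n : ℕ) (x : Fin n → Fin n → Fin β → ℝ) :
    (normalizedEnsemble u n x).IsHermitian := by
  have hp : ∀ a, (pairMatrix u n a)ᴴ = pairMatrix u n a := fun a => by
    simp [pairMatrix, conjTranspose_single, add_comm]
  simp [IsHermitian, normalizedEnsemble, conjTranspose_sum, conjTranspose_smul, hp]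

lemma sq_ensemble_normalization {n : ℕ} (hn : 1 ≤ n) (hβ : 0 < β) :
    ((2 * √n)⁻¹ * (√(2 * β))⁻¹) * ((2 * √n)⁻¹ * (√(2 * β))⁻¹) = 1 / (8 * n * β : ℝ) := by
  have h1 : √(n : ℝ) ^ 2 = n := Real.sq_sqrt (by positivity)
  have h2 : √(2 * β : ℝ) ^ 2 = 2 * β := Real.sq_sqrt (by positivity)
  calc _ = 1 / (4 * √(n : ℝ) ^ 2 * √(2 * β : ℝ) ^ 2) := by
        field_simp
        norm_num
    _ = _ := by
        rw [h1, h2]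
        congr 1
        ring

variable {re : 𝔽 →ₗ[ℝ] ℝ} {u : Fin β → 𝔽}

lemma IsStandardBasis.sum_reTrace_mul (h : IsStandardBasis re u) (hβ : 0 < β) {n : ℕ} (hn : 1 ≤ n)
    (x : Fin n → Fin n → Fin β → ℝ) (a b : ℕ) :
    ∑ i, reTrace re n (normalizedEnsemble u n x ^ a * normalizedEnsemble u n (coordVector i) *
      normalizedEnsemble u n x ^ b * normalizedEnsemble u n (coordVector i)) =
    1 / (4 * n) * (reTrace re n (normalizedEnsemble u n x ^ a) *
      reTrace re n (normalizedEnsemble u n x ^ b) +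
      (2 / β - 1) * reTrace re n (normalizedEnsemble u n x ^ (a + b))) := by
  have hβ' : (0 : ℝ) < β := by exact_mod_cast hβ
  have hn' : (0 : ℝ) < n := by exact_mod_cast hn
  simp only [normalizedEnsemble_coordVector, mul_smul_comm, smul_mul_assoc, smul_smul,
    sq_ensemble_normalization hn hβ, map_smul, ← Finset.smul_sum, reTrace_apply]
  rw [h.sum_trace_pair ((isHermitian_normalizedEnsemble u n x).pow b), ← pow_add]
  simp only [smul_eq_mul]
  field_simp
  ring

lemma IsStandardBasis.sum_reTrace_mul_reTrace (h : IsStandardBasis re u) (hβ : 0 < β) {n : ℕ}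
    (hn : 1 ≤ n) (x : Fin n → Fin n → Fin β → ℝ) (a b : ℕ) :
    ∑ i, reTrace re n (normalizedEnsemble u n x ^ a * normalizedEnsemble u n (coordVector i)) *
      reTrace re n (normalizedEnsemble u n x ^ b * normalizedEnsemble u n (coordVector i)) =
    (2 / β) / (4 * n) * reTrace re n (normalizedEnsemble u n x ^ (a + b)) := by
  have hβ' : (0 : ℝ) < β := by exact_mod_cast hβ
  have hn' : (0 : ℝ) < n := by exact_mod_cast hn
  simp only [normalizedEnsemble_coordVector, mul_smul_comm, map_smul, smul_mul_assoc,
    smul_smul, sq_ensemble_normalization hn hβ, ← Finset.smul_sum, reTrace_apply]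
  rw [h.sum_trace_mul_trace_pair ((isHermitian_normalizedEnsemble u n x).pow a)
    ((isHermitian_normalizedEnsemble u n x).pow b), ← pow_add]
  simp only [smul_eq_mul]
  field_simp
  ring

end Ensemble

section TraceModel

attribute [local instance] Matrix.linftyOpNormedRing Matrix.linftyOpNormedAlgebra

variable {𝔽 : Type} [NormedRing 𝔽] [StarRing 𝔽] [NormedAlgebra ℝ 𝔽] {β : ℕ} [StarModule ℝ 𝔽]
  [FiniteDimensional ℝ 𝔽] {re : 𝔽 →ₗ[ℝ] ℝ} {u : Fin β → 𝔽}

lemma IsStandardBasis.isTraceModel (h : IsStandardBasis re u) (hβ : 0 < β) {n : ℕ} (hn : 1 ≤ n) :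
    IsTraceModel (normalCoords β n) coordVector coordFunctional
      (normalizedEnsemble u n).toContinuousLinearMap (reTrace re n).toContinuousLinearMap
      n (2 / β - 1) (2 / β) where
  finiteMoments := finiteMoments_normalCoords β n
  ibp := integrationByParts_normalCoords
  expand := normalizedEnsemble_eq_sum u n
  one_le := by exact_mod_cast hn
  trace_one := h.reTrace_one n
  trace_comm := h.reTrace_mul_comm n
  sum_trace_mul := h.sum_reTrace_mul hβ hn
  sum_mul_trace := h.sum_reTrace_mul_reTrace hβ hn

/-- The centering makes the semicircle term of `centeredEval` disappear. -/
lemma centeredTracesLaw_eq_map_chebyshevVector (h : IsStandardBasis re u) (hβ : 0 < β) {n : ℕ}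
    (hn : 1 ≤ n) (d : ℕ) :
    centeredTracesLaw re u n d = (normalCoords β n).map
      (IsTraceModel.chebyshevVector (normalCoords β n)
        (normalizedEnsemble u n).toContinuousLinearMap
        (reTrace re n).toContinuousLinearMap n d) := by
  have hM := h.isTraceModel hβ hn
  have hT : ∀ k x, chebyshevTrace re k n (ensembleMatrix u n x) =
      IsTraceModel.traceEval (reTrace re n).toContinuousLinearMap
        ((normalizedEnsemble u n).toContinuousLinearMap x) (Polynomial.Chebyshev.T ℝ (k : ℤ)) :=
    fun k x => by
      rw [chebyshevTrace, ← normalizedEnsemble_apply]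
      rfl
  rw [centeredTracesLaw]
  congr 1
  ext x j
  have hi := (IsTraceModel.tame_traceEval (reTrace re n).toContinuousLinearMap
    (normalizedEnsemble u n).toContinuousLinearMap
    (Polynomial.Chebyshev.T ℝ ((j + 1 : ℕ) : ℤ))).integrable hM.finiteMoments
  simp only [centeredTraces, hT, IsTraceModel.chebyshevVector, IsTraceModel.centeredEval,
    LinearMap.sub_apply, LinearMap.smul_apply]
  rw [integral_sub hi (integrable_const _), integral_const, probReal_univ, one_smul,
    sub_sub_sub_cancel_right]
  rfl

lemma limitLaw_eq_map_diagScale (d : ℕ) {s ρ : ℝ} (hs : 0 ≤ s) (hρ : s ^ 2 = ρ) :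
    limitLaw d s = (stdNormal d).map (diagScale fun j => √(ρ * ((j : ℕ) + 1) / 4)) := by
  rw [limitLaw]
  congr 1
  ext z j
  simp only [diagScale_apply]
  rw [← hρ, mul_div_assoc, Real.sqrt_mul (sq_nonneg s), Real.sqrt_sq hs,
    Real.sqrt_div' _ (by norm_num), show (4 : ℝ) = 2 ^ 2 by norm_num, Real.sqrt_sq zero_le_two]

theorem IsStandardBasis.exists_wassersteinDist_le (h : IsStandardBasis re u) (hβ : 0 < β) {s : ℝ}
    (hs : 0 ≤ s) (hsβ : s ^ 2 = 2 / β) (d : ℕ) :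
    ∃ K : ℝ, 0 < K ∧ ∀ n : ℕ, 1 ≤ n →
      wassersteinDist (centeredTracesLaw re u n d) (limitLaw d s) ≤ ENNReal.ofReal (K / n) := by
  obtain ⟨K, hK, hle⟩ := IsTraceModel.exists_wassersteinDist_le
    (fun n : {n : ℕ // 1 ≤ n} => h.isTraceModel hβ n.2) (by positivity) d
  refine ⟨K, hK, fun n hn => ?_⟩
  rw [centeredTracesLaw_eq_map_chebyshevVector h hβ hn, limitLaw_eq_map_diagScale d hs hsβ]
  exact hle ⟨n, hn⟩

theorem IsStandardBasis.exists_le_wassersteinDist (h : IsStandardBasis re u) (hβ : 0 < β) {s : ℝ}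
    (hs : 0 ≤ s) (hsβ : s ^ 2 = 2 / β) {d : ℕ} (hd : 2 ≤ d) :
    ∃ c : ℝ, 0 < c ∧ ∀ᶠ n : ℕ in atTop,
      ENNReal.ofReal (c / n) ≤ wassersteinDist (centeredTracesLaw re u n d) (limitLaw d s) := by
  have hρ : (0 : ℝ) < 2 / β := by positivity
  have hpos := integral_sq_mul_exp_neg_sq_pos (⟨1, hd⟩ : Fin d)
    (s := fun j => √(2 / β * ((j : ℕ) + 1) / 4)) (by positivity)
  refine ⟨_, div_pos (mul_pos hρ hpos)
    (by positivity : (0 : ℝ) < 2 + 5 * (2 / β) + 2 / β * |2 / (β : ℝ) - 1|), ?_⟩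
  filter_upwards [eventually_ge_atTop 1] with n hn
  rw [centeredTracesLaw_eq_map_chebyshevVector h hβ hn, limitLaw_eq_map_diagScale d hs hsβ]
  exact (h.isTraceModel hβ hn).le_wassersteinDist hρ (j := ⟨1, hd⟩) rfl _

instance : StarModule ℝ ℍ[ℝ] := ⟨fun r q => Quaternion.star_smul r q⟩

end TraceModel

theorem theoremT (d : ℕ) :
    ((∃ K : ℝ, 0 < K ∧ ∀ n : ℕ, 1 ≤ n →
        wassersteinDist (gueLaw n d) (limitLaw d 1) ≤ ENNReal.ofReal (K / n)) ∧
      (∃ K : ℝ, 0 < K ∧ ∀ n : ℕ, 1 ≤ n →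
        wassersteinDist (goeLaw n d) (limitLaw d (Real.sqrt 2)) ≤ ENNReal.ofReal (K / n)) ∧
      (∃ K : ℝ, 0 < K ∧ ∀ n : ℕ, 1 ≤ n →
        wassersteinDist (gseLaw n d) (limitLaw d (1 / Real.sqrt 2)) ≤ ENNReal.ofReal (K / n))) ∧
    (2 ≤ d →
      (∃ c : ℝ, 0 < c ∧ ∀ᶠ n : ℕ in atTop,
        ENNReal.ofReal (c / n) ≤ wassersteinDist (gueLaw n d) (limitLaw d 1)) ∧
      (∃ c : ℝ, 0 < c ∧ ∀ᶠ n : ℕ in atTop,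
        ENNReal.ofReal (c / n) ≤ wassersteinDist (goeLaw n d) (limitLaw d (Real.sqrt 2))) ∧
      (∃ c : ℝ, 0 < c ∧ ∀ᶠ n : ℕ in atTop,
        ENNReal.ofReal (c / n) ≤ wassersteinDist (gseLaw n d) (limitLaw d (1 / Real.sqrt 2)))) := by
  have h2 : (1 : ℝ) ^ 2 = 2 / (2 : ℕ) := by norm_num
  have h1 : √2 ^ 2 = 2 / ((1 : ℕ) : ℝ) := by norm_num
  have h4 : (1 / √2) ^ 2 = 2 / ((4 : ℕ) : ℝ) := by
    rw [div_pow, Real.sq_sqrt zero_le_two]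
    norm_num
  exact ⟨⟨isStandardBasis_complex.exists_wassersteinDist_le two_pos zero_le_one h2 d,
      isStandardBasis_real.exists_wassersteinDist_le one_pos (by positivity) h1 d,
      isStandardBasis_quaternion.exists_wassersteinDist_le four_pos (by positivity) h4 d⟩,
    fun hd => ⟨isStandardBasis_complex.exists_le_wassersteinDist two_pos zero_le_one h2 hd,
      isStandardBasis_real.exists_le_wassersteinDist one_pos (by positivity) h1 hd,
      isStandardBasis_quaternion.exists_le_wassersteinDist four_pos (by positivity) h4 hd⟩⟩
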